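/- Let $N\ge 1$ be an integer, $P_N=\{1,\dots,N\}$, $\mathrm{e}(z)=e^{2\pi i z}$, $\mathcal{C}=\{z\in\mathbb{C}: \mathrm{Re}(z)>0\}\cup\{iy: y>0\}$, and write $\mathrm{Tr}(v,\Lambda)=\sum_{\ell\in\Lambda}v_\ell$ for $\Lambda\subseteq P_N$. Let $\mathbb{D}_N$ be the set of $\delta=(w,a,\theta)\in\mathbb{C}\times\mathbb{C}^N\times\mathbb{R}^N$ with $\theta_\ell\notin\mathbb{Z}$ whenever $a_\ell=0$. On $\mathbb{D}_N$ put $\pi(w,a,\theta)=w-\mathrm{Tr}(a,\{\ell: -a_\ell\in\mathcal{C}\})$ and $$F_N(u,\delta)=e^{-uw}\prod_{\ell=1}^N\big(1-\mathrm{e}(\theta_\ell)e^{-ua_\ell}\big)^{-1}.$$ For $\Lambda\subseteq P_N$, $\sigma\in S_N$, $\alpha\in\mathbb{C}^*$ let $M_\alpha(w,a,\theta)=(\alpha w,\alpha a,\theta)$, $R_\sigma(w,a,\theta)=(w,(a_{\sigma^{-1}(\ell)})_\ell,(\theta_{\sigma^{-1}(\ell)})_\ell)$, and let $T_\Lambda(w,a,\theta)=(w-\mathrm{Tr}(a,\Lambda),a',\theta')$,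 where $a',\theta'$ arise from $a,\theta$ by changing the signs of the entries indexed by $\Lambda$. The transformations $g=T_\Lambda R_\sigma M_\alpha$ form a group $G_N$ acting on $\mathbb{D}_N$, and $\Lambda,\sigma,\alpha$ are determined by $g$; put $\psi_g=\arg\alpha\in(-\pi,\pi]$ and $$J_g(s,\theta)=(-1)^{|\Lambda|}\,\mathrm{e}\big(\mathrm{Tr}(\theta,\sigma^{-1}[\Lambda])\big)\,\alpha^{-s}$$ (principal branch). Let $\widetilde{\mathcal{D}}^{\mathbb{C}^*}_N=\{\delta\in\mathbb{D}_N:\pi(M_\alpha\delta)\in\mathcal{C}\text{ for all }\alpha\in\mathbb{C}^*\}$. Let $\mathcal{E}$ be the set of functions $\epsilon:\mathbb{D}_N\to(0,\infty)$ such that for all $\delta$ and $\ell$ the equation $\mathrm{e}(\theta_\ell)=e^{ua_\ell}$ has no solution with $0<|u|\le\epsilon(\delta)$. For $\epsilon\in\mathcal{E}$ let $$\mathcal{L}_{N,\epsilon}(s,\delta)=\frac{1}{\Gamma(s)(\mathrm{e}(s)-1)}\int_{C(\epsilon(\delta))}F_N(u,\delta)u^{s-1}\,du,$$ a function of $s$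 with its removable singularities at integers removed, where $C(r)$ is the Hankel contour running from $+\infty$ to $r$ (with $\arg u=0$), once counterclockwise around the circle $|u|=r$, and back from $r$ to $+\infty$ (with $\arg u=2\pi$). Let $\mathcal{L}_N(s,\delta)=\lim_{\omega\to0^-}\mathcal{L}_{N,\epsilon}(s,M_{e^{i\omega}}\delta)$. For $\psi\in(-\pi,\pi]$ let $\mathcal{P}_\psi(\delta)$ be the set of nonzero poles $u_0$ of $F_N(\cdot,\delta)$ with $\arg u_0\in[0,\psi)$ if $\psi>0$, with $\arg u_0\in[\psi,0)$ if $\psi<0$, and $\mathcal{P}_0(\delta)=\emptyset$. Let $\rho_N^\psi(s,\delta)$ be the $s$-analytic continuation of $$\rho_N^\psi(s,\delta)=\mathrm{sgn}(-\psi)\,2\pi i\lim_{R\to\infty}\sum_{\substack{u_0\in\mathcal{P}_\psi(\delta)\\|u_0|<R}}\mathrm{Res}_{u=u_0}\big(F_N(u,\delta)u^{s-1}\big)\qquad(\mathrm{Re}(s)<1)$$ (principal branch of $u^{s-1}$), where the limit is taken through radii that do not separate close poles: for every $c>0$, it is the limit as $R\to\infty$ through those $R$ for which no two elements of $\mathcal{P}_\psi(\delta)$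 at distance less than $c$ are such that exactly one of them has absolute value less than $R$. **Theorem.** The set $\widetilde{\mathcal{D}}^{\mathbb{C}^*}_N$ is stable under $G_N$. For $s\in\mathbb{C}\smallsetminus P_N$ and $\delta\in\widetilde{\mathcal{D}}^{\mathbb{C}^*}_N$ the limit defining $\mathcal{L}_N(s,\delta)$ exists for every $\epsilon\in\mathcal{E}$ and does not depend on $\epsilon$. 1. For $g\in G_N$, $\psi=\psi_g$ and $\delta=(w,a,\theta)\in\widetilde{\mathcal{D}}^{\mathbb{C}^*}_N$, the limit defining $\rho_N^{\psi}(s,\delta)$ exists for $\mathrm{Re}(s)<1$ and has a unique continuation to a meromorphic function on $\mathbb{C}$ that is holomorphic on $\mathbb{C}\smallsetminus P_N$, and for all $s\in\mathbb{C}\smallsetminus P_N$ $$\mathcal{L}_N(s,g\delta)=J_g(s,\theta)\Big[\mathcal{L}_N(s,\delta)+\rho_N^{\psi}(s,\delta)/\Gamma(s)\Big].$$ 2. For every $k\in\mathbb{Z}$, $g\mapsto J_g(k,\cdot)$ is a 1-cocycle for the (right) action of $G_N$ by composition on the multiplicative group of everywhere nonzero complex functions on $\mathbb{D}_N$: $J_{gh}(k,\delta)=J_g(k,h\delta)\,J_h(k,\delta)$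 for all $g,h\in G_N$, $\delta\in\mathbb{D}_N$. 3. For all $g,h\in G_N$, $\delta\in\widetilde{\mathcal{D}}^{\mathbb{C}^*}_N$ and every $k\in\mathbb{Z}$ which is not a pole of any of the three functions $\rho_N$ involved, $$\rho_N^{\psi_g}(k,h\delta)=J_h(k,\delta)\Big[\rho_N^{\psi_{gh}}(k,\delta)-\rho_N^{\psi_h}(k,\delta)+i\,(\psi_g+\psi_h-\psi_{gh})\cdot\mathrm{coeff}\big(F_N(u,\delta),u^{-k}\big)\Big],$$ where $\mathrm{coeff}(f(u),u^{n})$ is the coefficient of $u^n$ in the Laurent expansion of $f$ at $u=0$. -/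

import Mathlib

open Filter Topology

namespace BarnesL

/-- `e(z) = exp(2πiz)`. -/
noncomputable def e (z : ℂ) : ℂ := Complex.exp (2 * Real.pi * Complex.I * z)

/-- The parameter space `𝔻_N` of triples `(w, a, θ) ∈ ℂ × ℂ^N × ℝ^N` such that
`θ_ℓ ∉ ℤ` whenever `a_ℓ = 0`. -/
@[ext]
structure Param (N : ℕ) where
  w : ℂ
  a : Fin N → ℂ
  θ : Fin N → ℝ
  good : ∀ l, a l = 0 → ∀ n : ℤ, θ l ≠ n

/-- The trace `Tr(v, Λ) = ∑_{ℓ ∈ Λ} v_ℓ`. -/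
def tr {N : ℕ} {R : Type*} [AddCommMonoid R] (v : Fin N → R) (Λ : Finset (Fin N)) : R :=
  ∑ l ∈ Λ, v l

/-- The cone `𝒞`: the open right half-plane together with the open positive imaginary axis. -/
def cone : Set ℂ := {z | 0 < z.re ∨ (z.re = 0 ∧ 0 < z.im)}

open Classical in
/-- `π(w, a, θ) = w - Tr(a, a⁻¹[-𝒞])`. -/
noncomputable def proj {N : ℕ} (δ : Param N) : ℂ :=
  δ.w - tr δ.a (Finset.univ.filter fun l => -δ.a l ∈ cone)

/-! ### The transformations and the group `G_N` -/

/-- The diagonal entries of the matrix `d(Λ)`. -/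
def sgn {N : ℕ} (Λ : Finset (Fin N)) (l : Fin N) : ℤ := if l ∈ Λ then -1 else 1

lemma sgn_eq {N : ℕ} (Λ : Finset (Fin N)) (l : Fin N) : sgn Λ l = 1 ∨ sgn Λ l = -1 := by
  unfold sgn; split_ifs <;> simp

/-- `T_Λ(w, a, θ) = (w - Tr(a, Λ), a d(Λ), θ d(Λ))`. -/
noncomputable def T {N : ℕ} (Λ : Finset (Fin N)) (δ : Param N) : Param N where
  w := δ.w - tr δ.a Λ
  a l := sgn Λ l * δ.a l
  θ l := sgn Λ l * δ.θ l
  good l h n hn := by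
    rcases sgn_eq Λ l with h1 | h1
    · exact δ.good l (by simpa [h1] using h) n (by simpa [h1] using hn)
    · refine δ.good l (by simpa [h1] using h) (-n) ?_
      rw [h1] at hn
      push_cast at hn ⊢
      linarith

/-- `R_σ(w, a, θ) = (w, a r(σ), θ r(σ))`, where `(v r(σ))_ℓ = v_{σ⁻¹(ℓ)}`. -/
def R {N : ℕ} (σ : Equiv.Perm (Fin N)) (δ : Param N) : Param N where
  w := δ.w
  a l := δ.a (σ⁻¹ l)
  θ l := δ.θ (σ⁻¹ l)
  good l h := δ.good (σ⁻¹ l) h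

/-- `M_α(w, a, θ) = (αw, αa, θ)` for `α ∈ ℂ^*`. -/
def M {N : ℕ} (α : ℂˣ) (δ : Param N) : Param N where
  w := α * δ.w
  a l := α * δ.a l
  θ := δ.θ
  good l h := δ.good l (by simpa using h)

/-- The group `G_N`, its elements `g = T_Λ R_σ M_α` being recorded by the triple `(Λ, σ, α)`. -/
@[ext]
structure GN (N : ℕ) where
  Λ : Finset (Fin N)
  σ : Equiv.Perm (Fin N)
  α : ℂˣ

lemma mem_map_perm {N : ℕ} (Λ : Finset (Fin N)) (σ : Equiv.Perm (Fin N)) (l : Fin N) :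
    l ∈ Λ.map σ.toEmbedding ↔ σ⁻¹ l ∈ Λ := by
  simp only [Finset.mem_map_equiv]
  rfl

/-- The composition law `T_{Λ₁}R_{σ₁}M_{α₁} · T_{Λ₂}R_{σ₂}M_{α₂} =
T_{Λ₁ ⊕ σ₁(Λ₂)} R_{σ₁σ₂} M_{α₁α₂}`. -/
instance (N : ℕ) : Mul (GN N) :=
  ⟨fun g h => ⟨symmDiff g.Λ (h.Λ.map g.σ.toEmbedding), g.σ * h.σ, g.α * h.α⟩⟩

instance (N : ℕ) : One (GN N) := ⟨⟨∅, 1, 1⟩⟩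

instance (N : ℕ) : Inv (GN N) := ⟨fun g => ⟨g.Λ.map (g.σ⁻¹).toEmbedding, g.σ⁻¹, g.α⁻¹⟩⟩

lemma mul_Λ {N : ℕ} (g h : GN N) : (g * h).Λ = symmDiff g.Λ (h.Λ.map g.σ.toEmbedding) := rfl
lemma mul_σ {N : ℕ} (g h : GN N) : (g * h).σ = g.σ * h.σ := rfl
lemma mul_α {N : ℕ} (g h : GN N) : (g * h).α = g.α * h.α := rfl

lemma mem_mul {N : ℕ} (g h : GN N) (l : Fin N) :
    l ∈ (g * h).Λ ↔ (l ∈ g.Λ ∧ g.σ⁻¹ l ∉ h.Λ ∨ g.σ⁻¹ l ∈ h.Λ ∧ l ∉ g.Λ) := by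
  rw [mul_Λ, Finset.mem_symmDiff, mem_map_perm]

instance (N : ℕ) : Group (GN N) :=
  Group.ofLeftAxioms
    (by
      intro f g h
      ext l
      · simp only [mem_mul, mul_σ, mul_inv_rev, Equiv.Perm.mul_apply]; tauto
      · simp [mul_σ, mul_assoc]
      · simp [mul_α, mul_assoc])
    (by
      intro g
      ext l
      · rw [mem_mul]
        change (l ∈ (∅ : Finset (Fin N)) ∧ _ ∨ (1 : Equiv.Perm (Fin N))⁻¹ l ∈ g.Λ ∧ _) ↔ _
        simp [show (1 : GN N).Λ = ∅ from rfl]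
      · rw [mul_σ, show (1 : GN N).σ = 1 from rfl, one_mul]
      · change (((1 : ℂˣ) * g.α : ℂˣ) : ℂ) = _; simp)
    (by
      intro g
      ext l
      · rw [mem_mul]
        change (l ∈ g.Λ.map (g.σ⁻¹).toEmbedding ∧ (g.σ⁻¹)⁻¹ l ∉ g.Λ ∨
          (g.σ⁻¹)⁻¹ l ∈ g.Λ ∧ l ∉ g.Λ.map (g.σ⁻¹).toEmbedding) ↔ l ∈ (∅ : Finset (Fin N))
        rw [mem_map_perm]; simp
      · rw [mul_σ, show (g⁻¹ : GN N).σ = g.σ⁻¹ from rfl, inv_mul_cancel]; rfl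
      · change ((g.α⁻¹ * g.α : ℂˣ) : ℂ) = ((1 : ℂˣ) : ℂ); simp)

/-- `g = T_Λ R_σ M_α` as a transformation of `𝔻_N`. -/
noncomputable instance (N : ℕ) : SMul (GN N) (Param N) := ⟨fun g δ => T g.Λ (R g.σ (M g.α δ))⟩

lemma smul_def {N : ℕ} (g : GN N) (δ : Param N) : g • δ = T g.Λ (R g.σ (M g.α δ)) := rfl

lemma sgn_mul {N : ℕ} (g h : GN N) (l : Fin N) :
    sgn (g * h).Λ l = sgn g.Λ l * sgn h.Λ (g.σ⁻¹ l) := by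
  simp only [sgn, mem_mul]
  by_cases h1 : l ∈ g.Λ <;> by_cases h2 : g.σ⁻¹ l ∈ h.Λ <;>
    simp_all

lemma tr_eq_sum_sgn {N : ℕ} (v : Fin N → ℂ) (Λ : Finset (Fin N)) :
    tr v Λ = ∑ l, ((1 - (sgn Λ l : ℂ)) / 2) * v l := by
  classical
  rw [tr, ← Finset.sum_filter_add_sum_filter_not Finset.univ (· ∈ Λ)]
  rw [Finset.sum_eq_zero (s := Finset.univ.filter fun l => ¬ l ∈ Λ), add_zero]
  · rw [Finset.filter_mem_eq_inter, Finset.univ_inter]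
    refine Finset.sum_congr rfl fun l hl => ?_
    simp only [sgn, hl, if_true]; push_cast; ring
  · intro l hl
    simp only [Finset.mem_filter] at hl
    simp [sgn, hl.2]

/-- The triples act on `𝔻_N` as a group, by the transformations `T_Λ R_σ M_α`. -/
noncomputable instance (N : ℕ) : MulAction (GN N) (Param N) where
  one_smul δ := by
    rw [smul_def]
    change T ∅ (R 1 (M 1 δ)) = δ
    ext l <;> simp [T, R, M, tr, sgn]
  mul_smul g h δ := by
    simp only [smul_def]
    ext l
    · simp only [T, R, M, mul_α, mul_σ, tr_eq_sum_sgn, sgn_mul, Units.val_mul]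
      have key : ∑ l, ((1 - (sgn h.Λ l : ℂ)) / 2) * (h.α * δ.a (h.σ⁻¹ l)) =
          ∑ l, ((1 - (sgn h.Λ (g.σ⁻¹ l) : ℂ)) / 2) * (h.α * δ.a (h.σ⁻¹ (g.σ⁻¹ l))) :=
        (Equiv.sum_comp g.σ⁻¹
          (fun l => ((1 - (sgn h.Λ l : ℂ)) / 2) * (h.α * δ.a (h.σ⁻¹ l)))).symm
      rw [key, mul_sub, sub_sub, Finset.mul_sum, ← Finset.sum_add_distrib, mul_assoc]
      congr 1
      refine Finset.sum_congr rfl fun l _ => ?_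
      simp only [mul_inv_rev, Equiv.Perm.mul_apply]
      push_cast
      ring
    · simp only [T, R, M, mul_α, mul_σ, sgn_mul, Units.val_mul, mul_inv_rev,
        Equiv.Perm.mul_apply]
      push_cast
      ring
    · simp only [T, R, M, mul_σ, sgn_mul, mul_inv_rev, Equiv.Perm.mul_apply]
      push_cast
      ring

/-- Different triples give different transformations, so `G_N` is indeed a group of
transformations of `𝔻_N`. -/
instance (N : ℕ) : FaithfulSMul (GN N) (Param N) where
  eq_of_smul_eq_smul {g h} H := by
    have hα : (g.α : ℂ) = h.α := by
      have := congrArg Param.w (H ⟨1, 0, fun _ => 1 / 2, fun _ _ n hn => by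
        have h2 : (1 : ℝ) = ((2 * n : ℤ) : ℝ) := by push_cast; linarith
        have h3 : (1 : ℤ) = 2 * n := by exact_mod_cast h2
        omega⟩)
      simpa [smul_def, T, R, M, tr] using this
    have hne : ∀ m : Fin N, ((m : ℕ) : ℂ) + 1 ≠ 0 := fun m => by
      exact_mod_cast Nat.succ_ne_zero (m : ℕ)
    have key : ∀ l, sgn g.Λ l * (((g.σ⁻¹ l : Fin N) : ℕ) + 1 : ℤ)
        = sgn h.Λ l * (((h.σ⁻¹ l : Fin N) : ℕ) + 1 : ℤ) := by
      intro l
      have := congrFun (congrArg Param.a (H ⟨0, fun m => ((m : ℕ) : ℂ) + 1, 0,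
        fun m hm => absurd hm (hne m)⟩)) l
      simp only [smul_def, T, R, M, hα] at this
      have h2 : (h.α : ℂ) * (sgn g.Λ l * ((((g.σ⁻¹ l : Fin N) : ℕ) : ℂ) + 1)) =
          h.α * (sgn h.Λ l * ((((h.σ⁻¹ l : Fin N) : ℕ) : ℂ) + 1)) := by linear_combination this
      have h3 := mul_left_cancel₀ h.α.ne_zero h2
      exact_mod_cast h3
    have hs : ∀ l, sgn g.Λ l = sgn h.Λ l ∧ g.σ⁻¹ l = h.σ⁻¹ l := by
      intro l
      have := key l
      rcases sgn_eq g.Λ l with h1 | h1 <;> rcases sgn_eq h.Λ l with h2 | h2 <;>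
        rw [h1, h2] at this ⊢
      · exact ⟨rfl, Fin.ext (by omega)⟩
      · omega
      · omega
      · exact ⟨rfl, Fin.ext (by omega)⟩
    refine GN.ext ?_ ?_ (Units.ext hα)
    · ext l
      have := (hs l).1
      by_cases h1 : l ∈ g.Λ <;> by_cases h2 : l ∈ h.Λ <;> simp_all [sgn]
    · exact inv_injective (Equiv.ext fun l => (hs l).2)

/-- The `ℂ^*`-stable domain `𝒟̃^{ℂ^*}_N = ⋂_{α ∈ ℂ^*} (π M_α)⁻¹[𝒞]`. -/
def stableDomain (N : ℕ) : Set (Param N) := {δ | ∀ α : ℂˣ, proj (M α δ) ∈ cone}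

/-- `M_{exp(iω)}` for a real angle `ω`. -/
noncomputable def rot {N : ℕ} (ω : ℝ) (δ : Param N) : Param N :=
  M (Units.mk0 (Complex.exp (ω * Complex.I)) (Complex.exp_ne_zero _)) δ

/-- The set `P_N = {1, …, N}`, as a set of complex numbers. -/
def PN (N : ℕ) : Set ℂ := {s | ∃ n : ℕ, 1 ≤ n ∧ n ≤ N ∧ s = n}

/-- The factor `J_g(s, θ) = (-1)^{|Λ|} e(Tr(θ, σ⁻¹[Λ])) α^{-s}` (principal branch). -/
noncomputable def J {N : ℕ} (g : GN N) (s : ℂ) (θ : Fin N → ℝ) : ℂ :=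
  (-1) ^ g.Λ.card * e (tr θ (g.Λ.map (g.σ⁻¹).toEmbedding) : ℝ) * (g.α : ℂ) ^ (-s)

lemma J_ne_zero {N : ℕ} (g : GN N) (s : ℂ) (θ : Fin N → ℝ) : J g s θ ≠ 0 := by
  refine mul_ne_zero (mul_ne_zero (pow_ne_zero _ (by norm_num)) (Complex.exp_ne_zero _)) ?_
  rw [Complex.cpow_def_of_ne_zero g.α.ne_zero]
  exact Complex.exp_ne_zero _

/-- `J_g(k, θ)` as an element of the multiplicative group of everywhere nonzero functions
of `(w, a, θ) ∈ 𝔻_N`. -/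
noncomputable def Junit {N : ℕ} (k : ℤ) (g : GN N) : Param N → ℂˣ :=
  fun δ => Units.mk0 (J g k δ.θ) (J_ne_zero g k δ.θ)

/-! ### The function `𝓛_N` -/

/-- `F_N(u, w, a, θ) = exp(-uw) ∏_ℓ (1 - e(θ_ℓ) exp(-u a_ℓ))⁻¹`. -/
noncomputable def F {N : ℕ} (u : ℂ) (δ : Param N) : ℂ :=
  Complex.exp (-u * δ.w) * ∏ l, (1 - e (δ.θ l) * Complex.exp (-u * δ.a l))⁻¹

/-- The set `ℰ` of admissible radius functions: positive functions `ε` on `𝔻_N` such that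
`e(θ_ℓ) = exp(u a_ℓ)` has no solutions with `0 < |u| ≤ ε(w, a, θ)`. -/
def radii (N : ℕ) : Set (Param N → ℝ) :=
  {ε | ∀ δ, 0 < ε δ ∧ ∀ (l : Fin N) (u : ℂ), 0 < ‖u‖ → ‖u‖ ≤ ε δ →
    e (δ.θ l) ≠ Complex.exp (u * δ.a l)}

/-- `∫_{C(r)} F_N(u, δ) u^{s-1} du` over the Hankel contour: from `+∞` to `r` along the real axis
(argument `0`), once counterclockwise around the circle of radius `r` (argument from `0` to `2π`),
and back to `+∞` along the real axis (argument `2π`). -/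
noncomputable def hankel {N : ℕ} (r : ℝ) (s : ℂ) (δ : Param N) : ℂ :=
  -(∫ x in Set.Ioi r, F (x : ℂ) δ * Complex.exp ((s - 1) * Real.log x))
  + (∫ t in (0 : ℝ)..(2 * Real.pi), F (r * Complex.exp (t * Complex.I)) δ
      * Complex.exp ((s - 1) * (Real.log r + t * Complex.I))
      * (r * Complex.I * Complex.exp (t * Complex.I)))
  + ∫ x in Set.Ioi r, F (x : ℂ) δ
      * Complex.exp ((s - 1) * (Real.log x + 2 * Real.pi * Complex.I))

/-- `(Γ(s)(e(s) - 1))⁻¹ ∫_{C(ε(δ))} F_N(u, δ) u^{s-1} du`, the formula meaningful for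
`s ∉ ℤ`. -/
noncomputable def LFormula {N : ℕ} (ε : Param N → ℝ) (s : ℂ) (δ : Param N) : ℂ :=
  (Complex.Gamma s * (e s - 1))⁻¹ * hankel (ε δ) s δ

/-- `𝓛_{N,ε}(s, δ)` as a meromorphic function of `s`: the removable singularities of the formula
at integers are removed. -/
noncomputable def LEps {N : ℕ} (ε : Param N → ℝ) (s : ℂ) (δ : Param N) : ℂ :=
  limUnder (𝓝[≠] s) fun z => LFormula ε z δ

lemma exists_radius {N : ℕ} (δ : Param N) :
    ∃ r : ℝ, 0 < r ∧ ∀ (l : Fin N) (u : ℂ), 0 < ‖u‖ → ‖u‖ ≤ r →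
      e (δ.θ l) ≠ Complex.exp (u * δ.a l) := by
  have h1 : ∀ l : Fin N, ∀ᶠ u in 𝓝[≠] (0 : ℂ), Complex.exp (u * δ.a l) - e (δ.θ l) ≠ 0 := by
    intro l
    by_cases ha : δ.a l = 0
    · refine Eventually.of_forall fun u => ?_
      rw [ha, mul_zero, Complex.exp_zero, sub_ne_zero]
      intro h
      obtain ⟨n, hn⟩ := Complex.exp_eq_one_iff.1 h.symm
      refine δ.good l ha n ?_
      have h2 : (2 * Real.pi * Complex.I : ℂ) ≠ 0 := Complex.two_pi_I_ne_zero
      have h3 : ((δ.θ l : ℝ) : ℂ) = n := mul_left_cancel₀ h2 (by linear_combination hn)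
      exact_mod_cast h3
    · have hf : AnalyticAt ℂ (fun u : ℂ => Complex.exp (u * δ.a l) - e (δ.θ l)) 0 := by
        fun_prop
      rcases hf.eventually_eq_zero_or_eventually_ne_zero with h | h
      · exfalso
        have hd : HasDerivAt (fun u : ℂ => Complex.exp (u * δ.a l) - e (δ.θ l))
            (Complex.exp (0 * δ.a l) * (1 * δ.a l)) 0 :=
          (((hasDerivAt_id (0 : ℂ)).mul_const (δ.a l)).cexp).sub_const _
        have hz := (hasDerivAt_const (0 : ℂ) (0 : ℂ)).congr_of_eventuallyEq h
        have := hd.unique hz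
        simp [ha] at this
      · exact h
  have h2 := (eventually_all.2 h1)
  rw [eventually_nhdsWithin_iff, Metric.eventually_nhds_iff] at h2
  obtain ⟨r, hr, h⟩ := h2
  refine ⟨r / 2, by positivity, fun l u hu hur heq => ?_⟩
  exact h (y := u) (by rw [dist_zero_right]; linarith) (norm_pos_iff.1 hu) l
    (sub_eq_zero.2 heq.symm)

lemma radii_nonempty (N : ℕ) : (radii N).Nonempty :=
  ⟨fun δ => (exists_radius δ).choose, fun δ => (exists_radius δ).choose_spec⟩

/-- `𝓛_N(s, δ) = lim_{ω → 0⁻} 𝓛_{N,ε}(s, M_{exp(iω)} δ)`, for some choice of `ε ∈ ℰ`. -/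
noncomputable def L {N : ℕ} (s : ℂ) (δ : Param N) : ℂ :=
  limUnder (𝓝[<] (0 : ℝ)) fun ω => LEps (radii_nonempty N).some s (rot ω δ)

/-! ### Residues and the function `ρ_N` -/

/-- The coefficient of `(z - z₀)^n` in the Laurent expansion of `f` at the isolated singularity
`z₀`: the value, for all small radii `r`, of `(2πi)⁻¹ ∮_{|z - z₀| = r} f(z) (z - z₀)^{-n-1} dz`. -/
noncomputable def laurentCoeff (f : ℂ → ℂ) (z₀ : ℂ) (n : ℤ) : ℂ :=
  limUnder (𝓝[>] (0 : ℝ)) fun r =>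
    (2 * Real.pi * Complex.I)⁻¹ * ∮ z in C(z₀, r), f z * (z - z₀) ^ (-n - 1)

/-- The residue of `f` at `z₀`. -/
noncomputable def residue (f : ℂ → ℂ) (z₀ : ℂ) : ℂ := laurentCoeff f z₀ (-1)

/-- The set `𝒫_ψ(a, θ)` of nonzero poles `u` of `F_N(u, w, a, θ)` with `arg u ∈ [0, ψ)` if
`ψ > 0`, and with `arg u ∈ [ψ, 0)` if `ψ < 0` (and the empty set if `ψ = 0`). -/
def poles {N : ℕ} (ψ : ℝ) (δ : Param N) : Set ℂ :=
  {u | u ≠ 0 ∧ meromorphicOrderAt (fun v => F v δ) u < 0 ∧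
    ((0 < ψ ∧ 0 ≤ u.arg ∧ u.arg < ψ) ∨ (ψ < 0 ∧ ψ ≤ u.arg ∧ u.arg < 0))}

/-- `sgn(-ψ) 2πi ∑ Res_{u = u₀} (F_N(u, δ) u^{s-1})` over the poles `u₀ ∈ 𝒫_ψ(a, θ)` with
`|u₀| < r` (a finite set), with the principal branch of `u^{s-1}`. -/
noncomputable def residueSum {N : ℕ} (ψ : ℝ) (δ : Param N) (s : ℂ) (r : ℝ) : ℂ :=
  Real.sign (-ψ) * (2 * Real.pi * Complex.I) *
    ∑ᶠ u₀ ∈ {u | u ∈ poles ψ δ ∧ ‖u‖ < r}, residue (fun u => F u δ * u ^ (s - 1)) u₀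

/-- The radii `r` such that no two poles in `𝒫_ψ(a, θ)` at distance less than `c` are separated
by the circle of radius `r`. -/
def goodRadii {N : ℕ} (ψ : ℝ) (δ : Param N) (c : ℝ) : Set ℝ :=
  {r | ∀ u ∈ poles ψ δ, ∀ v ∈ poles ψ δ, ‖u - v‖ < c → (‖u‖ < r ↔ ‖v‖ < r)}

/-- `ρ` is the `s`-analytic continuation of the limit of residue sums: it is meromorphic on `ℂ`
(taking its limit value at each point where it is bounded, and the value `0` at its poles),
holomorphic on `ℂ ∖ P_N`, and for `Re(s) < 1` it is the limit of the residue sums as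
`r → ∞` through radii not separating close poles. -/
structure IsRho {N : ℕ} (ψ : ℝ) (δ : Param N) (ρ : ℂ → ℂ) : Prop where
  meromorphic : MeromorphicNFOn ρ Set.univ
  holomorphic : AnalyticOnNhd ℂ ρ (PN N)ᶜ
  limit : ∀ s : ℂ, s.re < 1 → ∀ c : ℝ, 0 < c →
    Tendsto (residueSum ψ δ s) (atTop ⊓ 𝓟 (goodRadii ψ δ c)) (𝓝 (ρ s))

/-- The function `s ↦ ρ_N^ψ(s, δ)`. -/
noncomputable def rho {N : ℕ} (ψ : ℝ) (δ : Param N) : ℂ → ℂ :=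
  Classical.epsilon (IsRho ψ δ)

/-- The angle `ψ_g = arg α ∈ (-π, π]` of `g = T_Λ R_σ M_α`. -/
noncomputable def ang {N : ℕ} (g : GN N) : ℝ := Complex.arg (g.α : ℂ)

end BarnesL

/-! Everything reduces to the integral `contour r φ s δ` of F_N(u, δ)u^{s-1}, taken along an arc
from r to the ray of argument φ and then along that ray to infinity. Call φ critical if some nonzero
u a_ℓ is purely imaginary on its ray. All nonzero poles lie on critical rays, of which there are
finitely many. On the stable domain F_N decays exponentially along every other ray, so `contour` is
entire in s there.

The Hankel integral of the parameter rotated by φ is, up to the factor e^{-isφ}, equal to (e(s) - 1)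
times `contour` plus an integral over the full circle that does not involve φ
(`exp_mul_hankel_rot_eq_contour`). Since `contour` is constant in φ between critical angles
(`contour_eq_of_not_isCritical`), the limit ω → 0⁻ exists and does not depend on the radii. Moreover
F_N(u, gδ) is a constant times F_N(αu, δ) (`F_smul`), so passing from δ to gδ multiplies by J_g and
turns the angle φ into φ + ψ_g (`hankel_smul`). The full circles cancel, and the defect in the
transformation formula is the difference of the contours at the angles ψ + ω and ω for a small ω <
0.

For Re(s) < 1 this difference is the limit of the residue sums (`hasSectorLimit`). The residue
theorem is applied to truncated sectors, and the outer arcs have to vanish in the limit. Away from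
the poles, |F_N(u, δ)| is at most a constant times exp(-`height`), where `height` is the real part
of π(M_u δ) (`re_proj`). Between critical angles it is a nonnegative sinusoid, hence concave in the
angle, hence bounded below linearly in the distance to a critical angle, even if it vanishes there.
The arc integrals are therefore O(R^{Re(s)-1}), provided that R keeps its distance from the absolute
values of the poles. A radius that separates no close poles can be moved to such an R without
changing the residue sum. The continuation is the difference of contours itself, which is entire,
and it is unique because large admissible radii exist (`exists_gap_zeros`).

At an integer k the power u^{k-1} is single-valued and α^{-k} is multiplicative in α. The latter
gives the cocycle relation. By the former, turning a contour by 2πm adds m full circles, that is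
2πim times a Laurent coefficient. Arguments add only modulo 2π, and this defect is the correction
term in the rule for ρ_N (`rho_smul`). -/

namespace BarnesL

open Complex MeasureTheory intervalIntegral Set

variable {N : ℕ}

/-! ### Integrals over the boundary of a rectangle -/

/-- The counterclockwise integral over the boundary of the rectangle `[a, b] × [c, d]`. -/
noncomputable def rectIntegral (f : ℂ → ℂ) (a b c d : ℝ) : ℂ :=
  (∫ x : ℝ in a..b, f (x + c * I)) - (∫ x : ℝ in a..b, f (x + d * I)) +
    I * (∫ y : ℝ in c..d, f (b + y * I)) - I * ∫ y : ℝ in c..d, f (a + y * I)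

/-- The boundary of the rectangle `[a, b] × [c, d]`. -/
def rectBoundary (a b c d : ℝ) : Set ℂ :=
  {z | z.re ∈ Icc a b ∧ z.im ∈ Icc c d ∧ (z.re = a ∨ z.re = b ∨ z.im = c ∨ z.im = d)}

section Rectangle

variable {a b c d : ℝ} {f g : ℂ → ℂ}

lemma bottom_mem (hcd : c ≤ d) {x : ℝ} (hx : x ∈ Icc a b) :
    (x + c * I : ℂ) ∈ rectBoundary a b c d := by
  simp [rectBoundary, hcd, hx.1, hx.2]

lemma top_mem (hcd : c ≤ d) {x : ℝ} (hx : x ∈ Icc a b) :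
    (x + d * I : ℂ) ∈ rectBoundary a b c d := by
  simp [rectBoundary, hcd, hx.1, hx.2]

lemma right_mem (hab : a ≤ b) {y : ℝ} (hy : y ∈ Icc c d) :
    (b + y * I : ℂ) ∈ rectBoundary a b c d := by
  simp [rectBoundary, hab, hy.1, hy.2]

lemma left_mem (hab : a ≤ b) {y : ℝ} (hy : y ∈ Icc c d) :
    (a + y * I : ℂ) ∈ rectBoundary a b c d := by
  simp [rectBoundary, hab, hy.1, hy.2]

lemma horizontal_intervalIntegrable {s : Set ℂ} (hab : a ≤ b) (hf : ContinuousOn f s)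
    (h : ∀ x ∈ Icc a b, (x + c * I : ℂ) ∈ s) :
    IntervalIntegrable (fun x : ℝ => f (x + c * I)) volume a b := by
  refine ContinuousOn.intervalIntegrable ?_
  rw [uIcc_of_le hab]
  exact hf.comp (by fun_prop) h

lemma vertical_intervalIntegrable {s : Set ℂ} (hcd : c ≤ d) (hf : ContinuousOn f s)
    (h : ∀ y ∈ Icc c d, (b + y * I : ℂ) ∈ s) :
    IntervalIntegrable (fun y : ℝ => f (b + y * I)) volume c d := by
  refine ContinuousOn.intervalIntegrable ?_
  rw [uIcc_of_le hcd]
  exact hf.comp (by fun_prop) h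

lemma rectIntegral_congr (hab : a ≤ b) (hcd : c ≤ d) (h : EqOn f g (rectBoundary a b c d)) :
    rectIntegral f a b c d = rectIntegral g a b c d := by
  unfold rectIntegral
  congr 1
  · congr 1
    · congr 1
      · exact integral_congr fun x hx => h (bottom_mem hcd (by rwa [uIcc_of_le hab] at hx))
      · exact integral_congr fun x hx => h (top_mem hcd (by rwa [uIcc_of_le hab] at hx))
    · congr 1
      exact integral_congr fun x hx => h (right_mem hab (by rwa [uIcc_of_le hcd] at hx))
  · congr 1
    exact integral_congr fun x hx => h (left_mem hab (by rwa [uIcc_of_le hcd] at hx))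

lemma rectIntegral_add (hab : a ≤ b) (hcd : c ≤ d) (hf : ContinuousOn f (rectBoundary a b c d))
    (hg : ContinuousOn g (rectBoundary a b c d)) :
    rectIntegral (fun z => f z + g z) a b c d =
      rectIntegral f a b c d + rectIntegral g a b c d := by
  unfold rectIntegral
  rw [intervalIntegral.integral_add, intervalIntegral.integral_add, intervalIntegral.integral_add,
    intervalIntegral.integral_add]
  · ring
  all_goals first
    | exact horizontal_intervalIntegrable hab ‹_› fun x hx => bottom_mem hcd hx
    | exact horizontal_intervalIntegrable hab ‹_› fun x hx => top_mem hcd hx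
    | exact vertical_intervalIntegrable hcd ‹_› fun x hx => right_mem hab hx
    | exact vertical_intervalIntegrable hcd ‹_› fun x hx => left_mem hab hx

lemma rectIntegral_const_mul (k : ℂ) :
    rectIntegral (fun z => k * f z) a b c d = k * rectIntegral f a b c d := by
  simp only [rectIntegral, intervalIntegral.integral_const_mul]
  ring

lemma rectIntegral_sum {ι : Type*} (hab : a ≤ b) (hcd : c ≤ d) (S : Finset ι) (q : ι → ℂ → ℂ)
    (hq : ∀ i ∈ S, ContinuousOn (q i) (rectBoundary a b c d)) :
    rectIntegral (fun z => ∑ i ∈ S, q i z) a b c d = ∑ i ∈ S, rectIntegral (q i) a b c d := by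
  classical
  induction S using Finset.induction_on with
  | empty => simp [rectIntegral]
  | insert i S hi ih =>
    simp only [Finset.sum_insert hi]
    rw [rectIntegral_add hab hcd (hq i (by simp))
      (continuousOn_finsetSum _ fun j hj => hq j (by simp [hj])), ih fun j hj => hq j (by simp [hj])]

lemma rectIntegral_eq_zero_of_differentiableOn (hab : a ≤ b) (hcd : c ≤ d)
    (hf : DifferentiableOn ℂ f (Icc a b ×ℂ Icc c d)) : rectIntegral f a b c d = 0 := by
  have := Complex.integral_boundary_rect_eq_zero_of_differentiableOn f (a + c * I) (b + d * I)
    (by simpa [uIcc_of_le hab, uIcc_of_le hcd] using hf)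
  simpa [rectIntegral] using this

lemma integral_horizontal_of_hasDerivAt {G : ℂ → ℂ} (hab : a ≤ b)
    (hG : ∀ x ∈ Icc a b, HasDerivAt G (f (x + c * I)) (x + c * I))
    (hf : ContinuousOn f {z | z.re ∈ Icc a b ∧ z.im = c}) :
    ∫ x : ℝ in a..b, f (x + c * I) = G (b + c * I) - G (a + c * I) := by
  rw [integral_eq_sub_of_hasDerivAt (f := fun x : ℝ => G (x + c * I))]
  · intro x hx
    rw [uIcc_of_le hab] at hx
    have := (hG x hx).comp (x : ℂ) ((hasDerivAt_id (x : ℂ)).add_const (c * I))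
    simpa using this.comp_ofReal
  · exact horizontal_intervalIntegrable hab hf fun x hx => by simpa using hx

lemma integral_vertical_of_hasDerivAt {G : ℂ → ℂ} (hcd : c ≤ d)
    (hG : ∀ y ∈ Icc c d, HasDerivAt G (f (b + y * I)) (b + y * I))
    (hf : ContinuousOn f {z | z.re = b ∧ z.im ∈ Icc c d}) :
    I * ∫ y : ℝ in c..d, f (b + y * I) = G (b + d * I) - G (b + c * I) := by
  rw [← intervalIntegral.integral_const_mul,
    integral_eq_sub_of_hasDerivAt (f := fun y : ℝ => G (b + y * I))]
  · intro y hy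
    rw [uIcc_of_le hcd] at hy
    have := (hG y hy).comp (y : ℂ) (((hasDerivAt_id (y : ℂ)).mul_const I).const_add (b : ℂ))
    have := this.comp_ofReal
    simpa [mul_comm] using this
  · exact (vertical_intervalIntegrable hcd hf fun x hx => by simpa using hx).const_mul I

lemma rectIntegral_eq_zero_of_hasDerivAt {G : ℂ → ℂ} (hab : a ≤ b) (hcd : c ≤ d)
    (hG : ∀ z ∈ rectBoundary a b c d, HasDerivAt G (f z) z)
    (hf : ContinuousOn f (rectBoundary a b c d)) : rectIntegral f a b c d = 0 := by
  unfold rectIntegral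
  rw [integral_horizontal_of_hasDerivAt hab (fun x hx => hG _ (bottom_mem hcd hx)),
    integral_horizontal_of_hasDerivAt hab (fun x hx => hG _ (top_mem hcd hx)),
    integral_vertical_of_hasDerivAt hcd (fun x hx => hG _ (right_mem hab hx)),
    integral_vertical_of_hasDerivAt hcd (fun x hx => hG _ (left_mem hab hx))]
  · ring
  all_goals
    refine hf.mono ?_
    rintro z ⟨h1, h2⟩
    simp only [rectBoundary, mem_ofPred_eq]
    simp_all

lemma log_neg_of_im_pos {z : ℂ} (hz : 0 < z.im) : log (-z) = log z - Real.pi * I := by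
  rw [log, log, norm_neg, arg_neg_eq_arg_sub_pi_of_im_pos hz]
  push_cast; ring

lemma log_neg_of_im_neg {z : ℂ} (hz : z.im < 0) : log (-z) = log z + Real.pi * I := by
  rw [log, log, norm_neg, arg_neg_eq_arg_add_pi_of_im_neg hz]
  push_cast; ring

/-- The primitive log(z - p) serves on three edges. The left edge crosses its branch cut, so log(-(z
- p)) is used there; the two branches differ by πi and -πi at the left corners, which adds up to
2πi. -/
lemma rectIntegral_inv_sub {p : ℂ} (hp : p.re ∈ Ioo a b) (hp' : p.im ∈ Ioo c d) :
    rectIntegral (fun z => (z - p)⁻¹) a b c d = 2 * Real.pi * I := by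
  have hab : a ≤ b := (hp.1.trans hp.2).le
  have hcd : c ≤ d := (hp'.1.trans hp'.2).le
  have hlog : ∀ z : ℂ, z - p ∈ slitPlane → HasDerivAt (fun z => log (z - p)) ((z - p)⁻¹) z := by
    intro z hz
    simpa using ((hasDerivAt_id z).sub_const p).clog hz
  have hlog' : ∀ z : ℂ, -(z - p) ∈ slitPlane →
      HasDerivAt (fun z => log (-(z - p))) ((z - p)⁻¹) z := by
    intro z hz
    have h1 : HasDerivAt (fun z => log (-(z - p))) (-1 / -(z - p)) z :=
      ((hasDerivAt_id z).sub_const p).neg.clog hz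
    rwa [neg_div_neg_eq, one_div] at h1
  have hc : ∀ s : Set ℂ, p ∉ s → ContinuousOn (fun z => (z - p)⁻¹) s := by
    intro s hs
    refine ContinuousOn.inv₀ (by fun_prop) fun z hz h => hs ?_
    rwa [← sub_eq_zero.1 h]
  unfold rectIntegral
  rw [integral_horizontal_of_hasDerivAt hab (f := fun z => (z - p)⁻¹)
      (G := fun z => log (z - p)),
    integral_horizontal_of_hasDerivAt hab (f := fun z => (z - p)⁻¹)
      (G := fun z => log (z - p)),
    integral_vertical_of_hasDerivAt hcd (f := fun z => (z - p)⁻¹)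
      (G := fun z => log (z - p)),
    integral_vertical_of_hasDerivAt hcd (f := fun z => (z - p)⁻¹)
      (G := fun z => log (-(z - p)))]
  · rw [log_neg_of_im_pos (by simpa using hp'.2), log_neg_of_im_neg (by simpa using hp'.1)]
    ring
  · intro y hy
    refine hlog' _ (Or.inl ?_)
    simpa using hp.1
  · refine hc _ fun h => ?_
    exact hp.1.ne' h.1
  · intro y hy
    refine hlog _ (Or.inl ?_)
    simpa using hp.2
  · refine hc _ fun h => ?_
    exact hp.2.ne h.1
  · intro y hy
    refine hlog _ (Or.inr ?_)
    simpa [sub_eq_zero] using hp'.2.ne'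
  · refine hc _ fun h => ?_
    exact hp'.2.ne h.2
  · intro y hy
    refine hlog _ (Or.inr ?_)
    simpa [sub_eq_zero] using hp'.1.ne
  · refine hc _ fun h => ?_
    exact hp'.1.ne' h.2

/-- `e^ζ - 1 = ζ E(ζ)` for an entire function `E`. -/
noncomputable def expQuotient : ℂ → ℂ := dslope exp 0

lemma differentiable_expQuotient : Differentiable ℂ expQuotient := by
  have := (differentiableOn_dslope (c := (0 : ℂ)) (f := exp) univ_mem).2
    differentiable_exp.differentiableOn
  exact differentiableOn_univ.1 this

lemma mul_expQuotient (z : ℂ) : z * expQuotient z = exp z - 1 := by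
  have := sub_smul_dslope exp 0 z
  simpa [expQuotient] using this

lemma expQuotient_ne_zero {z : ℂ} (h1 : |z.im| < 2 * Real.pi) : expQuotient z ≠ 0 := by
  intro h
  have h2 := mul_expQuotient z
  rw [h, mul_zero, eq_comm, sub_eq_zero, exp_eq_one_iff] at h2
  obtain ⟨n, rfl⟩ := h2
  have h3 : n = 0 := by
    have : |(n : ℝ)| * (2 * Real.pi) < 1 * (2 * Real.pi) := by
      have h4 : ((n : ℂ) * (2 * Real.pi * I)).im = n * (2 * Real.pi) := by simp
      rw [h4, abs_mul, abs_of_pos Real.two_pi_pos] at h1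
      linarith
    have := lt_of_mul_lt_mul_right this Real.two_pi_pos.le
    have : |n| < 1 := by exact_mod_cast this
    exact Int.abs_lt_one_iff.1 this
  subst h3
  simp [expQuotient, dslope_same] at h

/-- The left side is the logarithmic derivative of exp z - exp p = e^p (z - p) E(z - p), with E the
function `expQuotient`. The bound on the imaginary part excludes the zeros of E. -/
lemma exp_div_exp_sub_exp {z p : ℂ} (hne : z ≠ p) (h : |(z - p).im| < 2 * Real.pi) :
    exp z / (exp z - exp p) =
      (z - p)⁻¹ + deriv expQuotient (z - p) / expQuotient (z - p) := by
  have h0 : z - p ≠ 0 := sub_ne_zero.2 hne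
  have hE := expQuotient_ne_zero h
  have h1 : exp (z - p) = expQuotient (z - p) + (z - p) * deriv expQuotient (z - p) := by
    have hd := (hasDerivAt_id (z - p)).mul
      (differentiable_expQuotient.differentiableAt (x := z - p)).hasDerivAt
    have he : (id * expQuotient : ℂ → ℂ) = fun w => exp w - 1 := by
      ext w; exact mul_expQuotient w
    rw [he] at hd
    have := hd.unique ((Complex.hasDerivAt_exp (z - p)).sub_const 1)
    simpa using this.symm
  have h2 : exp z - exp p = exp p * ((z - p) * expQuotient (z - p)) := by
    rw [mul_expQuotient, mul_sub, ← exp_add]; simp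
  have h3 : exp z = exp p * exp (z - p) := by rw [← exp_add]; simp
  rw [h2, h3, mul_div_mul_left _ _ (exp_ne_zero p), h1]
  field_simp

lemma exp_ne_exp {z p : ℂ} (hne : z ≠ p) (h : |(z - p).im| < 2 * Real.pi) : exp z ≠ exp p := by
  intro he
  have h2 : exp z - exp p = exp p * ((z - p) * expQuotient (z - p)) := by
    rw [mul_expQuotient, mul_sub, ← exp_add]; simp
  rw [he, sub_self, eq_comm] at h2
  simp [exp_ne_zero, sub_eq_zero, hne, expQuotient_ne_zero h] at h2

lemma rectIntegral_exp_div {p : ℂ} (hp : p.re ∈ Ioo a b) (hp' : p.im ∈ Ioo c d)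
    (hcd2 : d - c < 2 * Real.pi) :
    rectIntegral (fun z => exp z / (exp z - exp p)) a b c d = 2 * Real.pi * I := by
  have hab : a ≤ b := (hp.1.trans hp.2).le
  have hcd : c ≤ d := (hp'.1.trans hp'.2).le
  have him : ∀ z : ℂ, z.im ∈ Icc c d → |(z - p).im| < 2 * Real.pi := by
    intro z hz
    rw [sub_im, abs_lt]
    constructor <;> linarith [hz.1, hz.2, hp'.1, hp'.2]
  have hne : ∀ z ∈ rectBoundary a b c d, z ≠ p := by
    rintro z ⟨-, -, h⟩ rfl
    rcases h with h | h | h | h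
    · exact hp.1.ne' h
    · exact hp.2.ne h
    · exact hp'.1.ne' h
    · exact hp'.2.ne h
  have hdiff : DifferentiableOn ℂ
      (fun z => deriv expQuotient (z - p) / expQuotient (z - p)) (Icc a b ×ℂ Icc c d) := by
    intro z hz
    have h1 : DifferentiableAt ℂ (fun z => deriv expQuotient (z - p)) z := by
      have : Differentiable ℂ (deriv expQuotient) := fun w =>
        ((differentiable_expQuotient.analyticAt w).deriv).differentiableAt
      exact this.differentiableAt.comp z (by fun_prop)
    have h2 : DifferentiableAt ℂ (fun z => expQuotient (z - p)) z :=
      (differentiable_expQuotient.differentiableAt).comp z (by fun_prop)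
    exact (h1.div h2 (expQuotient_ne_zero (him z hz.2))).differentiableWithinAt
  rw [rectIntegral_congr hab hcd
    (fun z hz => exp_div_exp_sub_exp (hne z hz) (him z hz.2.1)),
    rectIntegral_add hab hcd, rectIntegral_inv_sub hp hp',
    rectIntegral_eq_zero_of_differentiableOn hab hcd hdiff, add_zero]
  · exact ContinuousOn.inv₀ (by fun_prop) fun z hz => sub_ne_zero.2 (hne z hz)
  · exact hdiff.continuousOn.mono fun z hz => ⟨hz.1, hz.2.1⟩

/-- The integrand has the primitive -(exp z - p)^{-(k+1)}/(k+1). Hence only the simple-pole part of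
a principal part contributes to the residue theorem below. -/
lemma rectIntegral_exp_mul_zpow {p : ℂ} (hab : a ≤ b) (hcd : c ≤ d)
    (hp : ∀ z ∈ rectBoundary a b c d, exp z ≠ p) (k : ℕ) :
    rectIntegral (fun z => exp z * ((exp z - p) ^ (k + 2))⁻¹) a b c d = 0 := by
  refine rectIntegral_eq_zero_of_hasDerivAt
    (G := fun z => -((k : ℂ) + 1)⁻¹ * ((exp z - p) ^ (k + 1))⁻¹) hab hcd ?_ ?_
  · intro z hz
    have h0 : exp z - p ≠ 0 := sub_ne_zero.2 (hp z hz)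
    have hk : (k : ℂ) + 1 ≠ 0 := by exact_mod_cast k.succ_ne_zero
    have := ((((hasDerivAt_exp z).sub_const p).pow (k + 1)).inv
      (pow_ne_zero _ h0)).const_mul (-((k : ℂ) + 1)⁻¹)
    refine this.congr_deriv ?_
    push_cast
    field_simp
    change _ = ((exp z - p) ^ (k + 1)) ^ 2
    ring
  · refine ContinuousOn.mul (by fun_prop) (ContinuousOn.inv₀ (by fun_prop) fun z hz => ?_)
    exact pow_ne_zero _ (sub_ne_zero.2 (hp z hz))

end Rectangle

/-! ### Principal parts and the residue theorem -/

/-- Each application of `dslope` splits off one Taylor coefficient of g. The resulting identity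
holds at every z ≠ p, not only near p. -/
lemma exists_principalPart_of_analyticAt {p : ℂ} (n : ℕ) :
    ∀ {g : ℂ → ℂ}, AnalyticAt ℂ g p → ∃ (c : ℕ → ℂ) (h : ℂ → ℂ), AnalyticAt ℂ h p ∧
      ∀ z, z ≠ p →
        ((z - p) ^ n)⁻¹ * g z = ∑ k ∈ Finset.range n, c k * ((z - p) ^ (k + 1))⁻¹ + h z := by
  induction n with
  | zero => exact fun {g} hg => ⟨0, g, hg, by simp⟩
  | succ n ih =>
    intro g hg
    have hg1 : AnalyticAt ℂ (dslope g p) p := by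
      obtain ⟨q, hq⟩ := hg
      exact hq.has_fpower_series_dslope_fslope.analyticAt
    obtain ⟨c, h, hh, hc⟩ := ih hg1
    refine ⟨fun k => if k = n then g p else c k, h, hh, fun z hz => ?_⟩
    have h1 : g z = g p + (z - p) * dslope g p z := by
      have := sub_smul_dslope g p z
      rw [smul_eq_mul] at this
      rw [this]; ring
    have hzp : z - p ≠ 0 := sub_ne_zero.2 hz
    rw [Finset.sum_range_succ, Finset.sum_congr rfl (g := fun k => c k * ((z - p) ^ (k + 1))⁻¹)]
    · have h2 := hc z hz
      simp only [if_true]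
      rw [add_right_comm, ← h2, h1]
      field_simp
      ring
    · intro k hk
      simp [(Finset.mem_range.1 hk).ne]

lemma exists_principalPart {f : ℂ → ℂ} {p : ℂ} (hf : MeromorphicAt f p) :
    ∃ (n : ℕ) (c : ℕ → ℂ) (h : ℂ → ℂ), AnalyticAt ℂ h p ∧
      ∀ z, z ≠ p → f z = ∑ k ∈ Finset.range (n + 1), c k * ((z - p) ^ (k + 1))⁻¹ + h z := by
  obtain ⟨n, hn⟩ := hf
  have hn' : AnalyticAt ℂ (fun z => (z - p) ^ (n + 1) * f z) p := by
    have h1 : AnalyticAt ℂ (fun z : ℂ => z - p) p := by fun_prop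
    have := h1.mul hn
    refine this.congr (Eventually.of_forall fun z => ?_)
    simp only [Pi.mul_apply, smul_eq_mul]
    ring
  obtain ⟨c, h, hh, hc⟩ := exists_principalPart_of_analyticAt (n + 1) hn'
  refine ⟨n, c, h, hh, fun z hz => ?_⟩
  rw [← hc z hz, inv_mul_cancel_left₀ (pow_ne_zero _ (sub_ne_zero.2 hz))]

/-- On all small circles the integral has the same value: h contributes nothing by Cauchy's theorem,
and among the powers of z - p only the exponent -1 does. -/
lemma residue_eq_of_principalPart {f h : ℂ → ℂ} {p : ℂ} {n : ℕ} {c : ℕ → ℂ}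
    (hh : AnalyticAt ℂ h p)
    (hf : ∀ z, z ≠ p → f z = ∑ k ∈ Finset.range (n + 1), c k * ((z - p) ^ (k + 1))⁻¹ + h z) :
    residue f p = c 0 := by
  refine Tendsto.limUnder_eq (tendsto_const_nhds.congr' ?_)
  obtain ⟨r0, hr0, hball⟩ := Metric.eventually_nhds_iff_ball.1 hh.eventually_analyticAt
  have hmem : Ioo (0 : ℝ) r0 ∈ 𝓝[>] (0 : ℝ) := Ioo_mem_nhdsGT hr0
  filter_upwards [hmem] with r hr
  have hr' : 0 ≤ r := hr.1.le
  have hne : ∀ z ∈ Metric.sphere p r, z ≠ p := by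
    rintro z hz rfl
    simp at hz
    exact hr.1.ne hz
  have hsub : Metric.closedBall p r ⊆ Metric.ball p r0 := Metric.closedBall_subset_ball hr.2
  have e1 : (∮ z in C(p, r), f z * (z - p) ^ (-(-1 : ℤ) - 1)) =
      ∮ z in C(p, r), (∑ k ∈ Finset.range (n + 1), c k * ((z - p) ^ (k + 1))⁻¹ + h z) := by
    refine circleIntegral.integral_congr hr' fun z hz => ?_
    simp only [neg_neg, sub_self, zpow_zero, mul_one]
    exact hf z (hne z hz)
  have hcont : ∀ k : ℕ, ContinuousOn (fun z => c k * ((z - p) ^ (k + 1))⁻¹)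
      (Metric.sphere p r) := by
    intro k
    refine ContinuousOn.mul (by fun_prop) (ContinuousOn.inv₀ (by fun_prop) fun z hz => ?_)
    exact pow_ne_zero _ (sub_ne_zero.2 (hne z hz))
  have hhd : DifferentiableOn ℂ h (Metric.closedBall p r) := fun z hz =>
    (hball z (hsub hz)).differentiableAt.differentiableWithinAt
  have e2 : (∮ z in C(p, r), h z) = 0 :=
    circleIntegral_eq_zero_of_differentiable_on_off_countable hr' countable_empty
      hhd.continuousOn fun z hz =>
        (hball z (hsub (Metric.ball_subset_closedBall hz.1))).differentiableAt
  have e3 : ∀ k : ℕ, (∮ z in C(p, r), c k * ((z - p) ^ (k + 1))⁻¹) =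
      if k = 0 then c 0 * (2 * Real.pi * I) else 0 := by
    intro k
    rw [circleIntegral.integral_const_mul]
    split_ifs with hk
    · subst hk
      simp only [zero_add, pow_one]
      rw [circleIntegral.integral_sub_center_inv _ hr.1.ne']
    · have := circleIntegral.integral_sub_zpow_of_ne (n := -((k : ℤ) + 1)) (by omega) p p r
      have h2 : ∀ z : ℂ, (z - p) ^ (-((k : ℤ) + 1)) = ((z - p) ^ (k + 1))⁻¹ := by
        intro z; rw [zpow_neg]; norm_cast
      simp only [h2] at this
      rw [this, mul_zero]
  rw [e1, circleIntegral.integral_add, e2, circleIntegral.integral_fun_sum]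
  · simp only [e3, Finset.sum_ite_eq', Finset.mem_range, Nat.succ_pos', if_true, add_zero]
    rw [mul_comm (c 0), inv_mul_cancel_left₀ two_pi_I_ne_zero]
  · exact fun k _ => (hcont k).circleIntegrable hr'
  · exact (continuousOn_finsetSum _ fun k _ => hcont k).circleIntegrable hr'
  · exact (hhd.continuousOn.mono Metric.sphere_subset_closedBall).circleIntegrable hr'

/-- The residue theorem for the image of a rectangle of height less than `2π` under the
exponential. -/
theorem rectIntegral_eq_sum_residue {f : ℂ → ℂ} {S : Finset ℂ} {a b c d : ℝ} (hab : a ≤ b)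
    (hcd : c ≤ d) (hcd2 : d - c < 2 * Real.pi)
    (hf : ∀ ζ ∈ Icc a b ×ℂ Icc c d, exp ζ ∉ S → AnalyticAt ℂ f (exp ζ))
    (hS : ∀ p ∈ S, MeromorphicAt f p)
    (hS' : ∀ p ∈ S, ∃ ξ : ℂ, exp ξ = p ∧ ξ.re ∈ Ioo a b ∧ ξ.im ∈ Ioo c d) :
    rectIntegral (fun ζ => exp ζ * f (exp ζ)) a b c d =
      2 * Real.pi * I * ∑ p ∈ S, residue f p := by
  classical
  choose! n C h hh hC using fun p hp => exists_principalPart (hS p hp)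
  set q : ℂ → ℂ → ℂ := fun p z =>
    ∑ k ∈ Finset.range (n p + 1), C p k * ((z - p) ^ (k + 1))⁻¹ with hq
  have hqa : ∀ p z, z ≠ p → AnalyticAt ℂ (q p) z := by
    intro p z hz
    refine Finset.analyticAt_fun_sum _ fun k _ => ?_
    exact analyticAt_const.mul (((analyticAt_id.sub analyticAt_const).pow _).inv
      (pow_ne_zero _ (sub_ne_zero.2 hz)))
  -- This is f minus all principal parts. At a point of S the singular term is replaced by the
  -- holomorphic remainder h, which makes the function analytic on the image of the whole rectangle.
  set F' : ℂ → ℂ := fun z => if z ∈ S then h z z - ∑ p ∈ S.erase z, q p z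
    else f z - ∑ p ∈ S, q p z with hF'
  -- Since the rectangle is less than 2π high, each p in S has only one logarithm in it, and that
  -- one is interior.
  have hbd : ∀ z ∈ rectBoundary a b c d, ∀ p ∈ S, exp z ≠ p := by
    rintro z ⟨h1, h2, h3⟩ p hp he
    obtain ⟨ξ, hξ, hre, him⟩ := hS' p hp
    rw [← hξ] at he
    by_cases hz : z = ξ
    · subst hz
      rcases h3 with h | h | h | h
      · exact hre.1.ne' h
      · exact hre.2.ne h
      · exact him.1.ne' h
      · exact him.2.ne h
    · refine exp_ne_exp hz ?_ he
      rw [sub_im, abs_lt]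
      constructor <;> linarith [h2.1, h2.2, him.1, him.2]
  have hF'a : ∀ ζ ∈ Icc a b ×ℂ Icc c d, AnalyticAt ℂ F' (exp ζ) := by
    intro ζ hζ
    by_cases hm : exp ζ ∈ S
    · set p := exp ζ
      have h1 : AnalyticAt ℂ (fun z => h p z - ∑ p' ∈ S.erase p, q p' z) p :=
        (hh p hm).sub (Finset.analyticAt_fun_sum _ fun p' hp' =>
          hqa p' p (Finset.ne_of_mem_erase hp').symm)
      refine h1.congr ?_
      have h2 : ((S.erase p : Finset ℂ) : Set ℂ)ᶜ ∈ 𝓝 p :=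
        (S.erase p).finite_toSet.isClosed.isOpen_compl.mem_nhds (by simp)
      filter_upwards [h2] with z hz
      by_cases hzp : z = p
      · subst hzp; simp [hF', hm]
      · have hzS : z ∉ S := fun hzS => hz (by simp [hzp, hzS])
        simp only [hF', hzS, if_false]
        rw [hC p hm z hzp, ← Finset.add_sum_erase S (fun p => q p z) hm]
        ring
    · have h1 : AnalyticAt ℂ (fun z => f z - ∑ p ∈ S, q p z) (exp ζ) :=
        (hf ζ hζ hm).sub (Finset.analyticAt_fun_sum _ fun p hp =>
          hqa p _ fun he => hm (he ▸ hp))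
      refine h1.congr ?_
      filter_upwards [S.finite_toSet.isClosed.isOpen_compl.mem_nhds
        (show exp ζ ∈ (S : Set ℂ)ᶜ by simpa using hm)] with z hz
      have hzS : z ∉ S := by simpa using hz
      simp [hF', hzS]
  have hdiff : DifferentiableOn ℂ (fun ζ => exp ζ * F' (exp ζ)) (Icc a b ×ℂ Icc c d) := by
    intro ζ hζ
    exact (differentiableAt_exp.mul
      ((hF'a ζ hζ).differentiableAt.comp ζ differentiableAt_exp)).differentiableWithinAt
  have hsub : rectBoundary a b c d ⊆ Icc a b ×ℂ Icc c d := fun z hz => ⟨hz.1, hz.2.1⟩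
  have hterm : ∀ p ∈ S, ∀ k, ContinuousOn (fun ζ => exp ζ * (C p k * ((exp ζ - p) ^ (k + 1))⁻¹))
      (rectBoundary a b c d) := by
    intro p hp k
    refine ContinuousOn.mul (by fun_prop) (ContinuousOn.mul (by fun_prop)
      (ContinuousOn.inv₀ (by fun_prop) fun z hz => ?_))
    exact pow_ne_zero _ (sub_ne_zero.2 (hbd z hz p hp))
  have hqc : ∀ p ∈ S, ContinuousOn (fun ζ => exp ζ * q p (exp ζ)) (rectBoundary a b c d) := by
    intro p hp
    simp only [hq, Finset.mul_sum]
    exact continuousOn_finsetSum _ fun k _ => hterm p hp k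
  have hqi : ∀ p ∈ S, rectIntegral (fun ζ => exp ζ * q p (exp ζ)) a b c d =
      2 * Real.pi * I * residue f p := by
    intro p hp
    simp only [hq, Finset.mul_sum]
    rw [rectIntegral_sum hab hcd _ _ fun k _ => hterm p hp k, Finset.sum_range_succ',
      Finset.sum_eq_zero, zero_add, residue_eq_of_principalPart (hh p hp) (hC p hp)]
    · obtain ⟨ξ, hξ, hre, him⟩ := hS' p hp
      have := rectIntegral_exp_div hre him hcd2
      rw [hξ] at this
      rw [← this, mul_comm _ (C p 0), ← rectIntegral_const_mul]
      congr 1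
      ext z
      simp only [zero_add, pow_one]
      ring
    · intro k _
      rw [show (fun ζ => exp ζ * (C p (k + 1) * ((exp ζ - p) ^ (k + 1 + 1))⁻¹)) =
        fun ζ => C p (k + 1) * (exp ζ * ((exp ζ - p) ^ (k + 2))⁻¹) by ext z; ring,
        rectIntegral_const_mul,
        rectIntegral_exp_mul_zpow hab hcd (fun z hz => hbd z hz p hp), mul_zero]
  have hcongr : EqOn (fun ζ => exp ζ * f (exp ζ))
      (fun ζ => exp ζ * F' (exp ζ) + ∑ p ∈ S, exp ζ * q p (exp ζ)) (rectBoundary a b c d) := by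
    intro z hz
    have hzS : exp z ∉ S := fun hm => hbd z hz _ hm rfl
    simp only [hF', hzS, if_false, ← Finset.mul_sum]
    ring
  rw [rectIntegral_congr hab hcd hcongr, rectIntegral_add hab hcd
    (hdiff.continuousOn.mono hsub) (continuousOn_finsetSum _ fun p hp => hqc p hp),
    rectIntegral_eq_zero_of_differentiableOn hab hcd hdiff, zero_add,
    rectIntegral_sum hab hcd _ _ hqc, Finset.sum_congr rfl hqi, Finset.mul_sum]

/-! ### Zeros of the denominator -/

/-- The denominator of `F_N(u, δ)`. -/
noncomputable def den (δ : Param N) (u : ℂ) : ℂ :=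
  ∏ l, (1 - e (δ.θ l) * exp (-u * δ.a l))

lemma F_eq (δ : Param N) (u : ℂ) : F u δ = exp (-u * δ.w) * (den δ u)⁻¹ := by
  rw [F, den, Finset.prod_inv_distrib]

lemma differentiable_den (δ : Param N) : Differentiable ℂ (den δ) := by
  unfold den; fun_prop

lemma factor_eq_zero_iff {t u a : ℂ} : 1 - e t * exp (-u * a) = 0 ↔ e t = exp (u * a) := by
  rw [sub_eq_zero, neg_mul, exp_neg, ← div_eq_mul_inv, eq_comm, div_eq_one_iff_eq (exp_ne_zero _)]

lemma den_eq_zero_iff (δ : Param N) (u : ℂ) :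
    den δ u = 0 ↔ ∃ l, e (δ.θ l) = exp (u * δ.a l) := by
  simp [den, Finset.prod_eq_zero_iff, ← factor_eq_zero_iff]

lemma e_eq_exp_iff {t z : ℂ} : e t = exp z ↔ ∃ n : ℤ, z = 2 * Real.pi * I * (t + n) := by
  rw [e, eq_comm, exp_eq_exp_iff_exists_int]
  refine exists_congr fun n => ?_
  rw [mul_add, mul_comm (n : ℂ)]

lemma a_ne_zero_of_zero (δ : Param N) {u : ℂ} {l : Fin N} (h : e (δ.θ l) = exp (u * δ.a l)) :
    δ.a l ≠ 0 := by
  intro ha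
  obtain ⟨n, hn⟩ := e_eq_exp_iff.1 h
  rw [ha, mul_zero, eq_comm, mul_eq_zero, or_iff_right two_pi_I_ne_zero] at hn
  refine δ.good l ha (-n) ?_
  have : ((δ.θ l + n : ℝ) : ℂ) = 0 := by push_cast; exact hn
  have := ofReal_eq_zero.1 this
  push_cast; linarith

/-- The angle `φ` is critical if some `u a_ℓ ≠ 0` is purely imaginary for `arg u = φ`. -/
def IsCritical (δ : Param N) (φ : ℝ) : Prop := ∃ l, δ.a l ≠ 0 ∧ (exp (φ * I) * δ.a l).re = 0

lemma exists_eq_of_den_eq_zero {δ : Param N} {u : ℂ} (h : den δ u = 0) :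
    ∃ l, δ.a l ≠ 0 ∧ ∃ n : ℤ, u * δ.a l = 2 * Real.pi * I * (δ.θ l + n) := by
  obtain ⟨l, hl⟩ := (den_eq_zero_iff δ u).1 h
  exact ⟨l, a_ne_zero_of_zero δ hl, e_eq_exp_iff.1 hl⟩

/-- A zero satisfies u a_ℓ = 2πi(θ_ℓ + n) for some ℓ and n, and the right side is purely imaginary
because θ_ℓ is real. -/
lemma isCritical_of_den_eq_zero {δ : Param N} {x φ : ℝ} (hx : x ≠ 0)
    (h : den δ (x * exp (φ * I)) = 0) : IsCritical δ φ := by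
  obtain ⟨l, ha, n, hn⟩ := exists_eq_of_den_eq_zero h
  refine ⟨l, ha, ?_⟩
  have h1 := congrArg re hn
  have h2 : (2 * Real.pi * I * (δ.θ l + n) : ℂ) = ((2 * Real.pi * (δ.θ l + n) : ℝ) : ℂ) * I := by
    push_cast; ring
  rw [h2, mul_assoc, re_ofReal_mul, re_ofReal_mul, I_re, mul_zero, mul_eq_zero] at h1
  exact h1.resolve_left hx

lemma isCritical_arg {δ : Param N} {u : ℂ} (hu : u ≠ 0) (h : den δ u = 0) :
    IsCritical δ u.arg :=
  isCritical_of_den_eq_zero (norm_ne_zero_iff.2 hu) (by rwa [norm_mul_exp_arg_mul_I])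

lemma finite_zeros (δ : Param N) (R : ℝ) : {u : ℂ | den δ u = 0 ∧ ‖u‖ ≤ R}.Finite := by
  have key : ∀ l : Fin N, δ.a l ≠ 0 →
      {u : ℂ | ‖u‖ ≤ R ∧ ∃ n : ℤ, u * δ.a l = 2 * Real.pi * I * (δ.θ l + n)}.Finite := by
    intro l ha
    -- From u a_ℓ = 2πi(θ_ℓ + n) and 2π ≥ 1 follows |θ_ℓ + n| ≤ R|a_ℓ|, which confines n to [-m, m].
    set m : ℤ := ⌈R * ‖δ.a l‖ + |δ.θ l|⌉
    refine ((finite_Icc (-m) m).image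
      fun n : ℤ => 2 * Real.pi * I * (δ.θ l + n) / δ.a l).subset ?_
    rintro u ⟨hu, n, hn⟩
    refine ⟨n, ?_, ?_⟩
    · have h1 := congrArg norm hn
      have h2 : (2 * Real.pi * I * (δ.θ l + n) : ℂ) =
        ((2 * Real.pi * (δ.θ l + n) : ℝ) : ℂ) * I := by push_cast; ring
      rw [h2, norm_mul, norm_mul, norm_I, mul_one, norm_real, Real.norm_eq_abs, abs_mul,
        abs_of_pos Real.two_pi_pos] at h1
      have h3 : |δ.θ l + n| ≤ R * ‖δ.a l‖ := by
        have h4 : ‖u‖ * ‖δ.a l‖ ≤ R * ‖δ.a l‖ := by gcongr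
        have h5 : 1 * |δ.θ l + n| ≤ 2 * Real.pi * |δ.θ l + n| := by
          gcongr; linarith [Real.pi_gt_three]
        linarith
      have h6 : |(n : ℝ)| ≤ R * ‖δ.a l‖ + |δ.θ l| := by
        have : (n : ℝ) = (δ.θ l + n) - δ.θ l := by ring
        rw [this]
        exact (abs_sub _ _).trans (by linarith)
      have h7 : |(n : ℝ)| ≤ m := h6.trans (Int.le_ceil _)
      have h8 : |n| ≤ m := by exact_mod_cast h7
      exact ⟨(abs_le.1 h8).1, (abs_le.1 h8).2⟩
    · simp only
      rw [← hn, mul_div_cancel_right₀ _ ha]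
  refine (finite_iUnion fun l : Fin N => finite_iUnion fun ha : δ.a l ≠ 0 => key l ha).subset ?_
  rintro u ⟨h0, hR⟩
  obtain ⟨l, ha, h⟩ := exists_eq_of_den_eq_zero h0
  simp only [mem_iUnion]
  exact ⟨l, ha, hR, h⟩

lemma eventually_den_ne_zero (δ : Param N) (u : ℂ) : ∀ᶠ v in 𝓝[≠] u, den δ v ≠ 0 := by
  have h1 := ((finite_zeros δ (‖u‖ + 1)).sdiff (t := {u})).isClosed.isOpen_compl.mem_nhds
    (show u ∈ ({v : ℂ | den δ v = 0 ∧ ‖v‖ ≤ ‖u‖ + 1} \ {u})ᶜ by simp)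
  have h2 : ∀ᶠ v in 𝓝 u, ‖v‖ < ‖u‖ + 1 :=
    (continuous_norm.tendsto u).eventually (gt_mem_nhds (by linarith))
  filter_upwards [nhdsWithin_le_nhds h1, nhdsWithin_le_nhds h2, self_mem_nhdsWithin]
    with v h3 h4 h5 h6
  exact h3 ⟨⟨h6, h4.le⟩, h5⟩

lemma analyticAt_F {δ : Param N} {u : ℂ} (h : den δ u ≠ 0) : AnalyticAt ℂ (fun v => F v δ) u := by
  simp only [F_eq]
  have h1 : AnalyticAt ℂ (den δ) u := (differentiable_den δ).analyticAt u
  have h2 : AnalyticAt ℂ (fun v : ℂ => exp (-v * δ.w)) u := by fun_prop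
  exact h2.mul (h1.inv h)

lemma meromorphicAt_F (δ : Param N) (u : ℂ) : MeromorphicAt (fun v => F v δ) u := by
  simp only [F_eq]
  have h1 : AnalyticAt ℂ (den δ) u := (differentiable_den δ).analyticAt u
  have h2 : AnalyticAt ℂ (fun v : ℂ => exp (-v * δ.w)) u := by fun_prop
  exact h2.meromorphicAt.mul h1.meromorphicAt.inv

/-- The numerator of F is an exponential and cannot cancel a zero of the denominator, so F tends to
infinity there. -/
lemma meromorphicOrderAt_F_neg_iff (δ : Param N) (u : ℂ) :
    meromorphicOrderAt (fun v => F v δ) u < 0 ↔ den δ u = 0 := by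
  constructor
  · intro h
    by_contra h0
    exact absurd h (not_lt.2 (analyticAt_F h0).meromorphicOrderAt_nonneg)
  · intro h
    rw [← tendsto_cobounded_iff_meromorphicOrderAt_neg (meromorphicAt_F δ u)]
    have h1 : Tendsto (fun v => (den δ v)⁻¹) (𝓝[≠] u) (Bornology.cobounded ℂ) := by
      refine Filter.tendsto_inv₀_nhdsNE_zero.comp ?_
      refine tendsto_nhdsWithin_iff.2 ⟨?_, eventually_den_ne_zero δ u⟩
      rw [← h]
      exact ((differentiable_den δ).continuous.tendsto u).mono_left nhdsWithin_le_nhds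
    have h2 : Tendsto (fun v : ℂ => exp (-v * δ.w)) (𝓝[≠] u) (𝓝 (exp (-u * δ.w))) := by
      have : Continuous fun v : ℂ => exp (-v * δ.w) := by fun_prop
      exact (this.tendsto u).mono_left nhdsWithin_le_nhds
    simp only [F_eq]
    rw [← tendsto_norm_atTop_iff_cobounded] at h1 ⊢
    simp only [norm_mul]
    exact h2.norm.pos_mul_atTop (norm_pos_iff.2 (exp_ne_zero _)) h1

lemma mem_poles_iff {ψ : ℝ} {δ : Param N} {u : ℂ} :
    u ∈ poles ψ δ ↔ u ≠ 0 ∧ den δ u = 0 ∧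
      ((0 < ψ ∧ 0 ≤ u.arg ∧ u.arg < ψ) ∨ (ψ < 0 ∧ ψ ≤ u.arg ∧ u.arg < 0)) := by
  rw [poles, mem_ofPred_eq, meromorphicOrderAt_F_neg_iff]

/-! ### A lower bound for the factors of the denominator -/

/-- For |Re z| > 1 one of the terms 1 and e^{-z} dominates the other. The rest of the plane reduces
modulo 2πi to a compact set on which 1 - e^{-z} has no zero. -/
lemma exists_le_norm_one_sub_exp {ε : ℝ} (hε : 0 < ε) :
    ∃ c > 0, ∀ z : ℂ, (∀ n : ℤ, ε ≤ ‖z - 2 * Real.pi * I * n‖) →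
      c * max 1 (Real.exp (-z.re)) ≤ ‖1 - exp (-z)‖ := by
  set K : Set ℂ := (Icc (-1) 1 ×ℂ Icc (-Real.pi) Real.pi) ∩ {z | ε ≤ ‖z‖}
  have hK : IsCompact K :=
    (isCompact_Icc.reProdIm isCompact_Icc).inter_right
      (isClosed_le continuous_const continuous_norm)
  obtain ⟨m, hm, hmK⟩ : ∃ m > 0, ∀ z ∈ K, m ≤ ‖1 - exp (-z)‖ := by
    rcases K.eq_empty_or_nonempty with h | h
    · exact ⟨1, one_pos, by simp [h]⟩
    · obtain ⟨z0, hz0, hmin⟩ := hK.exists_isMinOn h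
        (f := fun z => ‖1 - exp (-z)‖) (by fun_prop)
      refine ⟨_, norm_pos_iff.2 fun h0 => ?_, fun z hz => hmin hz⟩
      have h1 : exp (-z0) = exp 0 := by rw [exp_zero]; exact (sub_eq_zero.1 h0).symm
      by_cases hz : z0 = 0
      · have := hz0.2
        simp only [mem_ofPred_eq, hz, norm_zero] at this
        linarith
      · refine exp_ne_exp (neg_ne_zero.2 hz) ?_ h1
        have := hz0.1.2
        rw [sub_zero, neg_im, abs_neg]
        exact (abs_le.2 ⟨this.1, this.2⟩).trans_lt (by linarith [Real.pi_pos])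
  have he1 : 0 < 1 - Real.exp (-1) := by
    rw [sub_pos, Real.exp_lt_one_iff]; norm_num
  refine ⟨min (1 - Real.exp (-1)) (m / Real.exp 1), by positivity, fun z hz => ?_⟩
  have hn : ‖exp (-z)‖ = Real.exp (-z.re) := by rw [norm_exp, neg_re]
  rcases lt_or_ge 1 z.re with h | h
  · have h1 : Real.exp (-z.re) ≤ Real.exp (-1) := Real.exp_le_exp.2 (by linarith)
    have h2 : max 1 (Real.exp (-z.re)) = 1 := max_eq_left (by linarith)
    have h3 := norm_sub_norm_le (1 : ℂ) (exp (-z))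
    rw [hn, norm_one] at h3
    rw [h2, mul_one]
    exact (min_le_left _ _).trans (by linarith)
  rcases lt_or_ge z.re (-1) with h' | h'
  · have h1 : Real.exp 1 ≤ Real.exp (-z.re) := Real.exp_le_exp.2 (by linarith)
    have h0 : 1 ≤ Real.exp 1 := Real.one_le_exp (by norm_num)
    have h2 : max 1 (Real.exp (-z.re)) = Real.exp (-z.re) := max_eq_right (by linarith)
    have h3 := norm_sub_norm_le (exp (-z)) 1
    rw [hn, norm_one, norm_sub_rev] at h3
    rw [h2]
    have h4 : (1 - Real.exp (-1)) * Real.exp (-z.re) ≤ Real.exp (-z.re) - 1 := by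
      have : 1 ≤ Real.exp (-1) * Real.exp (-z.re) := by
        rw [← Real.exp_add]; exact Real.one_le_exp (by linarith)
      linarith
    refine le_trans ?_ (h4.trans h3)
    gcongr
    exact min_le_left _ _
  -- Subtracting the nearest multiple of 2πi moves z into K and leaves exp(-z) unchanged.
  · set n : ℤ := round (z.im / (2 * Real.pi))
    have h1 := abs_sub_round (z.im / (2 * Real.pi))
    set z' := z - 2 * Real.pi * I * n with hz'
    have hre : z'.re = z.re := by
      rw [hz', show (2 * Real.pi * I * n : ℂ) = ((2 * Real.pi * n : ℝ) : ℂ) * I by push_cast; ring]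
      simp
    have him : z'.im = z.im - 2 * Real.pi * n := by
      rw [hz', show (2 * Real.pi * I * n : ℂ) = ((2 * Real.pi * n : ℝ) : ℂ) * I by push_cast; ring]
      simp
    have hexp : exp (-z') = exp (-z) := by
      rw [exp_eq_exp_iff_exists_int]
      exact ⟨n, by rw [hz']; ring⟩
    have hmem : z' ∈ K := by
      refine ⟨⟨by rw [mem_preimage, hre]; exact ⟨h', h⟩, ?_⟩, hz n⟩
      rw [mem_preimage, him, mem_Icc, ← abs_le]
      have : z.im - 2 * Real.pi * n = (2 * Real.pi) * (z.im / (2 * Real.pi) - n) := by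
        field_simp
      rw [this, abs_mul, abs_of_pos Real.two_pi_pos]
      have : 2 * Real.pi * |z.im / (2 * Real.pi) - n| ≤ 2 * Real.pi * (1 / 2) := by
        gcongr
      linarith
    have h2 := hmK z' hmem
    rw [hexp] at h2
    have h3 : max 1 (Real.exp (-z.re)) ≤ Real.exp 1 :=
      max_le (Real.one_le_exp (by norm_num)) (Real.exp_le_exp.2 (by linarith))
    calc min (1 - Real.exp (-1)) (m / Real.exp 1) * max 1 (Real.exp (-z.re))
        ≤ (m / Real.exp 1) * Real.exp 1 := by
          gcongr
          exact min_le_right _ _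
      _ = m := by field_simp
      _ ≤ _ := h2

/-- The exponent of decay of `F_N(·, δ)` away from its poles. -/
noncomputable def height (δ : Param N) (u : ℂ) : ℝ :=
  (u * δ.w).re + ∑ l, max 0 (-(u * δ.a l).re)

/-- The previous bound is applied factor by factor at z = u a_ℓ - 2πiθ_ℓ, using max(1, e^{-x}) =
e^{max(0, -x)}. Factors with a_ℓ = 0 are nonzero constants. -/
lemma exists_norm_F_le (δ : Param N) {ε : ℝ} (hε : 0 < ε) :
    ∃ C > 0, ∀ u : ℂ,
      (∀ l, δ.a l ≠ 0 → ∀ n : ℤ, ε ≤ ‖u * δ.a l - 2 * Real.pi * I * (δ.θ l + n)‖) →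
      ‖F u δ‖ ≤ C * Real.exp (-height δ u) := by
  obtain ⟨c, hc, hcz⟩ := exists_le_norm_one_sub_exp hε
  have hfac : ∀ l : Fin N, ∃ C > 0, ∀ u : ℂ,
      (δ.a l ≠ 0 → ∀ n : ℤ, ε ≤ ‖u * δ.a l - 2 * Real.pi * I * (δ.θ l + n)‖) →
      ‖(1 - e (δ.θ l) * exp (-u * δ.a l))⁻¹‖ ≤ C * Real.exp (-max 0 (-(u * δ.a l).re)) := by
    intro l
    by_cases ha : δ.a l = 0
    · have hne : 1 - e (δ.θ l) ≠ 0 := by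
        intro h
        have := a_ne_zero_of_zero δ (l := l) (u := 0) (by
          rw [zero_mul, exp_zero]; exact (sub_eq_zero.1 h).symm)
        exact this ha
      refine ⟨‖(1 - e (δ.θ l))⁻¹‖, norm_pos_iff.2 (inv_ne_zero hne), fun u _ => ?_⟩
      simp [ha]
    · refine ⟨c⁻¹, inv_pos.2 hc, fun u hu => ?_⟩
      have h1 := hcz (u * δ.a l - 2 * Real.pi * I * δ.θ l) fun n => by
        rw [sub_sub, ← mul_add]; exact hu ha n
      have h2 : exp (-(u * δ.a l - 2 * Real.pi * I * δ.θ l)) =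
          e (δ.θ l) * exp (-u * δ.a l) := by
        rw [e, ← exp_add]; congr 1; ring
      have h3 : (u * δ.a l - 2 * Real.pi * I * δ.θ l).re = (u * δ.a l).re := by
        rw [show (2 * Real.pi * I * δ.θ l : ℂ) = ((2 * Real.pi * δ.θ l : ℝ) : ℂ) * I by
          push_cast; ring]
        simp
      rw [h2, h3] at h1
      have h4 : max 1 (Real.exp (-(u * δ.a l).re)) = Real.exp (max 0 (-(u * δ.a l).re)) := by
        rw [Real.exp_monotone.map_max, Real.exp_zero]
      rw [h4] at h1
      rw [norm_inv, Real.exp_neg, ← mul_inv]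
      exact inv_anti₀ (by positivity) h1
  choose C hC hCb using hfac
  refine ⟨∏ l, C l, Finset.prod_pos fun l _ => hC l, fun u hu => ?_⟩
  rw [F, norm_mul, norm_prod, norm_exp, height, neg_add, Real.exp_add, ← Finset.sum_neg_distrib,
    Real.exp_sum]
  calc Real.exp (-u * δ.w).re * ∏ l, ‖(1 - e (δ.θ l) * exp (-u * δ.a l))⁻¹‖
      ≤ Real.exp (-u * δ.w).re *
        ∏ l, (C l * Real.exp (-max 0 (-(u * δ.a l).re))) := by
        gcongr with l
        exact hCb l u (hu l)
    _ = _ := by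
        rw [Finset.prod_mul_distrib, neg_mul, neg_re]; ring

/-! ### Positivity of the exponent on the stable domain -/

lemma re_nonpos_of_neg_mem_cone {z : ℂ} (h : -z ∈ cone) : z.re ≤ 0 := by
  rcases h with h | h <;> simp at h <;> linarith

lemma re_nonneg_of_neg_notMem_cone {z : ℂ} (h : -z ∉ cone) : 0 ≤ z.re := by
  by_contra h'
  exact h (Or.inl (by simpa using h'))

open Classical in
lemma proj_eq (δ : Param N) :
    proj δ = δ.w - ∑ l, if -δ.a l ∈ cone then δ.a l else 0 := by
  rw [proj, tr, Finset.sum_filter]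

open Classical in
lemma proj_M_eq (δ : Param N) (α : ℂˣ) :
    proj (M α δ) = α * δ.w - ∑ l, if -(α * δ.a l) ∈ cone then α * δ.a l else 0 :=
  proj_eq (M α δ)

/-- This translates membership in the stable domain into a property of the decay exponent. How the
cone divides the imaginary axis is irrelevant here, as such entries have real part zero. -/
lemma re_proj (δ : Param N) (α : ℂˣ) : (proj (M α δ)).re = height δ α := by
  classical
  rw [proj_M_eq, height, sub_re, re_sum, sub_eq_add_neg, ← Finset.sum_neg_distrib]
  congr 1
  refine Finset.sum_congr rfl fun l _ => ?_
  split_ifs with h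
  · rw [max_eq_right]
    have := re_nonpos_of_neg_mem_cone h
    linarith
  · rw [max_eq_left, zero_re, neg_zero]
    have := re_nonneg_of_neg_notMem_cone h
    linarith

lemma height_real_mul (δ : Param N) {x : ℝ} (hx : 0 ≤ x) (u : ℂ) :
    height δ (x * u) = x * height δ u := by
  simp only [height, mul_assoc, re_ofReal_mul, mul_add, Finset.mul_sum]
  congr 1
  refine Finset.sum_congr rfl fun l _ => ?_
  rw [← mul_neg, mul_max_of_nonneg _ _ hx, mul_zero]

lemma height_exp_nonneg {δ : Param N} (hδ : δ ∈ stableDomain N) (φ : ℝ) :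
    0 ≤ height δ (exp (φ * I)) := by
  have h := hδ (Units.mk0 (exp (φ * I)) (exp_ne_zero _))
  have h2 := re_proj δ (Units.mk0 (exp (φ * I)) (exp_ne_zero _))
  rw [Units.val_mk0] at h2
  rw [← h2]
  rcases h with h | h
  · exact h.le
  · exact h.1.ge

lemma nonneg_or_nonpos_of_ne_zero {g : ℝ → ℝ} {A B : ℝ} (hg : Continuous g)
    (h : ∀ t ∈ Ioo A B, g t ≠ 0) : (∀ t ∈ Icc A B, 0 ≤ g t) ∨ (∀ t ∈ Icc A B, g t ≤ 0) := by
  by_contra! hcon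
  obtain ⟨⟨t1, ht1, h1⟩, ⟨t2, ht2, h2⟩⟩ := hcon
  obtain ⟨t, ht, h0⟩ := intermediate_value_uIcc (hg.continuousOn (s := uIcc t1 t2))
    (show (0 : ℝ) ∈ uIcc (g t1) (g t2) from mem_uIcc_of_le h1.le h2.le)
  have hne1 : t ≠ t1 := by rintro rfl; exact h1.ne h0
  have hne2 : t ≠ t2 := by rintro rfl; exact h2.ne' h0
  refine h t ?_ h0
  rcases mem_uIcc.1 ht with ht | ht
  · exact ⟨ht1.1.trans_lt (lt_of_le_of_ne ht.1 hne1.symm),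
      (lt_of_le_of_ne ht.2 hne2).trans_le ht2.2⟩
  · exact ⟨ht2.1.trans_lt (lt_of_le_of_ne ht.1 hne2.symm),
      (lt_of_le_of_ne ht.2 hne1).trans_le ht1.2⟩

/-- Without critical angles inside the interval each Re(e^{it} a_ℓ) keeps its sign, so the same
entries contribute to the height throughout and the height is a single sinusoid. -/
lemma exists_height_eq_re (δ : Param N) {A B : ℝ} (h : ∀ t ∈ Ioo A B, ¬ IsCritical δ t) :
    ∃ Λ : Finset (Fin N), (∀ t ∈ Icc A B, ∀ l ∈ Λ, (exp (t * I) * δ.a l).re ≤ 0) ∧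
      (∀ t ∈ Icc A B, ∀ l ∉ Λ, 0 ≤ (exp (t * I) * δ.a l).re) ∧
      ∀ t ∈ Icc A B, height δ (exp (t * I)) = (exp (t * I) * (δ.w - tr δ.a Λ)).re := by
  classical
  set Λ : Finset (Fin N) :=
    Finset.univ.filter fun l => ∀ t ∈ Icc A B, (exp (t * I) * δ.a l).re ≤ 0 with hΛ
  have h1 : ∀ t ∈ Icc A B, ∀ l ∈ Λ, (exp (t * I) * δ.a l).re ≤ 0 := by
    intro t ht l hl
    exact (Finset.mem_filter.1 hl).2 t ht
  have h2 : ∀ t ∈ Icc A B, ∀ l ∉ Λ, 0 ≤ (exp (t * I) * δ.a l).re := by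
    intro t ht l hl
    by_cases ha : δ.a l = 0
    · simp [ha]
    · rcases nonneg_or_nonpos_of_ne_zero (g := fun t : ℝ => (exp (t * I) * δ.a l).re)
        (by fun_prop) (fun t ht h0 => h t ht ⟨l, ha, h0⟩) with h3 | h3
      · exact h3 t ht
      · exact absurd (Finset.mem_filter.2 ⟨Finset.mem_univ l, h3⟩) hl
  refine ⟨Λ, h1, h2, fun t ht => ?_⟩
  simp only [height, tr, mul_sub, sub_re, Finset.mul_sum, re_sum]
  rw [sub_eq_add_neg, ← Finset.sum_neg_distrib, ← Finset.sum_filter_add_sum_filter_not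
    Finset.univ (· ∈ Λ), Finset.sum_eq_zero (s := Finset.univ.filter fun l => ¬ l ∈ Λ), add_zero,
    Finset.filter_mem_eq_inter, Finset.univ_inter]
  · congr 1
    refine Finset.sum_congr rfl fun l hl => max_eq_right ?_
    linarith [h1 t ht l hl]
  · intro l hl
    refine max_eq_left ?_
    linarith [h2 t ht l (Finset.mem_filter.1 hl).2]

lemma hasDerivAt_re_exp_mul (ζ : ℂ) (t : ℝ) :
    HasDerivAt (fun t : ℝ => (exp (t * I) * ζ).re) (exp (t * I) * (I * ζ)).re t := by
  have h1 : HasDerivAt (fun z : ℂ => exp (z * I) * ζ) (exp (t * I) * (I * ζ)) t := by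
    have := (((hasDerivAt_id (t : ℂ)).mul_const I).cexp).mul_const ζ
    simpa [mul_assoc] using this
  exact h1.real_of_complex

/-- A zero of the height would be a minimum of the sinusoid Re(e^{it}ζ), so its derivative would
vanish as well and e^{iφ}ζ = 0. At a noncritical angle this number is π(M_α δ) with α = e^{iφ}, and
it lies in the cone, which does not contain 0. -/
lemma height_exp_pos_of_forall {δ : Param N} (hδ : δ ∈ stableDomain N) {A B φ : ℝ}
    (hφ : φ ∈ Ioo A B) (h : ∀ t ∈ Ioo A B, ¬ IsCritical δ t) : 0 < height δ (exp (φ * I)) := by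
  classical
  refine lt_of_le_of_ne (height_exp_nonneg hδ φ) fun h0 => ?_
  obtain ⟨Λ, h1, h2, h3⟩ := exists_height_eq_re δ h
  set ζ := δ.w - tr δ.a Λ
  have hφ' : φ ∈ Icc A B := Ioo_subset_Icc_self hφ
  have hmin : IsLocalMin (fun t : ℝ => (exp (t * I) * ζ).re) φ := by
    filter_upwards [Ioo_mem_nhds hφ.1 hφ.2] with t ht
    rw [← h3 φ hφ', ← h0, ← h3 t (Ioo_subset_Icc_self ht)]
    exact height_exp_nonneg hδ t
  have h4 := hmin.hasDerivAt_eq_zero (hasDerivAt_re_exp_mul ζ φ)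
  have h5 : (exp (φ * I) * ζ).re = 0 := by rw [← h3 φ hφ', ← h0]
  have h6 : exp (φ * I) * ζ = 0 := by
    refine Complex.ext h5 ?_
    have : exp (φ * I) * (I * ζ) = I * (exp (φ * I) * ζ) := by ring
    rw [this, I_mul_re, neg_eq_zero] at h4
    exact h4
  have h7 := hδ (Units.mk0 (exp (φ * I)) (exp_ne_zero _))
  have h8 : proj (M (Units.mk0 (exp (φ * I)) (exp_ne_zero _)) δ) = exp (φ * I) * ζ := by
    rw [proj_M_eq, Units.val_mk0, mul_sub, tr, Finset.mul_sum]
    congr 1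
    rw [← Finset.sum_filter_add_sum_filter_not Finset.univ (· ∈ Λ),
      Finset.sum_eq_zero (s := Finset.univ.filter fun l => ¬ l ∈ Λ), add_zero,
      Finset.filter_mem_eq_inter, Finset.univ_inter]
    · refine Finset.sum_congr rfl fun l hl => ?_
      by_cases ha : δ.a l = 0
      · simp [ha]
      · rw [if_pos]
        refine Or.inl ?_
        rw [neg_re, neg_pos]
        exact lt_of_le_of_ne (h1 φ hφ' l hl) fun h0 => h φ hφ ⟨l, ha, h0⟩
    · intro l hl
      by_cases ha : δ.a l = 0
      · simp [ha]
      · rw [if_neg]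
        intro hc
        have h9 := h2 φ hφ' l (Finset.mem_filter.1 hl).2
        exact h φ hφ ⟨l, ha, le_antisymm (re_nonpos_of_neg_mem_cone hc) h9⟩
  rw [h8, h6] at h7
  rcases h7 with h | h <;> simp at h

lemma continuous_critical (δ : Param N) (l : Fin N) :
    Continuous fun t : ℝ => (exp (t * I) * δ.a l).re := by fun_prop

lemma isClosed_isCritical (δ : Param N) : IsClosed {φ | IsCritical δ φ} := by
  have : {φ | IsCritical δ φ} =
      ⋃ l : Fin N, ⋃ _ : δ.a l ≠ 0, {φ : ℝ | (exp (φ * I) * δ.a l).re = 0} := by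
    ext φ; simp [IsCritical]
  rw [this]
  exact isClosed_iUnion_of_finite fun l => isClosed_iUnion_of_finite fun _ =>
    isClosed_eq (continuous_critical δ l) continuous_const

lemma height_exp_pos {δ : Param N} (hδ : δ ∈ stableDomain N) {φ : ℝ} (hφ : ¬ IsCritical δ φ) :
    0 < height δ (exp (φ * I)) := by
  obtain ⟨r, hr, h⟩ := Metric.isOpen_iff.1 (isClosed_isCritical δ).isOpen_compl φ hφ
  rw [Real.ball_eq_Ioo] at h
  exact height_exp_pos_of_forall hδ (A := φ - r) (B := φ + r) (by constructor <;> linarith)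
    fun t ht => h ht

/-- The height is a sinusoid f on this interval, with f'' = -f ≤ 0. It is therefore concave and lies
above its chord. -/
lemma height_chord_le {δ : Param N} (hδ : δ ∈ stableDomain N) {A B : ℝ}
    (h : ∀ t ∈ Ioo A B, ¬ IsCritical δ t) {t : ℝ} (ht : t ∈ Icc A B) :
    (t - A) * height δ (exp (B * I)) + (B - t) * height δ (exp (A * I)) ≤
      (B - A) * height δ (exp (t * I)) := by
  obtain ⟨Λ, -, -, h3⟩ := exists_height_eq_re δ h
  set ζ := δ.w - tr δ.a Λ
  have hconc : ConcaveOn ℝ (Icc A B) fun t : ℝ => (exp (t * I) * ζ).re := by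
    have hd : deriv (fun t : ℝ => (exp (t * I) * ζ).re) =
        fun t : ℝ => (exp (t * I) * (I * ζ)).re :=
      funext fun t => (hasDerivAt_re_exp_mul ζ t).deriv
    have hd2 : deriv (fun t : ℝ => (exp (t * I) * (I * ζ)).re) =
        fun t : ℝ => (exp (t * I) * (I * (I * ζ))).re :=
      funext fun t => (hasDerivAt_re_exp_mul (I * ζ) t).deriv
    refine concaveOn_of_deriv2_nonpos (convex_Icc A B) (by fun_prop)
      (fun t _ => (hasDerivAt_re_exp_mul ζ t).differentiableAt.differentiableWithinAt)
      (hd ▸ fun t _ =>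
        (hasDerivAt_re_exp_mul (I * ζ) t).differentiableAt.differentiableWithinAt) ?_
    intro t ht
    rw [interior_Icc] at ht
    rw [Function.iterate_succ_apply, Function.iterate_one, hd, hd2]
    have : exp (t * I) * (I * (I * ζ)) = -(exp (t * I) * ζ) := by
      rw [← mul_assoc I, I_mul_I]; ring
    simp only [this, neg_re]
    rw [← h3 t (Ioo_subset_Icc_self ht)]
    linarith [height_exp_nonneg hδ t]
  rcases eq_or_lt_of_le (ht.1.trans ht.2) with hAB | hAB
  · obtain rfl : t = A := le_antisymm (hAB ▸ ht.2) ht.1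
    simp [hAB]
  have hA : A ∈ Icc A B := left_mem_Icc.2 hAB.le
  have hB : B ∈ Icc A B := right_mem_Icc.2 hAB.le
  have hBA : 0 < B - A := sub_pos.2 hAB
  have := hconc.2 hA hB
    (div_nonneg (show 0 ≤ B - t by linarith [ht.2]) hBA.le) (div_nonneg (show 0 ≤ t - A by linarith [ht.1]) hBA.le)
    (by field_simp; ring)
  have h4 : ((B - t) / (B - A)) • A + ((t - A) / (B - A)) • B = t := by
    simp only [smul_eq_mul]; field_simp; ring
  simp only [h4] at this
  rw [← h3 t ht, ← h3 A hA, ← h3 B hB, smul_eq_mul, smul_eq_mul, div_mul_eq_mul_div,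
    div_mul_eq_mul_div, ← add_div, div_le_iff₀ hBA] at this
  linarith

/-! ### Critical angles -/

/-- If e^{iφ} a_ℓ is a nonzero multiple of i, then φ is the argument of i/a_ℓ or of -i/a_ℓ. -/
lemma finite_isCritical (δ : Param N) : {φ ∈ Ioc (-Real.pi) Real.pi | IsCritical δ φ}.Finite := by
  refine ((finite_range fun p : Fin N × Bool =>
    arg ((if p.2 then I else -I) / δ.a p.1)).subset ?_)
  rintro φ ⟨hφ, l, ha, h0⟩
  have hn : 0 < ‖δ.a l‖ := norm_pos_iff.2 ha
  set y := (exp (φ * I) * δ.a l).im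
  have h1 : exp (φ * I) * δ.a l = y * I := by
    refine Complex.ext ?_ ?_
    · rw [h0, re_ofReal_mul, I_re, mul_zero]
    · rw [im_ofReal_mul, I_im, mul_one]
  have hy : y ≠ 0 := by
    intro hy
    rw [hy] at h1
    simp [exp_ne_zero, ha] at h1
  have harg : ∀ x : ℝ, 0 < x → arg (x * exp (φ * I)) = φ := fun x hx => by
    rw [exp_mul_I]; exact arg_mul_cos_add_sin_mul_I hx hφ
  rcases lt_or_gt_of_ne hy with hy | hy
  · refine ⟨(l, false), ?_⟩
    rw [← harg (-y)⁻¹ (inv_pos.2 (neg_pos.2 hy))]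
    change arg _ = arg _
    congr 1
    simp only [Bool.false_eq_true, if_false]
    rw [div_eq_iff ha, mul_assoc, h1]
    have : (y : ℂ) ≠ 0 := ofReal_ne_zero.2 hy.ne
    push_cast
    field_simp
  · refine ⟨(l, true), ?_⟩
    rw [← harg y⁻¹ (inv_pos.2 hy)]
    change arg _ = arg _
    congr 1
    simp only [if_true]
    rw [div_eq_iff ha, mul_assoc, h1]
    have : (y : ℂ) ≠ 0 := ofReal_ne_zero.2 hy.ne'
    push_cast
    field_simp

/-- The function Re(e^{it} a_ℓ) has only simple zeros: if its derivative vanished too, e^{it} a_ℓ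
would be 0. -/
lemma eventually_not_isCritical (δ : Param N) (φ : ℝ) : ∀ᶠ t in 𝓝[≠] φ, ¬ IsCritical δ t := by
  have h : ∀ l : Fin N, ∀ᶠ t in 𝓝[≠] φ, δ.a l ≠ 0 → (exp ((t : ℝ) * I) * δ.a l).re ≠ 0 := by
    intro l
    by_cases ha : δ.a l = 0
    · exact Eventually.of_forall fun t h => absurd ha h
    by_cases h0 : (exp (φ * I) * δ.a l).re = 0
    · have hd := hasDerivAt_re_exp_mul (δ.a l) φ
      have hne : (exp (φ * I) * (I * δ.a l)).re ≠ 0 := by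
        intro h1
        have : exp (φ * I) * (I * δ.a l) = I * (exp (φ * I) * δ.a l) := by ring
        rw [this, I_mul_re, neg_eq_zero] at h1
        have : exp (φ * I) * δ.a l = 0 := Complex.ext h0 h1
        simp [exp_ne_zero, ha] at this
      filter_upwards [hd.eventually_ne hne (c := 0)] with t ht _ using ht
    · have := (continuous_critical δ l).continuousAt.eventually_ne h0
      filter_upwards [nhdsWithin_le_nhds this] with t ht _ using ht
  filter_upwards [eventually_all.2 h] with t ht
  rintro ⟨l, ha, h0⟩
  exact ht l ha h0

/-! ### Integrals depending holomorphically on a parameter -/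

lemma differentiable_integral_mul_exp {X : Type*} [MeasurableSpace X] {μ : Measure X}
    {g c : X → ℂ} (hg : AEStronglyMeasurable g μ) (hc : AEStronglyMeasurable c μ)
    (h : ∀ B : ℝ, Integrable (fun x => ‖g x‖ * Real.exp (B * ‖c x‖)) μ) :
    Differentiable ℂ fun s : ℂ => ∫ x, g x * exp (s * c x) ∂μ := by
  have hmeas : ∀ s : ℂ, AEStronglyMeasurable (fun x => g x * exp (s * c x)) μ := fun s =>
    hg.mul (continuous_exp.comp_aestronglyMeasurable (hc.const_mul s))
  have hre : ∀ (s : ℂ) (x : X), ‖exp (s * c x)‖ ≤ Real.exp (‖s‖ * ‖c x‖) := fun s x => by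
    rw [norm_exp, Real.exp_le_exp, ← norm_mul]
    exact re_le_norm _
  intro s₀
  have key := hasDerivAt_integral_of_dominated_loc_of_deriv_le (μ := μ) (x₀ := s₀)
    (s := Metric.ball s₀ 1)
    (F := fun s x => g x * exp (s * c x)) (F' := fun s x => g x * (c x * exp (s * c x)))
    -- On the unit ball around s₀ the exponent is at most (‖s₀‖ + 1)‖c‖. The last 1 absorbs the
    -- factor c produced by differentiation, as ‖c‖ ≤ e^{‖c‖}.
    (bound := fun x => ‖g x‖ * Real.exp ((‖s₀‖ + 1 + 1) * ‖c x‖))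
    (Metric.ball_mem_nhds s₀ one_pos) (Eventually.of_forall hmeas)
    ((h ‖s₀‖).mono' (hmeas s₀) (Eventually.of_forall fun x => by
      rw [norm_mul]; gcongr; exact hre s₀ x))
    (hg.mul (hc.mul (continuous_exp.comp_aestronglyMeasurable (hc.const_mul s₀))))
    (Eventually.of_forall fun x s hs => by
      have hs' : ‖s‖ ≤ ‖s₀‖ + 1 := by
        have := norm_sub_norm_le s s₀
        rw [Metric.mem_ball, dist_eq_norm] at hs
        linarith
      rw [norm_mul, norm_mul]
      have h1 : ‖c x‖ ≤ Real.exp ‖c x‖ := by linarith [Real.add_one_le_exp ‖c x‖]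
      calc ‖g x‖ * (‖c x‖ * ‖exp (s * c x)‖)
          ≤ ‖g x‖ * (Real.exp ‖c x‖ * Real.exp ((‖s₀‖ + 1) * ‖c x‖)) := by
            gcongr
            exact (hre s x).trans (Real.exp_le_exp.2 (by gcongr))
        _ = _ := by rw [← Real.exp_add]; congr 2; ring)
    (h _)
    (Eventually.of_forall fun x s _ => by
      have := (((hasDerivAt_id s).mul_const (c x)).cexp).const_mul (g x)
      simpa [mul_comm] using this)
  exact key.2.differentiableAt

lemma differentiable_intervalIntegral_mul_exp {g c : ℝ → ℂ} (hg : Continuous g)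
    (hc : Continuous c) (a b : ℝ) :
    Differentiable ℂ fun s : ℂ => ∫ t in a..b, g t * exp (s * c t) := by
  have h : ∀ a b : ℝ, Differentiable ℂ fun s : ℂ => ∫ t in Ioc a b, g t * exp (s * c t) :=
    fun a b => differentiable_integral_mul_exp hg.aestronglyMeasurable hc.aestronglyMeasurable
      fun B => Continuous.integrableOn_Ioc (by fun_prop)
  exact (h a b).sub (h b a)

/-! ### Admissible radii -/

/-- `F_N(·, δ)` has no poles with `0 < |u| ≤ r`. -/
def IsAdmissible (δ : Param N) (r : ℝ) : Prop :=
  0 < r ∧ ∀ (l : Fin N) (u : ℂ), 0 < ‖u‖ → ‖u‖ ≤ r → e (δ.θ l) ≠ exp (u * δ.a l)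

lemma norm_real_mul_exp {x : ℝ} (hx : 0 ≤ x) (t : ℝ) : ‖(x * exp (t * I) : ℂ)‖ = x := by
  rw [norm_mul, norm_exp_ofReal_mul_I, mul_one, norm_real, Real.norm_of_nonneg hx]

lemma IsAdmissible.den_ne_zero {δ : Param N} {r x : ℝ} (h : IsAdmissible δ r) (hx : 0 < x)
    (hxr : x ≤ r) (t : ℝ) : den δ (x * exp (t * I)) ≠ 0 := by
  rw [Ne, den_eq_zero_iff]
  rintro ⟨l, hl⟩
  exact h.2 l _ (by rwa [norm_real_mul_exp hx.le]) (by rwa [norm_real_mul_exp hx.le]) hl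

lemma exists_isAdmissible (δ : Param N) : ∃ r, IsAdmissible δ r := exists_radius δ

lemma isAdmissible_of_radii {ε : Param N → ℝ} (hε : ε ∈ radii N) (δ : Param N) :
    IsAdmissible δ (ε δ) := hε δ

/-! ### Rays, arcs, and contours -/

/-- The integral of `F_N(u, δ) u^{s-1} du` along the ray of argument `φ` from radius `r` to `∞`,
divided by `exp(isφ)`. -/
noncomputable def ray (r φ : ℝ) (s : ℂ) (δ : Param N) : ℂ :=
  ∫ x in Ioi r, F (x * exp (φ * I)) δ * exp ((s - 1) * Real.log x)

/-- The truncation of `ray` at radius `R`. -/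
noncomputable def seg (r R φ : ℝ) (s : ℂ) (δ : Param N) : ℂ :=
  ∫ x in r..R, F (x * exp (φ * I)) δ * exp ((s - 1) * Real.log x)

/-- `F_N(u, δ) u^s` at `u = r exp(it)`. -/
noncomputable def arcFun (r : ℝ) (s : ℂ) (δ : Param N) (t : ℝ) : ℂ :=
  F (r * exp (t * I)) δ * exp (s * (Real.log r + t * I))

/-- The integral of `F_N(u, δ) u^{s-1} du` along the arc from `r` to `r exp(iφ)` and the ray from
`r exp(iφ)` to `∞`. -/
noncomputable def contour (r φ : ℝ) (s : ℂ) (δ : Param N) : ℂ :=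
  exp (s * φ * I) * ray r φ s δ + I * ∫ t in (0 : ℝ)..φ, arcFun r s δ t

lemma continuous_arcFun {δ : Param N} {r : ℝ} (s : ℂ)
    (h : ∀ t : ℝ, den δ (r * exp (t * I)) ≠ 0) : Continuous (arcFun r s δ) := by
  unfold arcFun
  simp only [F_eq]
  have h1 : Continuous fun t : ℝ => den δ (r * exp (t * I)) :=
    (differentiable_den δ).continuous.comp (by fun_prop)
  have h2 : Continuous fun t : ℝ => (den δ (r * exp (t * I)))⁻¹ := h1.inv₀ h
  fun_prop

lemma IsAdmissible.continuous_arcFun {δ : Param N} {r : ℝ} (h : IsAdmissible δ r) (s : ℂ) :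
    Continuous (arcFun r s δ) :=
  BarnesL.continuous_arcFun s fun t => h.den_ne_zero h.1 le_rfl t

lemma arcFun_add_two_pi (r : ℝ) (s : ℂ) (δ : Param N) (t : ℝ) :
    arcFun r s δ (t + 2 * Real.pi) = e s * arcFun r s δ t := by
  simp only [arcFun, e]
  have h1 : exp ((t + 2 * Real.pi : ℝ) * I) = exp (t * I) := by
    push_cast; rw [add_mul, exp_periodic]
  rw [h1, mul_left_comm, ← exp_add]
  push_cast
  ring_nf

lemma differentiable_arcIntegral {δ : Param N} {r : ℝ} (h : IsAdmissible δ r) (a b : ℝ) :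
    Differentiable ℂ fun s => ∫ t in a..b, arcFun r s δ t := by
  refine differentiable_intervalIntegral_mul_exp (g := fun t => F (r * exp (t * I)) δ)
    (c := fun t : ℝ => Real.log r + t * I) ?_ (by fun_prop) a b
  have := h.continuous_arcFun 0
  unfold arcFun at this
  simpa using this

lemma den_ne_zero_of_not_isCritical {δ : Param N} {φ : ℝ} (hφ : ¬ IsCritical δ φ) {x : ℝ}
    (hx : 0 < x) : den δ (x * exp (φ * I)) ≠ 0 := fun h =>
  hφ (isCritical_of_den_eq_zero hx.ne' h)

lemma continuousOn_F_ray {δ : Param N} {φ : ℝ} {s : Set ℝ}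
    (h : ∀ x ∈ s, den δ (x * exp (φ * I)) ≠ 0) :
    ContinuousOn (fun x : ℝ => F (x * exp (φ * I)) δ) s := by
  simp only [F_eq]
  have h1 : Continuous fun x : ℝ => den δ (x * exp (φ * I)) :=
    (differentiable_den δ).continuous.comp (by fun_prop)
  have h2 : ContinuousOn (fun x : ℝ => (den δ (x * exp (φ * I)))⁻¹) s := h1.continuousOn.inv₀ h
  exact ContinuousOn.mul (by fun_prop) h2

lemma abs_re_le_norm_sub (z : ℂ) (x : ℝ) (n : ℤ) :
    |z.re| ≤ ‖z - 2 * Real.pi * I * (x + n)‖ := by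
  have h : (z - 2 * Real.pi * I * (x + n)).re = z.re := by
    rw [show (2 * Real.pi * I * (x + n) : ℂ) = ((2 * Real.pi * (x + n) : ℝ) : ℂ) * I by
      push_cast; ring]
    simp
  rw [← h]
  exact abs_re_le_norm _

/-- On a noncritical ray every Re(u a_ℓ) with a_ℓ ≠ 0 grows linearly, so u a_ℓ moves away from the
imaginary axis, where the zeros of the factors lie. The height is positive and proportional to |u|.
-/
lemma exists_norm_F_ray_le {δ : Param N} (hδ : δ ∈ stableDomain N) {φ : ℝ}
    (hφ : ¬ IsCritical δ φ) :
    ∃ κ > 0, (fun x : ℝ => F (x * exp (φ * I)) δ) =O[atTop] fun x : ℝ => Real.exp (-κ * x) := by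
  obtain ⟨C, hC, hb⟩ := exists_norm_F_le δ one_pos
  refine ⟨height δ (exp (φ * I)), height_exp_pos hδ hφ, ?_⟩
  have h : ∀ l : Fin N, ∀ᶠ x : ℝ in atTop, δ.a l ≠ 0 → 1 ≤ |(x * exp (φ * I) * δ.a l).re| := by
    intro l
    by_cases ha : δ.a l = 0
    · exact Eventually.of_forall fun x h => absurd ha h
    have h0 : 0 < |(exp (φ * I) * δ.a l).re| := abs_pos.2 fun h => hφ ⟨l, ha, h⟩
    filter_upwards [eventually_ge_atTop |(exp (φ * I) * δ.a l).re|⁻¹, eventually_ge_atTop 0]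
      with x hx hx0 _
    rw [mul_assoc, re_ofReal_mul, abs_mul, abs_of_nonneg hx0]
    calc (1 : ℝ) = |(exp (φ * I) * δ.a l).re|⁻¹ * |(exp (φ * I) * δ.a l).re| := by field_simp
      _ ≤ _ := by gcongr
  refine Asymptotics.IsBigO.of_bound C ?_
  filter_upwards [eventually_all.2 h, eventually_ge_atTop 0] with x hx hx0
  refine (hb _ fun l ha n => (hx l ha).trans (abs_re_le_norm_sub _ _ _)).trans ?_
  rw [height_real_mul δ hx0, Real.norm_eq_abs, Real.abs_exp, neg_mul, mul_comm x]

lemma integrableOn_ray_exp {δ : Param N} (hδ : δ ∈ stableDomain N) {φ : ℝ}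
    (hφ : ¬ IsCritical δ φ) {r : ℝ} (hr : 0 < r) (B : ℝ) :
    IntegrableOn (fun x : ℝ => ‖F (x * exp (φ * I)) δ‖ * Real.exp (B * ‖(Real.log x : ℂ)‖))
      (Ioi r) := by
  obtain ⟨κ, hκ, hO⟩ := exists_norm_F_ray_le hδ hφ
  refine integrable_of_isBigO_exp_neg (b := κ / 2) (by positivity) ?_ ?_
  · refine ContinuousOn.mul (continuousOn_F_ray fun x hx =>
      den_ne_zero_of_not_isCritical hφ (hr.trans_le hx)).norm ?_
    simp only [norm_real]
    have h1 : ContinuousOn Real.log (Ici r) :=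
      Real.continuousOn_log.mono fun x hx => (hr.trans_le hx).ne'
    exact (h1.norm.const_mul B).rexp
  -- For x ≥ 1 the left side is x^B, which is dominated by half of the exponential decay.
  · have h1 : (fun x : ℝ => Real.exp (B * ‖(Real.log x : ℂ)‖)) =O[atTop]
        fun x : ℝ => Real.exp (κ / 2 * x) := by
      refine ((isLittleO_rpow_exp_pos_mul_atTop B (half_pos hκ)).isBigO).congr' ?_ .rfl
      filter_upwards [eventually_ge_atTop 1] with x hx
      rw [norm_real, Real.norm_of_nonneg (Real.log_nonneg hx), Real.rpow_def_of_pos (by linarith),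
        mul_comm]
    refine (hO.norm_left.mul h1).congr_right fun x => ?_
    rw [← Real.exp_add]
    ring_nf

lemma integrableOn_ray {δ : Param N} (hδ : δ ∈ stableDomain N) {φ : ℝ}
    (hφ : ¬ IsCritical δ φ) {r : ℝ} (hr : 0 < r) (s : ℂ) :
    IntegrableOn (fun x : ℝ => F (x * exp (φ * I)) δ * exp ((s - 1) * Real.log x)) (Ioi r) := by
  refine (integrableOn_ray_exp hδ hφ hr ‖s - 1‖).mono' ?_ (Eventually.of_forall fun x => ?_)
  · refine ContinuousOn.aestronglyMeasurable ?_ measurableSet_Ioi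
    refine ContinuousOn.mul (continuousOn_F_ray fun x hx =>
      den_ne_zero_of_not_isCritical hφ (hr.trans hx)) ?_
    have h1 : ContinuousOn Real.log (Ioi r) :=
      Real.continuousOn_log.mono fun x hx => (hr.trans hx).ne'
    have h2 : ContinuousOn (fun x : ℝ => (Real.log x : ℂ)) (Ioi r) :=
      continuous_ofReal.comp_continuousOn h1
    exact (continuousOn_const.mul h2).cexp
  · rw [norm_mul, norm_exp]
    gcongr
    rw [← norm_mul]
    exact re_le_norm _

lemma differentiable_ray {δ : Param N} (hδ : δ ∈ stableDomain N) {φ : ℝ}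
    (hφ : ¬ IsCritical δ φ) {r : ℝ} (hr : 0 < r) : Differentiable ℂ fun s => ray r φ s δ := by
  have h := differentiable_integral_mul_exp (μ := volume.restrict (Ioi r))
    (g := fun x : ℝ => F (x * exp (φ * I)) δ) (c := fun x : ℝ => (Real.log x : ℂ))
    ((continuousOn_F_ray fun x hx => den_ne_zero_of_not_isCritical hφ
      (hr.trans hx)).aestronglyMeasurable measurableSet_Ioi)
    (by fun_prop)
    (integrableOn_ray_exp hδ hφ hr)
  exact h.comp (differentiable_id.sub_const 1)

lemma differentiable_contour {δ : Param N} (hδ : δ ∈ stableDomain N) {φ : ℝ}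
    (hφ : ¬ IsCritical δ φ) {r : ℝ} (hr : IsAdmissible δ r) :
    Differentiable ℂ fun s => contour r φ s δ := by
  unfold contour
  have h1 := differentiable_ray hδ hφ hr.1
  have h2 := differentiable_arcIntegral hr 0 φ
  fun_prop

lemma tendsto_seg {δ : Param N} (hδ : δ ∈ stableDomain N) {φ : ℝ}
    (hφ : ¬ IsCritical δ φ) {r : ℝ} (hr : 0 < r) (s : ℂ) :
    Tendsto (fun R => seg r R φ s δ) atTop (𝓝 (ray r φ s δ)) :=
  intervalIntegral_tendsto_integral_Ioi r (integrableOn_ray hδ hφ hr s) tendsto_id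

lemma seg_add_ray {δ : Param N} (hδ : δ ∈ stableDomain N) {φ : ℝ}
    (hφ : ¬ IsCritical δ φ) {r R : ℝ} (hr : 0 < r) (hrR : r ≤ R) (s : ℂ) :
    seg r R φ s δ + ray R φ s δ = ray r φ s δ := by
  have h := integrableOn_ray hδ hφ hr s
  unfold seg ray
  rw [integral_of_le hrR, ← setIntegral_union, Ioc_union_Ioi_eq_Ioi hrR]
  · exact Ioc_disjoint_Ioi le_rfl
  · exact measurableSet_Ioi
  · exact h.mono_set Ioc_subset_Ioi_self
  · exact h.mono_set (Ioi_subset_Ioi hrR)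

/-- The integrand `F_N(u, δ) u^{s-1} du` in the coordinate `ζ = log u`. -/
noncomputable def logIntegrand (s : ℂ) (δ : Param N) (ζ : ℂ) : ℂ := F (exp ζ) δ * exp (s * ζ)

lemma exp_log_add {r : ℝ} (hr : 0 < r) (t : ℝ) :
    exp (Real.log r + t * I) = r * exp (t * I) := by
  rw [exp_add, ← ofReal_exp, Real.exp_log hr]

lemma logIntegrand_vertical {r : ℝ} (hr : 0 < r) (s : ℂ) (δ : Param N) (t : ℝ) :
    logIntegrand s δ (Real.log r + t * I) = arcFun r s δ t := by
  rw [logIntegrand, arcFun, exp_log_add hr]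

lemma integral_logIntegrand {δ : Param N} {r R φ : ℝ} (hr : 0 < r) (hrR : r ≤ R) (s : ℂ)
    (h : ∀ x ∈ Icc r R, den δ (x * exp (φ * I)) ≠ 0) :
    ∫ x in Real.log r..Real.log R, logIntegrand s δ (x + φ * I) =
      exp (s * φ * I) * seg r R φ s δ := by
  have hR : 0 < R := hr.trans_le hrR
  have h2 := integral_deriv_smul_comp'' (a := Real.log r) (b := Real.log R) (f := Real.exp)
    (f' := Real.exp)
    (g := fun x : ℝ => F (x * exp (φ * I)) δ * exp ((s - 1) * Real.log x))
    Real.continuous_exp.continuousOn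
    (fun x _ => (Real.hasDerivAt_exp x).hasDerivWithinAt)
    Real.continuous_exp.continuousOn ?_
  · rw [Real.exp_log hr, Real.exp_log hR] at h2
    rw [seg, ← h2, ← intervalIntegral.integral_const_mul]
    refine integral_congr fun x _ => ?_
    simp only [logIntegrand, Function.comp_apply, real_smul, Real.log_exp]
    rw [exp_add, ofReal_exp, mul_left_comm (exp (s * φ * I)), mul_left_comm (exp (s * φ * I)),
      mul_left_comm (exp (x : ℂ))]
    congr 1
    rw [← exp_add, ← exp_add]
    ring_nf
  · have hsub : Real.exp '' uIcc (Real.log r) (Real.log R) ⊆ Icc r R := by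
      rw [uIcc_of_le (Real.log_le_log hr hrR)]
      rintro _ ⟨x, hx, rfl⟩
      exact ⟨(Real.log_le_iff_le_exp hr).1 hx.1, (Real.le_log_iff_exp_le hR).1 hx.2⟩
    have h3 : ContinuousOn (fun x : ℝ => (Real.log x : ℂ)) (Icc r R) :=
      continuous_ofReal.comp_continuousOn
        (Real.continuousOn_log.mono fun x hx => (hr.trans_le hx.1).ne')
    exact ((continuousOn_F_ray h).mul (continuousOn_const.mul h3).cexp).mono hsub

lemma rectIntegral_logIntegrand {δ : Param N} {r R φ₁ φ₂ : ℝ} (hr : 0 < r) (hrR : r ≤ R)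
    (s : ℂ) (h₁ : ∀ x ∈ Icc r R, den δ (x * exp (φ₁ * I)) ≠ 0)
    (h₂ : ∀ x ∈ Icc r R, den δ (x * exp (φ₂ * I)) ≠ 0) :
    rectIntegral (logIntegrand s δ) (Real.log r) (Real.log R) φ₁ φ₂ =
      exp (s * φ₁ * I) * seg r R φ₁ s δ - exp (s * φ₂ * I) * seg r R φ₂ s δ +
        I * (∫ t in φ₁..φ₂, arcFun R s δ t) - I * ∫ t in φ₁..φ₂, arcFun r s δ t := by
  rw [rectIntegral, integral_logIntegrand hr hrR s h₁, integral_logIntegrand hr hrR s h₂]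
  simp only [logIntegrand_vertical hr, logIntegrand_vertical (hr.trans_le hrR)]

lemma differentiableAt_logIntegrand (s : ℂ) {δ : Param N} {ζ : ℂ} (h : den δ (exp ζ) ≠ 0) :
    DifferentiableAt ℂ (logIntegrand s δ) ζ := by
  unfold logIntegrand
  have h1 : DifferentiableAt ℂ (fun ζ => F (exp ζ) δ) ζ :=
    (analyticAt_F h).differentiableAt.comp ζ differentiableAt_exp
  fun_prop

/-! ### The Hankel contour -/

lemma F_rot (φ : ℝ) (u : ℂ) (δ : Param N) : F u (rot φ δ) = F (u * exp (φ * I)) δ := by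
  simp only [F, rot, M, Units.val_mk0, neg_mul, mul_assoc]

/-- Rotating the variable turns the Hankel contour into one around the ray of argument φ. On the way
back the argument is φ + 2π, so this ray carries the additional factor e(s). -/
lemma exp_mul_hankel_rot {r : ℝ} (hr : 0 < r) (φ : ℝ) (s : ℂ) (δ : Param N) :
    exp (s * φ * I) * hankel r s (rot φ δ) =
      (e s - 1) * (exp (s * φ * I) * ray r φ s δ) +
        I * ∫ t in φ..(φ + 2 * Real.pi), arcFun r s δ t := by
  have h1 : ∀ x : ℝ, F (x : ℂ) (rot φ δ) * exp ((s - 1) * (Real.log x + 2 * Real.pi * I)) =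
      e s * (F (x * exp (φ * I)) δ * exp ((s - 1) * Real.log x)) := by
    intro x
    rw [F_rot, mul_left_comm, e]
    congr 1
    have : exp ((s - 1) * (Real.log x + 2 * Real.pi * I)) =
        exp (2 * Real.pi * I * s + (s - 1) * Real.log x - 2 * Real.pi * I) := by ring_nf
    rw [this, exp_sub, exp_two_pi_mul_I, div_one, exp_add]
  have h2 : exp (s * φ * I) * (∫ t in (0 : ℝ)..(2 * Real.pi), F (r * exp (t * I)) (rot φ δ)
      * exp ((s - 1) * (Real.log r + t * I)) * (r * I * exp (t * I))) =
      I * ∫ t in φ..(φ + 2 * Real.pi), arcFun r s δ t := by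
    have h3 := integral_comp_add_right (a := 0) (b := 2 * Real.pi) (arcFun r s δ) φ
    rw [zero_add, add_comm (2 * Real.pi)] at h3
    rw [← h3, ← intervalIntegral.integral_const_mul, ← intervalIntegral.integral_const_mul]
    refine integral_congr fun t _ => ?_
    simp only [F_rot, arcFun]
    have h4 : (r : ℂ) * exp (t * I) * exp (φ * I) = r * exp ((t + φ : ℝ) * I) := by
      rw [mul_assoc, ← exp_add]; push_cast; ring_nf
    have h5 : (r : ℂ) * I * exp (t * I) = I * exp (Real.log r + t * I) := by
      rw [exp_log_add hr]; ring
    rw [h4, h5]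
    have h6 : exp (s * (Real.log r + (t + φ : ℝ) * I)) =
        exp (s * φ * I) * (exp ((s - 1) * (Real.log r + t * I)) * exp (Real.log r + t * I)) := by
      rw [← exp_add, ← exp_add]; push_cast; ring_nf
    rw [h6]
    ring
  unfold hankel
  simp only [h1]
  rw [mul_add, mul_add, h2, MeasureTheory.integral_const_mul, ray]
  simp only [F_rot]
  ring

/-- The circle from φ to φ + 2π is moved to the one from 0 to 2π. By quasi-periodicity this costs
(e(s) - 1) times the arc from 0 to φ, exactly the arc that completes the ray to `contour`. Only this
first term still depends on φ. -/
lemma exp_mul_hankel_rot_eq_contour {δ : Param N} {r : ℝ} (hr : IsAdmissible δ r) (φ : ℝ)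
    (s : ℂ) :
    exp (s * φ * I) * hankel r s (rot φ δ) =
      (e s - 1) * contour r φ s δ + I * ∫ t in (0 : ℝ)..(2 * Real.pi), arcFun r s δ t := by
  have hi : ∀ a b : ℝ, IntervalIntegrable (arcFun r s δ) volume a b := fun a b =>
    (hr.continuous_arcFun s).intervalIntegrable a b
  have h1 : (∫ t in (2 * Real.pi)..(φ + 2 * Real.pi), arcFun r s δ t) =
      e s * ∫ t in (0 : ℝ)..φ, arcFun r s δ t := by
    have := integral_comp_add_right (a := 0) (b := φ) (arcFun r s δ) (2 * Real.pi)
    rw [zero_add] at this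
    rw [← this, ← intervalIntegral.integral_const_mul]
    exact integral_congr fun t _ => arcFun_add_two_pi r s δ t
  have h2 := integral_add_adjacent_intervals (hi φ 0) (hi 0 (2 * Real.pi))
  have h3 := integral_add_adjacent_intervals (hi φ (2 * Real.pi))
    (hi (2 * Real.pi) (φ + 2 * Real.pi))
  rw [exp_mul_hankel_rot hr.1, contour, ← h3, ← h2, h1, integral_symm 0 φ]
  ring

/-- Cauchy's theorem on the annulus slit along the ray of argument φ, which is a rectangle of height
2π in the coordinate log u. The annulus contains no pole because the larger radius is admissible. -/
lemma hankel_rot_eq {δ : Param N} (hδ : δ ∈ stableDomain N) {φ : ℝ} (hφ : ¬ IsCritical δ φ)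
    {r R : ℝ} (hr : IsAdmissible δ r) (hR : IsAdmissible δ R) (s : ℂ) :
    hankel r s (rot φ δ) = hankel R s (rot φ δ) := by
  wlog hrR : r ≤ R generalizing r R
  · exact (this hR hr (le_of_not_ge hrR)).symm
  refine mul_left_cancel₀ (exp_ne_zero (s * φ * I)) ?_
  rw [exp_mul_hankel_rot hr.1, exp_mul_hankel_rot hR.1, ← seg_add_ray hδ hφ hr.1 hrR]
  have hden : ∀ t : ℝ, ∀ x ∈ Icc r R, den δ (x * exp (t * I)) ≠ 0 := fun t x hx =>
    hR.den_ne_zero (hr.1.trans_le hx.1) hx.2 t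
  have h0 := rectIntegral_eq_zero_of_differentiableOn (f := logIntegrand s δ)
    (Real.log_le_log hr.1 hrR) (show φ ≤ φ + 2 * Real.pi by linarith [Real.pi_pos]) ?_
  · rw [rectIntegral_logIntegrand hr.1 hrR s (hden _) (hden _)] at h0
    have h1 : exp (s * (φ + 2 * Real.pi : ℝ) * I) = e s * exp (s * φ * I) := by
      rw [e, ← exp_add]; push_cast; ring_nf
    have h2 : seg r R (φ + 2 * Real.pi) s δ = seg r R φ s δ := by
      have : exp ((φ + 2 * Real.pi : ℝ) * I) = exp (φ * I) := by
        push_cast; rw [add_mul, exp_periodic]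
      simp only [seg, this]
    rw [h1, h2] at h0
    linear_combination -h0
  · intro ζ hζ
    refine (differentiableAt_logIntegrand s ?_).differentiableWithinAt
    have h1 : exp ζ = (Real.exp ζ.re : ℝ) * exp (ζ.im * I) := by
      rw [ofReal_exp, ← exp_add, re_add_im]
    rw [h1]
    exact hden _ _ ⟨(Real.log_le_iff_le_exp hr.1).1 hζ.1.1,
      (Real.le_log_iff_exp_le hR.1).1 hζ.1.2⟩

/-! ### Residue sums over sectors -/

/-- The nonzero poles of `F_N(·, δ)` in an open sector. -/
def sectorPoles (φ₁ φ₂ : ℝ) (δ : Param N) : Set ℂ :=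
  {u | u ≠ 0 ∧ den δ u = 0 ∧ φ₁ < u.arg ∧ u.arg < φ₂}

/-- The radii that separate no two points of `P` at distance less than `c`. -/
def nonseparatingRadii (P : Set ℂ) (c : ℝ) : Set ℝ :=
  {r | ∀ u ∈ P, ∀ v ∈ P, ‖u - v‖ < c → (‖u‖ < r ↔ ‖v‖ < r)}

lemma nonseparatingRadii_anti {P Q : Set ℂ} (h : P ⊆ Q) (c : ℝ) :
    nonseparatingRadii Q c ⊆ nonseparatingRadii P c :=
  fun _ hr u hu v hv => hr u (h hu) v (h hv)

/-- The sum of the residues of `F_N(u, δ) u^{s-1}` at the points of `P` of absolute value less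
than `r`. -/
noncomputable def residueSumOn (P : Set ℂ) (δ : Param N) (s : ℂ) (r : ℝ) : ℂ :=
  ∑ᶠ u₀ ∈ {u | u ∈ P ∧ ‖u‖ < r}, residue (fun u => F u δ * u ^ (s - 1)) u₀

lemma finite_sectorPoles (φ₁ φ₂ : ℝ) (δ : Param N) (r : ℝ) :
    {u | u ∈ sectorPoles φ₁ φ₂ δ ∧ ‖u‖ < r}.Finite :=
  (finite_zeros δ r).subset fun _ hu => ⟨hu.1.2.1, hu.2.le⟩

lemma exp_eq_real_mul (ζ : ℂ) : exp ζ = (Real.exp ζ.re : ℝ) * exp (ζ.im * I) := by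
  rw [ofReal_exp, ← exp_add, re_add_im]

lemma arg_exp_of_mem {ζ : ℂ} (h : ζ.im ∈ Ioc (-Real.pi) Real.pi) : (exp ζ).arg = ζ.im := by
  rw [arg_exp, (toIocMod_eq_self _).2]
  exact ⟨h.1, by linarith [h.2]⟩

/-- The truncated sector is a rectangle in the coordinate log u. Angles strictly between -π and π
keep the principal branch of u^{s-1} analytic, and neither the bounding rays nor the two arcs meet a
pole. -/
lemma two_pi_I_mul_residueSumOn {δ : Param N} {r R φ₁ φ₂ : ℝ} (hr : IsAdmissible δ r)
    (hrR : r < R) (hφ : φ₁ < φ₂) (h1 : -Real.pi < φ₁) (h2 : φ₂ < Real.pi)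
    (hc1 : ¬ IsCritical δ φ₁) (hc2 : ¬ IsCritical δ φ₂)
    (hR : ∀ u ∈ sectorPoles φ₁ φ₂ δ, ‖u‖ ≠ R) (s : ℂ) :
    2 * Real.pi * I * residueSumOn (sectorPoles φ₁ φ₂ δ) δ s R =
      exp (s * φ₁ * I) * seg r R φ₁ s δ - exp (s * φ₂ * I) * seg r R φ₂ s δ +
        I * (∫ t in φ₁..φ₂, arcFun R s δ t) - I * ∫ t in φ₁..φ₂, arcFun r s δ t := by
  have hR0 : 0 < R := hr.1.trans hrR
  set S := (finite_sectorPoles φ₁ φ₂ δ R).toFinset with hS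
  have hmemS : ∀ u, u ∈ S ↔ u ∈ sectorPoles φ₁ φ₂ δ ∧ ‖u‖ < R := fun u => by simp [hS]
  have hslit : ∀ ζ : ℂ, ζ.im ∈ Icc φ₁ φ₂ → exp ζ ∈ slitPlane := by
    intro ζ hζ
    rw [mem_slitPlane_iff_arg, arg_exp_of_mem ⟨by linarith [hζ.1], by linarith [hζ.2]⟩]
    exact ⟨by linarith [hζ.2], exp_ne_zero _⟩
  have hpow : ∀ u ∈ slitPlane, AnalyticAt ℂ (fun u : ℂ => u ^ (s - 1)) u := fun u hu =>
    analyticAt_id.cpow analyticAt_const hu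
  have key := rectIntegral_eq_sum_residue (f := fun u => F u δ * u ^ (s - 1)) (S := S)
    (Real.log_le_log hr.1 hrR.le) hφ.le (by linarith) ?_ ?_ ?_
  · rw [← rectIntegral_logIntegrand hr.1 hrR.le s
      (fun x hx => den_ne_zero_of_not_isCritical hc1 (hr.1.trans_le hx.1))
      (fun x hx => den_ne_zero_of_not_isCritical hc2 (hr.1.trans_le hx.1)), residueSumOn,
      finsum_mem_eq_finite_toFinset_sum _ (finite_sectorPoles φ₁ φ₂ δ R), ← key]
    refine rectIntegral_congr (Real.log_le_log hr.1 hrR.le) hφ.le fun ζ hζ => ?_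
    have him : ζ.im ∈ Icc φ₁ φ₂ := hζ.2.1
    simp only [logIntegrand]
    rw [cpow_def_of_ne_zero (exp_ne_zero _), log_exp (by linarith [him.1]) (by linarith [him.2]),
      mul_left_comm, ← exp_add]
    ring_nf
  · intro ζ hζ hζS
    refine (analyticAt_F fun h0 => hζS ?_).mul (hpow _ (hslit ζ hζ.2))
    have him : ζ.im ∈ Icc φ₁ φ₂ := hζ.2
    have hcr : IsCritical δ ζ.im :=
      isCritical_of_den_eq_zero (Real.exp_pos ζ.re).ne' (by rwa [← exp_eq_real_mul])
    have hmem : exp ζ ∈ sectorPoles φ₁ φ₂ δ := by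
      refine ⟨exp_ne_zero _, h0, ?_⟩
      rw [arg_exp_of_mem ⟨by linarith [him.1], by linarith [him.2]⟩]
      exact ⟨lt_of_le_of_ne him.1 fun h => hc1 (h ▸ hcr),
        lt_of_le_of_ne him.2 fun h => hc2 (h ▸ hcr)⟩
    refine (hmemS _).2 ⟨hmem, lt_of_le_of_ne ?_ (hR _ hmem)⟩
    rw [norm_exp]
    exact (Real.le_log_iff_exp_le hR0).1 hζ.1.2
  · intro p hp
    have hp' := ((hmemS p).1 hp).1
    refine (meromorphicAt_F δ p).mul (hpow p ?_).meromorphicAt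
    rw [mem_slitPlane_iff_arg]
    exact ⟨by linarith [hp'.2.2.2], hp'.1⟩
  · intro p hp
    obtain ⟨hp1, hp2⟩ := (hmemS p).1 hp
    have hpn : 0 < ‖p‖ := norm_pos_iff.2 hp1.1
    refine ⟨log p, exp_log hp1.1, ?_, by rw [log_im]; exact hp1.2.2⟩
    rw [log_re]
    refine ⟨Real.log_lt_log hr.1 ?_, Real.log_lt_log hpn hp2⟩
    by_contra hle
    refine hr.den_ne_zero hpn (not_lt.1 hle) p.arg ?_
    rw [norm_mul_exp_arg_mul_I]
    exact hp1.2.1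

/-! ### Auxiliary estimates for arcs of large radius -/

/-- The elements of A below R are at distance at least c from the others. If one of the two groups
comes within c/2 of R, the new radius is put at distance c/2 from the extreme point of that group,
inside the gap; otherwise R itself will do. -/
lemma exists_radius_of_nonseparating {A : Set ℝ} {R c : ℝ} (hc : 0 < c)
    (h : ∀ x ∈ A, ∀ y ∈ A, |x - y| < c → (x < R ↔ y < R)) :
    ∃ R', |R' - R| ≤ c / 2 ∧ (∀ x ∈ A, x < R ↔ x < R') ∧ ∀ x ∈ A, c / 2 ≤ |x - R'| := by
  have hsep : ∀ x ∈ A, ∀ y ∈ A, x < R → R ≤ y → c ≤ y - x := by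
    intro x hx y hy hxR hRy
    by_contra! hlt
    have := (h x hx y hy (by rw [abs_lt]; constructor <;> linarith)).1 hxR
    linarith
  by_cases h1 : ∃ y ∈ A, R ≤ y ∧ y < R + c / 2
  · obtain ⟨y, hyA, hRy, hy⟩ := h1
    set q := sInf (A ∩ Ici R)
    have hbdd : BddBelow (A ∩ Ici R) := ⟨R, fun z hz => hz.2⟩
    have hqy : q ≤ y := csInf_le hbdd ⟨hyA, hRy⟩
    have hRq : R ≤ q := le_csInf ⟨y, hyA, hRy⟩ fun z hz => hz.2
    have hlow : ∀ x ∈ A, x < R → x ≤ q - c := by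
      intro x hx hxR
      have : x + c ≤ q := le_csInf ⟨y, hyA, hRy⟩ fun z hz => by
        linarith [hsep x hx z hz.1 hxR hz.2]
      linarith
    have hup : ∀ x ∈ A, R ≤ x → q ≤ x := fun x hx hxR => csInf_le hbdd ⟨hx, hxR⟩
    refine ⟨q - c / 2, by rw [abs_le]; constructor <;> linarith, fun x hx => ?_, fun x hx => ?_⟩
    · constructor
      · intro hxR; linarith [hlow x hx hxR]
      · intro hxR; by_contra hxR'; linarith [hup x hx (not_lt.1 hxR')]
    · rw [le_abs]
      rcases lt_or_ge x R with hxR | hxR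
      · right; linarith [hlow x hx hxR]
      · left; linarith [hup x hx hxR]
  by_cases h2 : ∃ y ∈ A, y < R ∧ R - c / 2 < y
  · obtain ⟨y, hyA, hRy, hy⟩ := h2
    set q := sSup (A ∩ Iio R)
    have hbdd : BddAbove (A ∩ Iio R) := ⟨R, fun z hz => le_of_lt hz.2⟩
    have hqy : y ≤ q := le_csSup hbdd ⟨hyA, hRy⟩
    have hRq : q ≤ R := csSup_le ⟨y, hyA, hRy⟩ fun z hz => le_of_lt hz.2
    have hup : ∀ x ∈ A, R ≤ x → q + c ≤ x := by
      intro x hx hxR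
      have : q ≤ x - c := csSup_le ⟨y, hyA, hRy⟩ fun z hz => by
        linarith [hsep z hz.1 x hx hz.2 hxR]
      linarith
    have hlow : ∀ x ∈ A, x < R → x ≤ q := fun x hx hxR => le_csSup hbdd ⟨hx, hxR⟩
    refine ⟨q + c / 2, by rw [abs_le]; constructor <;> linarith, fun x hx => ?_, fun x hx => ?_⟩
    · constructor
      · intro hxR; linarith [hlow x hx hxR]
      · intro hxR; by_contra hxR'; linarith [hup x hx (not_lt.1 hxR')]
    · rw [le_abs]
      rcases lt_or_ge x R with hxR | hxR
      · right; linarith [hlow x hx hxR]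
      · left; linarith [hup x hx hxR]
  · push Not at h1 h2
    refine ⟨R, by rw [sub_self, abs_zero]; linarith, fun x _ => Iff.rfl, fun x hx => ?_⟩
    rw [le_abs]
    rcases lt_or_ge x R with hxR | hxR
    · right; linarith [h2 x hx hxR]
    · left; linarith [h1 x hx hxR]

lemma integral_exp_neg_abs_le {k a m b : ℝ} (hk : 0 < k) (ham : a ≤ m) (hmb : m ≤ b) :
    ∫ t in a..b, Real.exp (-(k * |t - m|)) ≤ 2 / k := by
  have hi : ∀ a b : ℝ, IntervalIntegrable (fun t => Real.exp (-(k * |t - m|))) volume a b :=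
    fun a b => Continuous.intervalIntegrable (by fun_prop) a b
  have h1 : ∫ t in a..m, Real.exp (-(k * |t - m|)) ≤ 1 / k := by
    have e1 : ∫ t in a..m, Real.exp (-(k * |t - m|)) = ∫ t in a..m, Real.exp (k * (t - m)) := by
      refine integral_congr fun t ht => ?_
      rw [uIcc_of_le ham] at ht
      simp only [abs_of_nonpos (sub_nonpos.2 ht.2)]
      ring_nf
    rw [e1, integral_eq_sub_of_hasDerivAt (f := fun t => Real.exp (k * (t - m)) / k)]
    · have := Real.exp_pos (k * (a - m))
      simp only [sub_self, mul_zero, Real.exp_zero]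
      have : 0 ≤ Real.exp (k * (a - m)) / k := by positivity
      linarith
    · intro t _
      have := ((((hasDerivAt_id t).sub_const m).const_mul k).exp).div_const k
      refine this.congr_deriv ?_
      simp only [id]
      field_simp
    · exact Continuous.intervalIntegrable (by fun_prop) _ _
  have h2 : ∫ t in m..b, Real.exp (-(k * |t - m|)) ≤ 1 / k := by
    have e1 : ∫ t in m..b, Real.exp (-(k * |t - m|)) = ∫ t in m..b, Real.exp (-k * (t - m)) := by
      refine integral_congr fun t ht => ?_
      rw [uIcc_of_le hmb] at ht
      simp only [abs_of_nonneg (sub_nonneg.2 ht.1)]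
      ring_nf
    rw [e1, integral_eq_sub_of_hasDerivAt (f := fun t => -(Real.exp (-k * (t - m)) / k))]
    · simp only [sub_self, mul_zero, Real.exp_zero]
      have : 0 ≤ Real.exp (-k * (b - m)) / k := by positivity
      linarith
    · intro t _
      have := (((((hasDerivAt_id t).sub_const m).const_mul (-k)).exp).div_const k).neg
      refine this.congr_deriv ?_
      simp only [id]
      field_simp
    · exact Continuous.intervalIntegrable (by fun_prop) _ _
  rw [← integral_add_adjacent_intervals (hi a m) (hi m b)]
  calc _ ≤ 1 / k + 1 / k := add_le_add h1 h2
    _ = 2 / k := by ring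

lemma exists_pos_forall_le {ι : Type*} [Finite ι] {f : ι → ℝ} (hf : ∀ i, 0 < f i) :
    ∃ ε > 0, ∀ i, ε ≤ f i := by
  have h : ∀ᶠ ε in 𝓝[>] (0 : ℝ), ∀ i, ε ≤ f i :=
    eventually_all.2 fun i => nhdsWithin_le_nhds (eventually_le_nhds (hf i))
  obtain ⟨ε, h1, h2⟩ := (h.and self_mem_nhdsWithin).exists
  exact ⟨ε, h2, h1⟩

/-! ### Thin sectors -/

/-- A sector of angle at most `π/2` with nondegenerate boundary, in which only the
angle `φ₀` may be critical. -/
structure IsThinSector (δ : Param N) (φ₁ φ₀ φ₂ : ℝ) : Prop where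
  lt_mid : φ₁ < φ₀
  mid_lt : φ₀ < φ₂
  neg_pi_lt : -Real.pi < φ₁
  lt_pi : φ₂ < Real.pi
  length_le : φ₂ - φ₁ ≤ Real.pi / 2
  eq_of_isCritical : ∀ t ∈ Icc φ₁ φ₂, IsCritical δ t → t = φ₀

namespace IsThinSector

variable {δ : Param N} {φ₁ φ₀ φ₂ : ℝ}

lemma left (h : IsThinSector δ φ₁ φ₀ φ₂) : ¬ IsCritical δ φ₁ := fun hc =>
  h.lt_mid.ne (h.eq_of_isCritical φ₁ ⟨le_rfl, (h.lt_mid.trans h.mid_lt).le⟩ hc)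

lemma right (h : IsThinSector δ φ₁ φ₀ φ₂) : ¬ IsCritical δ φ₂ := fun hc =>
  h.mid_lt.ne' (h.eq_of_isCritical φ₂ ⟨(h.lt_mid.trans h.mid_lt).le, le_rfl⟩ hc)

lemma arg_eq (h : IsThinSector δ φ₁ φ₀ φ₂) {u : ℂ} (hu : u ∈ sectorPoles φ₁ φ₂ δ) :
    u.arg = φ₀ :=
  h.eq_of_isCritical _ ⟨hu.2.2.1.le, hu.2.2.2.le⟩ (isCritical_arg hu.1 hu.2.1)

/-- All poles of a thin sector lie on one ray. A condition on the distances of poles thus becomes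
one on their absolute values. -/
lemma norm_sub_eq (h : IsThinSector δ φ₁ φ₀ φ₂) {u v : ℂ} (hu : u ∈ sectorPoles φ₁ φ₂ δ)
    (hv : v ∈ sectorPoles φ₁ φ₂ δ) : ‖u - v‖ = |‖u‖ - ‖v‖| := by
  have h1 := norm_mul_exp_arg_mul_I u
  have h2 := norm_mul_exp_arg_mul_I v
  rw [h.arg_eq hu] at h1
  rw [h.arg_eq hv] at h2
  nth_rewrite 1 [← h1, ← h2]
  rw [← sub_mul, norm_mul, norm_exp_ofReal_mul_I, mul_one, ← ofReal_sub, norm_real,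
    Real.norm_eq_abs]

/-- On each side of φ₀ the height lies above a chord that is positive at the outer end and
nonnegative at φ₀. The height itself may vanish at φ₀, so a linear bound is all that can be
expected. -/
lemma exists_le_height (h : IsThinSector δ φ₁ φ₀ φ₂) (hδ : δ ∈ stableDomain N) :
    ∃ κ > 0, ∀ t ∈ Icc φ₁ φ₂, κ * |t - φ₀| ≤ height δ (exp (t * I)) := by
  have hh1 := height_exp_pos hδ h.left
  have hh2 := height_exp_pos hδ h.right
  have hd1 : 0 < φ₀ - φ₁ := sub_pos.2 h.lt_mid
  have hd2 : 0 < φ₂ - φ₀ := sub_pos.2 h.mid_lt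
  refine ⟨min (height δ (exp (φ₁ * I)) / (φ₀ - φ₁)) (height δ (exp (φ₂ * I)) / (φ₂ - φ₀)),
    by positivity, fun t ht => ?_⟩
  rcases le_total t φ₀ with htm | htm
  · have hch := height_chord_le hδ (A := φ₁) (B := φ₀) (t := t) (fun x hx hc =>
      hx.2.ne (h.eq_of_isCritical x ⟨hx.1.le, hx.2.le.trans h.mid_lt.le⟩ hc)) ⟨ht.1, htm⟩
    have h0 := height_exp_nonneg hδ φ₀
    rw [abs_of_nonpos (sub_nonpos.2 htm), neg_sub]
    have h3 : 0 ≤ (t - φ₁) * height δ (exp (φ₀ * I)) := mul_nonneg (sub_nonneg.2 ht.1) h0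
    calc _ ≤ height δ (exp (φ₁ * I)) / (φ₀ - φ₁) * (φ₀ - t) := by
          gcongr
          exact min_le_left _ _
      _ ≤ _ := by
          rw [div_mul_eq_mul_div, div_le_iff₀ hd1]
          linarith
  · have hch := height_chord_le hδ (A := φ₀) (B := φ₂) (t := t) (fun x hx hc =>
      hx.1.ne' (h.eq_of_isCritical x ⟨h.lt_mid.le.trans hx.1.le, hx.2.le⟩ hc)) ⟨htm, ht.2⟩
    have h0 := height_exp_nonneg hδ φ₀
    rw [abs_of_nonneg (sub_nonneg.2 htm)]
    have h3 : 0 ≤ (φ₂ - t) * height δ (exp (φ₀ * I)) := mul_nonneg (sub_nonneg.2 ht.2) h0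
    calc _ ≤ height δ (exp (φ₂ * I)) / (φ₂ - φ₀) * (t - φ₀) := by
          gcongr
          exact min_le_right _ _
      _ ≤ _ := by
          rw [div_mul_eq_mul_div, div_le_iff₀ hd2]
          linarith

lemma exists_le_cos (h : IsThinSector δ φ₁ φ₀ φ₂) :
    ∃ m > 0, ∀ t ∈ Icc φ₁ φ₂, m ≤ Real.cos (t - φ₀) := by
  have hL := h.length_le
  have h1 := h.lt_mid
  have h2 := h.mid_lt
  set L := max (φ₀ - φ₁) (φ₂ - φ₀)
  have hL2 : L < Real.pi / 2 := max_lt (by linarith) (by linarith)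
  have hL0 : 0 < L := (sub_pos.2 h1).trans_le (le_max_left _ _)
  refine ⟨Real.cos L, Real.cos_pos_of_mem_Ioo ⟨by linarith, hL2⟩, fun t ht => ?_⟩
  rw [← Real.cos_abs (t - φ₀)]
  refine Real.cos_le_cos_of_nonneg_of_le_pi (abs_nonneg _) (by linarith) (abs_le.2 ⟨?_, ?_⟩)
  · linarith [le_max_left (φ₀ - φ₁) (φ₂ - φ₀), ht.1]
  · linarith [le_max_right (φ₀ - φ₁) (φ₂ - φ₀), ht.2]

/-- Away from the poles on the critical ray, circular arcs of large radius stay away from the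
zeros of every factor of the denominator. -/
lemma exists_le_norm_sub (h : IsThinSector δ φ₁ φ₀ φ₂) {c : ℝ} (hc : 0 < c) :
    ∃ ε > 0, ∀ᶠ R : ℝ in atTop, (∀ u ∈ sectorPoles φ₁ φ₂ δ, c ≤ |‖u‖ - R|) →
      ∀ t ∈ Icc φ₁ φ₂, ∀ l, δ.a l ≠ 0 → ∀ n : ℤ,
        ε ≤ ‖R * exp (t * I) * δ.a l - 2 * Real.pi * I * (δ.θ l + n)‖ := by
  obtain ⟨m, hm, hcos⟩ := h.exists_le_cos
  have key : ∀ l : Fin N, ∃ ε > 0, ∀ᶠ R : ℝ in atTop,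
      (∀ u ∈ sectorPoles φ₁ φ₂ δ, c ≤ |‖u‖ - R|) →
      ∀ t ∈ Icc φ₁ φ₂, δ.a l ≠ 0 → ∀ n : ℤ,
        ε ≤ ‖R * exp (t * I) * δ.a l - 2 * Real.pi * I * (δ.θ l + n)‖ := by
    intro l
    by_cases ha : δ.a l = 0
    · exact ⟨1, one_pos, Eventually.of_forall fun R _ t _ h => absurd ha h⟩
    have han : 0 < ‖δ.a l‖ := norm_pos_iff.2 ha
    by_cases h0 : (exp (φ₀ * I) * δ.a l).re = 0
    · refine ⟨‖δ.a l‖ * min c 1, by positivity, ?_⟩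
      filter_upwards [eventually_ge_atTop (1 / m), eventually_gt_atTop 0]
        with R hR hR0 hpoles t ht _ n
      set β := (exp (φ₀ * I) * δ.a l).im
      have hβ : exp (φ₀ * I) * δ.a l = β * I := by
        refine Complex.ext ?_ ?_
        · rw [h0, re_ofReal_mul, I_re, mul_zero]
        · rw [im_ofReal_mul, I_im, mul_one]
      have hβ0 : (β : ℂ) ≠ 0 := by
        intro hz
        rw [hz, zero_mul] at hβ
        simp [exp_ne_zero, ha] at hβ
      -- The zeros of this factor lie on the line through 0 and e^{iφ₀}, at the points p e^{iφ₀}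
      -- with p real of either sign.
      set p : ℝ := 2 * Real.pi * (δ.θ l + n) / β with hp
      have hpe : (p : ℂ) * exp (φ₀ * I) * δ.a l = 2 * Real.pi * I * (δ.θ l + n) := by
        rw [mul_assoc, hβ, hp]
        push_cast
        field_simp
      rw [← hpe, ← sub_mul, norm_mul, mul_comm]
      gcongr
      -- For p > 0 the point is a pole in the sector, from whose absolute value R keeps the distance
      -- c. For p ≤ 0 it lies on the opposite ray (or at 0), at distance at least R cos(t - φ₀) ≥ Rm
      -- ≥ 1.
      rcases lt_or_ge 0 p with hp0 | hp0
      · have harg : arg (p * exp (φ₀ * I)) = φ₀ := by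
          rw [exp_mul_I]
          exact arg_mul_cos_add_sin_mul_I hp0
            ⟨h.neg_pi_lt.trans h.lt_mid, (h.mid_lt.trans h.lt_pi).le⟩
        have hmem : (p * exp (φ₀ * I) : ℂ) ∈ sectorPoles φ₁ φ₂ δ := by
          refine ⟨mul_ne_zero (ofReal_ne_zero.2 hp0.ne') (exp_ne_zero _), ?_, ?_⟩
          · rw [den_eq_zero_iff]
            exact ⟨l, e_eq_exp_iff.2 ⟨n, hpe⟩⟩
          · rw [harg]; exact ⟨h.lt_mid, h.mid_lt⟩
        have h1 := hpoles _ hmem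
        rw [norm_real_mul_exp hp0.le] at h1
        refine (min_le_left _ _).trans (h1.trans ?_)
        have h2 := abs_norm_sub_norm_le (R * exp (t * I) : ℂ) (p * exp (φ₀ * I))
        rwa [norm_real_mul_exp hp0.le, norm_real_mul_exp hR0.le, abs_sub_comm] at h2
      · refine (min_le_right _ _).trans ?_
        have h1 : (R * exp (t * I) - p * exp (φ₀ * I) : ℂ) =
            (R * exp ((t - φ₀ : ℝ) * I) - p) * exp (φ₀ * I) := by
          rw [sub_mul, mul_assoc, ← exp_add]; push_cast; ring_nf
        rw [h1, norm_mul, norm_exp_ofReal_mul_I, mul_one]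
        refine le_trans ?_ (re_le_norm _)
        rw [sub_re, re_ofReal_mul, exp_ofReal_mul_I_re, ofReal_re]
        have h2 := hcos t ht
        have h3 : 1 ≤ R * m := by rwa [div_le_iff₀ hm] at hR
        have h4 : R * m ≤ R * Real.cos (t - φ₀) := by gcongr
        linarith
    -- If φ₀ is not critical for this factor, no angle of the sector is, and |Re(e^{it} a_ℓ)| has a
    -- positive minimum by compactness.
    · have hne : ∀ t ∈ Icc φ₁ φ₂, 0 < |(exp (t * I) * δ.a l).re| := by
        intro t ht
        refine abs_pos.2 fun h1 => ?_
        have := h.eq_of_isCritical t ht ⟨l, ha, h1⟩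
        rw [this] at h1
        exact h0 h1
      obtain ⟨t0, ht0, hmin⟩ := isCompact_Icc.exists_isMinOn
        (nonempty_Icc.2 (h.lt_mid.trans h.mid_lt).le)
        ((continuous_critical δ l).abs.continuousOn (s := Icc φ₁ φ₂))
      refine ⟨1, one_pos, ?_⟩
      have hpos := hne t0 ht0
      filter_upwards [eventually_ge_atTop (1 / |(exp (t0 * I) * δ.a l).re|),
        eventually_gt_atTop 0] with R hR hR0 _ t ht _ n
      refine le_trans ?_ (abs_re_le_norm_sub _ _ _)
      rw [mul_assoc, re_ofReal_mul, abs_mul, abs_of_pos hR0]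
      have h3 : 1 ≤ R * |(exp (t0 * I) * δ.a l).re| := by rwa [div_le_iff₀ hpos] at hR
      have h4 : |(exp (t0 * I) * δ.a l).re| ≤ |(exp (t * I) * δ.a l).re| := hmin ht
      exact h3.trans (by gcongr)
  choose ε hε hb using key
  obtain ⟨ε', hε', hle⟩ := exists_pos_forall_le hε
  refine ⟨ε', hε', ?_⟩
  filter_upwards [eventually_all.2 hb] with R hR hpoles t ht l ha n
  exact (hle l).trans (hR l hpoles t ht ha n)

/-- The integral over arcs avoiding the poles is `O(R^{Re(s) - 1})`. -/
lemma exists_norm_arcIntegral_le (h : IsThinSector δ φ₁ φ₀ φ₂) (hδ : δ ∈ stableDomain N) {c : ℝ}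
    (hc : 0 < c) (s : ℂ) :
    ∃ C, ∀ᶠ R : ℝ in atTop, (∀ u ∈ sectorPoles φ₁ φ₂ δ, c ≤ |‖u‖ - R|) →
      ‖∫ t in φ₁..φ₂, arcFun R s δ t‖ ≤ C * R ^ (s.re - 1) := by
  obtain ⟨ε, hε, hdist⟩ := h.exists_le_norm_sub hc
  obtain ⟨C, hC, hF⟩ := exists_norm_F_le δ hε
  obtain ⟨κ, hκ, hheight⟩ := h.exists_le_height hδ
  -- The second factor bounds e^{-t Im(s)} for |t| ≤ π. The last one, divided by R, bounds the
  -- integral of exp(-κR|t - φ₀|), which is where the exponent Re(s) - 1 comes from.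
  refine ⟨C * Real.exp (|s.im| * Real.pi) * (2 / κ), ?_⟩
  filter_upwards [hdist, eventually_gt_atTop 0] with R hR hR0 hpoles
  have hle : φ₁ ≤ φ₂ := (h.lt_mid.trans h.mid_lt).le
  have hbound : ∀ t ∈ Icc φ₁ φ₂, ‖arcFun R s δ t‖ ≤
      C * Real.exp (|s.im| * Real.pi) * R ^ s.re * Real.exp (-(κ * R * |t - φ₀|)) := by
    intro t ht
    have h1 := hF (R * exp (t * I)) fun l ha n => hR hpoles t ht l ha n
    rw [height_real_mul δ hR0.le] at h1
    have h2 : Real.exp (-(R * height δ (exp (t * I)))) ≤ Real.exp (-(κ * R * |t - φ₀|)) := by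
      rw [Real.exp_le_exp, neg_le_neg_iff]
      calc κ * R * |t - φ₀| = R * (κ * |t - φ₀|) := by ring
        _ ≤ _ := by gcongr; exact hheight t ht
    have h3 : ‖exp (s * (Real.log R + t * I))‖ ≤ R ^ s.re * Real.exp (|s.im| * Real.pi) := by
      rw [norm_exp, Real.rpow_def_of_pos hR0, ← Real.exp_add, Real.exp_le_exp]
      have h4 : (s * (Real.log R + t * I)).re = Real.log R * s.re + -s.im * t := by
        simp only [mul_re, add_re, add_im, ofReal_re, ofReal_im, I_re, I_im, mul_im]
        ring
      have h5 : |t| ≤ Real.pi := abs_le.2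
        ⟨by linarith [h.neg_pi_lt, ht.1], by linarith [h.lt_pi, ht.2]⟩
      have h6 : -s.im * t ≤ |s.im| * Real.pi := by
        calc -s.im * t ≤ |-s.im * t| := le_abs_self _
          _ = |s.im| * |t| := by rw [abs_mul, abs_neg]
          _ ≤ |s.im| * Real.pi := by gcongr
      rw [h4]
      linarith
    rw [arcFun, norm_mul]
    calc _ ≤ (C * Real.exp (-(κ * R * |t - φ₀|))) * (R ^ s.re * Real.exp (|s.im| * Real.pi)) := by
          gcongr
          exact h1.trans (by gcongr)
      _ = _ := by ring
  have hcont : Continuous fun t =>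
      C * Real.exp (|s.im| * Real.pi) * R ^ s.re * Real.exp (-(κ * R * |t - φ₀|)) := by fun_prop
  have hint := norm_integral_le_of_norm_le hle (μ := volume) (f := arcFun R s δ)
    (g := fun t => C * Real.exp (|s.im| * Real.pi) * R ^ s.re * Real.exp (-(κ * R * |t - φ₀|)))
    (Eventually.of_forall fun t ht => hbound t (Ioc_subset_Icc_self ht))
    (hcont.intervalIntegrable _ _)
  refine hint.trans ?_
  rw [intervalIntegral.integral_const_mul]
  calc _ ≤ C * Real.exp (|s.im| * Real.pi) * R ^ s.re * (2 / (κ * R)) := by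
        gcongr
        exact integral_exp_neg_abs_le (by positivity) h.lt_mid.le h.mid_lt.le
    _ = _ := by
        rw [Real.rpow_sub_one hR0.ne']
        field_simp

end IsThinSector

/-! ### Residue sums as differences of contours -/

/-- The residue sums over a sector converge to the difference of the contour integrals. -/
def HasSectorLimit (δ : Param N) (φ₁ φ₂ : ℝ) : Prop :=
  ∀ r, IsAdmissible δ r → ∀ s : ℂ, s.re < 1 → ∀ c > 0,
    Tendsto (fun R => 2 * Real.pi * I * residueSumOn (sectorPoles φ₁ φ₂ δ) δ s R)
      (atTop ⊓ 𝓟 (nonseparatingRadii (sectorPoles φ₁ φ₂ δ) c))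
      (𝓝 (contour r φ₁ s δ - contour r φ₂ s δ))

/-- Each nonseparating R is replaced by a radius within c/2 of it that cuts off the same poles and
stays c/2 away from their absolute values. At the new radii the outer arc tends to 0 because Re(s) <
1, and the segments tend to the full rays. -/
lemma IsThinSector.hasSectorLimit {δ : Param N} {φ₁ φ₀ φ₂ : ℝ} (h : IsThinSector δ φ₁ φ₀ φ₂)
    (hδ : δ ∈ stableDomain N) : HasSectorLimit δ φ₁ φ₂ := by
  intro r hr s hs c hc
  set P := sectorPoles φ₁ φ₂ δ
  have hchoice : ∀ R ∈ nonseparatingRadii P c, ∃ R', |R' - R| ≤ c / 2 ∧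
      (∀ u ∈ P, ‖u‖ < R ↔ ‖u‖ < R') ∧ ∀ u ∈ P, c / 2 ≤ |‖u‖ - R'| := by
    intro R hR
    obtain ⟨R', h1, h2, h3⟩ := exists_radius_of_nonseparating (A := norm '' P) (R := R) hc (by
      rintro _ ⟨u, hu, rfl⟩ _ ⟨v, hv, rfl⟩ huv
      exact hR u hu v hv (by rwa [h.norm_sub_eq hu hv]))
    exact ⟨R', h1, fun u hu => h2 _ ⟨u, hu, rfl⟩, fun u hu => h3 _ ⟨u, hu, rfl⟩⟩
  choose! ρ hρ1 hρ2 hρ3 using hchoice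
  set l := atTop ⊓ 𝓟 (nonseparatingRadii P c)
  have hgood : ∀ᶠ R in l, R ∈ nonseparatingRadii P c := mem_inf_of_right (mem_principal_self _)
  have hρ : Tendsto ρ l atTop := by
    have h1 : Tendsto (fun R : ℝ => R - c / 2) l atTop :=
      (tendsto_atTop_add_const_right _ (-(c / 2)) tendsto_id).mono_left inf_le_left
    refine tendsto_atTop_mono' l ?_ h1
    filter_upwards [hgood] with R hR
    linarith [(abs_le.1 (hρ1 R hR)).1]
  obtain ⟨C, hC⟩ := h.exists_norm_arcIntegral_le hδ (half_pos hc) s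
  have harc : Tendsto (fun R => ∫ t in φ₁..φ₂, arcFun (ρ R) s δ t) l (𝓝 0) := by
    refine squeeze_zero_norm' (a := fun R => C * ρ R ^ (s.re - 1)) ?_ ?_
    · filter_upwards [hρ.eventually hC, hgood] with R h1 h2
      exact h1 (hρ3 R h2)
    · have h1 : Tendsto (fun x : ℝ => x ^ (s.re - 1)) atTop (𝓝 0) := by
        have := tendsto_rpow_neg_atTop (y := 1 - s.re) (by linarith)
        simpa using this
      simpa using (h1.comp hρ).const_mul C
  have hlim := (((((tendsto_seg hδ h.left hr.1 s).comp hρ).const_mul (exp (s * φ₁ * I))).sub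
    (((tendsto_seg hδ h.right hr.1 s).comp hρ).const_mul (exp (s * φ₂ * I)))).add
    (harc.const_mul I)).sub_const (I * ∫ t in φ₁..φ₂, arcFun r s δ t)
  have hval : exp (s * φ₁ * I) * ray r φ₁ s δ - exp (s * φ₂ * I) * ray r φ₂ s δ + I * 0 -
      I * (∫ t in φ₁..φ₂, arcFun r s δ t) = contour r φ₁ s δ - contour r φ₂ s δ := by
    have hi : ∀ a b : ℝ, IntervalIntegrable (arcFun r s δ) volume a b := fun a b =>
      (hr.continuous_arcFun s).intervalIntegrable a b
    have := integral_add_adjacent_intervals (hi 0 φ₁) (hi φ₁ φ₂)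
    rw [contour, contour, ← this]
    ring
  rw [hval] at hlim
  refine hlim.congr' ?_
  filter_upwards [hρ.eventually (eventually_gt_atTop r), hgood] with R h1 h2
  have hset : residueSumOn P δ s R = residueSumOn P δ s (ρ R) := by
    have : {u | u ∈ P ∧ ‖u‖ < R} = {u | u ∈ P ∧ ‖u‖ < ρ R} := by
      ext u
      exact and_congr_right fun hu => hρ2 R h2 u hu
    rw [residueSumOn, residueSumOn, this]
  rw [hset]
  refine (two_pi_I_mul_residueSumOn hr h1 (h.lt_mid.trans h.mid_lt) h.neg_pi_lt h.lt_pi h.left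
    h.right (fun u hu hn => ?_) s).symm
  have := hρ3 R h2 u hu
  rw [hn, sub_self, abs_zero] at this
  linarith

/-- The noncritical middle ray carries no poles, so the residue sums add and the middle contours
cancel. Radii that are nonseparating for the union are so for both parts. -/
lemma HasSectorLimit.trans {δ : Param N} {φ₁ m φ₂ : ℝ} (hm : ¬ IsCritical δ m) (h1m : φ₁ < m)
    (hm2 : m < φ₂) (h1 : HasSectorLimit δ φ₁ m) (h2 : HasSectorLimit δ m φ₂) :
    HasSectorLimit δ φ₁ φ₂ := by
  intro r hr s hs c hc
  have hunion : sectorPoles φ₁ φ₂ δ = sectorPoles φ₁ m δ ∪ sectorPoles m φ₂ δ := by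
    ext u
    constructor
    · rintro ⟨h0, hd, ha, hb⟩
      rcases lt_trichotomy u.arg m with h | h | h
      · exact Or.inl ⟨h0, hd, ha, h⟩
      · exact absurd (h ▸ isCritical_arg h0 hd) hm
      · exact Or.inr ⟨h0, hd, h, hb⟩
    · rintro (⟨h0, hd, ha, hb⟩ | ⟨h0, hd, ha, hb⟩)
      · exact ⟨h0, hd, ha, hb.trans hm2⟩
      · exact ⟨h0, hd, h1m.trans ha, hb⟩
  have hsum : ∀ R, residueSumOn (sectorPoles φ₁ φ₂ δ) δ s R =
      residueSumOn (sectorPoles φ₁ m δ) δ s R + residueSumOn (sectorPoles m φ₂ δ) δ s R := by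
    intro R
    have : {u | u ∈ sectorPoles φ₁ φ₂ δ ∧ ‖u‖ < R} =
        {u | u ∈ sectorPoles φ₁ m δ ∧ ‖u‖ < R} ∪ {u | u ∈ sectorPoles m φ₂ δ ∧ ‖u‖ < R} := by
      rw [hunion]; ext u; simp only [mem_union, mem_ofPred_eq]; tauto
    rw [residueSumOn, this, finsum_mem_union _ (finite_sectorPoles φ₁ m δ R)
      (finite_sectorPoles m φ₂ δ R), residueSumOn, residueSumOn]
    rw [Set.disjoint_left]
    rintro u ⟨hu, -⟩ ⟨hv, -⟩
    exact lt_asymm hu.2.2.2 hv.2.2.1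
  have hmono : ∀ Q ⊆ sectorPoles φ₁ φ₂ δ,
      atTop ⊓ 𝓟 (nonseparatingRadii (sectorPoles φ₁ φ₂ δ) c) ≤
        atTop ⊓ 𝓟 (nonseparatingRadii Q c) := fun Q hQ =>
    inf_le_inf_left _ (principal_mono.2 (nonseparatingRadii_anti hQ c))
  have := ((h1 r hr s hs c hc).mono_left (hmono _ (hunion ▸ subset_union_left))).add
    ((h2 r hr s hs c hc).mono_left (hmono _ (hunion ▸ subset_union_right)))
  simp only [hsum, mul_add]
  simpa using this

/-- The angles at which a sector is cut into thin sectors. -/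
def cuttingAngles (δ : Param N) : Set ℝ :=
  {t | IsCritical δ t ∨ ∃ k : ℤ, t = k * (Real.pi / 4)}

lemma finite_cuttingAngles (δ : Param N) {φ₁ φ₂ : ℝ} (h1 : -Real.pi < φ₁) (h2 : φ₂ < Real.pi) :
    (Ioo φ₁ φ₂ ∩ cuttingAngles δ).Finite := by
  refine ((finite_isCritical δ).union
    ((finite_Icc (-4 : ℤ) 4).image fun k : ℤ => (k : ℝ) * (Real.pi / 4))).subset ?_
  rintro t ⟨ht, hc | ⟨k, hk⟩⟩
  · exact Or.inl ⟨⟨h1.trans ht.1, (ht.2.trans h2).le⟩, hc⟩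
  · refine Or.inr ⟨k, ?_, hk.symm⟩
    have hpi := Real.pi_pos
    have h3 : (-4 : ℝ) * (Real.pi / 4) < k * (Real.pi / 4) := by linarith [ht.1]
    have h4 : (k : ℝ) * (Real.pi / 4) < 4 * (Real.pi / 4) := by linarith [ht.2]
    have h5 := lt_of_mul_lt_mul_right h3 (by positivity)
    have h6 := lt_of_mul_lt_mul_right h4 (by positivity)
    have h7 : (-4 : ℤ) < k := by exact_mod_cast h5
    have h8 : k < (4 : ℤ) := by exact_mod_cast h6
    exact ⟨h7.le, h8.le⟩

/-- An interval longer than π/2 has two multiples of π/4 in its interior; this is why these count as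
cutting angles. So a sector with at most one cutting angle is thin. -/
lemma hasSectorLimit_of_subsingleton {δ : Param N} (hδ : δ ∈ stableDomain N) {φ₁ φ₂ : ℝ}
    (h12 : φ₁ < φ₂) (h1 : -Real.pi < φ₁) (h2 : φ₂ < Real.pi) (hc1 : ¬ IsCritical δ φ₁)
    (hc2 : ¬ IsCritical δ φ₂) (hs : (Ioo φ₁ φ₂ ∩ cuttingAngles δ).Subsingleton) :
    HasSectorLimit δ φ₁ φ₂ := by
  have hlen : φ₂ - φ₁ ≤ Real.pi / 2 := by
    by_contra! hlt
    have hp : 0 < Real.pi / 4 := by positivity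
    set k : ℤ := ⌊φ₁ / (Real.pi / 4)⌋
    have hk1 : (k : ℝ) * (Real.pi / 4) ≤ φ₁ := by
      rw [← le_div_iff₀ hp]; exact Int.floor_le _
    have hk2 : φ₁ < ((k : ℝ) + 1) * (Real.pi / 4) := by
      rw [← div_lt_iff₀ hp]; exact Int.lt_floor_add_one _
    have := hs (x := ((k + 1 : ℤ) : ℝ) * (Real.pi / 4))
      ⟨⟨by push_cast; linarith, by push_cast; linarith⟩, Or.inr ⟨k + 1, rfl⟩⟩
      (y := ((k + 2 : ℤ) : ℝ) * (Real.pi / 4))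
      ⟨⟨by push_cast; linarith, by push_cast; linarith⟩, Or.inr ⟨k + 2, rfl⟩⟩
    push_cast at this
    linarith
  have hmem : ∀ t ∈ Icc φ₁ φ₂, IsCritical δ t → t ∈ Ioo φ₁ φ₂ ∩ cuttingAngles δ := fun t ht hc =>
    ⟨⟨lt_of_le_of_ne ht.1 fun h => hc1 (h ▸ hc), lt_of_le_of_ne ht.2 fun h => hc2 (h ▸ hc)⟩,
      Or.inl hc⟩
  by_cases hex : ∃ φ₀ ∈ Icc φ₁ φ₂, IsCritical δ φ₀
  · obtain ⟨φ₀, h0, hc0⟩ := hex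
    have h0' := (hmem φ₀ h0 hc0).1
    exact IsThinSector.hasSectorLimit
      ⟨h0'.1, h0'.2, h1, h2, hlen, fun t ht hc => hs (hmem t ht hc) (hmem φ₀ h0 hc0)⟩ hδ
  -- Without critical angles any interior angle may play the part of φ₀.
  · exact IsThinSector.hasSectorLimit (φ₀ := (φ₁ + φ₂) / 2)
      ⟨by linarith, by linarith, h1, h2, hlen, fun t ht hc => absurd ⟨t, ht, hc⟩ hex⟩ hδ

theorem hasSectorLimit {δ : Param N} (hδ : δ ∈ stableDomain N) {φ₁ φ₂ : ℝ} (h12 : φ₁ < φ₂)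
    (h1 : -Real.pi < φ₁) (h2 : φ₂ < Real.pi) (hc1 : ¬ IsCritical δ φ₁)
    (hc2 : ¬ IsCritical δ φ₂) : HasSectorLimit δ φ₁ φ₂ := by
  induction hn : (Ioo φ₁ φ₂ ∩ cuttingAngles δ).ncard using Nat.strong_induction_on
    generalizing φ₁ φ₂ with
  | _ n ih =>
    by_cases hs : (Ioo φ₁ φ₂ ∩ cuttingAngles δ).Subsingleton
    · exact hasSectorLimit_of_subsingleton hδ h12 h1 h2 hc1 hc2 hs
    have hfin := finite_cuttingAngles δ h1 h2
    obtain ⟨a, ha, b, hb, hab⟩ : ∃ a ∈ Ioo φ₁ φ₂ ∩ cuttingAngles δ,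
        ∃ b ∈ Ioo φ₁ φ₂ ∩ cuttingAngles δ, a < b := by
      rw [not_subsingleton_iff] at hs
      obtain ⟨a, ha, b, hb, hne⟩ := hs
      rcases lt_or_gt_of_ne hne with h | h
      · exact ⟨a, ha, b, hb, h⟩
      · exact ⟨b, hb, a, ha, h⟩
    -- The cut is made at a noncritical angle between two cutting angles, so that each half has
    -- fewer of them and the induction applies.
    obtain ⟨m, hm, hmX⟩ := ((Ioo_infinite hab).sdiff hfin).nonempty
    have h1m : φ₁ < m := ha.1.1.trans hm.1
    have hm2 : m < φ₂ := hm.2.trans hb.1.2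
    have hmc : ¬ IsCritical δ m := fun hc => hmX ⟨⟨h1m, hm2⟩, Or.inl hc⟩
    refine HasSectorLimit.trans hmc h1m hm2
      (ih _ ?_ h1m h1 (hm2.trans h2) hc1 hmc rfl) (ih _ ?_ hm2 (h1.trans h1m) h2 hmc hc2 rfl)
    · rw [← hn]
      refine ncard_lt_ncard ⟨fun t ht => ⟨⟨ht.1.1, ht.1.2.trans hm2⟩, ht.2⟩, fun h => ?_⟩ hfin
      exact lt_asymm (h hb).1.2 hm.2
    · rw [← hn]
      refine ncard_lt_ncard ⟨fun t ht => ⟨⟨h1m.trans ht.1.1, ht.1.2⟩, ht.2⟩, fun h => ?_⟩ hfin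
      exact lt_asymm (h ha).1.1 hm.1

/-! ### The group action -/

/-- The factor `(-1)^{|Λ|} e(Tr(θ, σ⁻¹[Λ]))` of `J_g(s, θ)`. -/
noncomputable def phase (g : GN N) (θ : Fin N → ℝ) : ℂ :=
  (-1) ^ g.Λ.card * e (tr θ (g.Λ.map (g.σ⁻¹).toEmbedding) : ℝ)

lemma J_eq (g : GN N) (s : ℂ) (θ : Fin N → ℝ) : J g s θ = phase g θ * (g.α : ℂ) ^ (-s) := rfl

lemma F_M (α : ℂˣ) (δ : Param N) (u : ℂ) : F u (M α δ) = F (α * u) δ := by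
  have : ∀ z : ℂ, -u * (α * z) = -(α * u) * z := fun z => by ring
  simp only [F, M, this]

lemma F_R (σ : Equiv.Perm (Fin N)) (δ : Param N) (u : ℂ) : F u (R σ δ) = F u δ := by
  simp only [F, R]
  congr 1
  exact Equiv.prod_comp σ⁻¹ fun l => (1 - e (δ.θ l) * exp (-u * δ.a l))⁻¹

lemma e_sum {ι : Type*} (S : Finset ι) (t : ι → ℝ) :
    e ((∑ l ∈ S, t l : ℝ) : ℂ) = ∏ l ∈ S, e (t l) := by
  simp only [e, ← exp_sum, ofReal_sum, Finset.mul_sum]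

/-- With x = e(θ_ℓ)e^{-u a_ℓ}, changing the signs replaces (1 - x)⁻¹ by (1 - x⁻¹)⁻¹ = -x(1 - x)⁻¹.
The exponential part of x is cancelled by the shift of w. -/
lemma F_T (Λ : Finset (Fin N)) (δ : Param N) (u : ℂ) :
    F u (T Λ δ) = (-1) ^ Λ.card * e (tr δ.θ Λ : ℝ) * F u δ := by
  classical
  have hfac : ∀ l, (1 - e ((T Λ δ).θ l) * exp (-u * (T Λ δ).a l))⁻¹ =
      (if l ∈ Λ then -1 * (e (δ.θ l) * exp (-u * δ.a l)) else 1) *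
        (1 - e (δ.θ l) * exp (-u * δ.a l))⁻¹ := by
    intro l
    by_cases hl : l ∈ Λ
    · simp only [T, sgn, hl, if_true]
      set x := e (δ.θ l) * exp (-u * δ.a l) with hx
      have hx0 : x ≠ 0 := mul_ne_zero (exp_ne_zero _) (exp_ne_zero _)
      have h1 : e ((((-1 : ℤ) : ℝ) * δ.θ l : ℝ) : ℂ) * exp (-u * (((-1 : ℤ) : ℂ) * δ.a l)) =
          x⁻¹ := by
        rw [hx, e, e, mul_inv, ← exp_neg, ← exp_neg]
        push_cast
        ring_nf
      rw [h1]
      -- At x = 1 both inverses are 0 by convention, so the identity holds at the poles as well.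
      by_cases h1x : x = 1
      · simp [h1x]
      · have h2 : 1 - x ≠ 0 := sub_ne_zero.2 (Ne.symm h1x)
        have h3 : 1 - x⁻¹ ≠ 0 := sub_ne_zero.2 fun h => h1x (by rw [← inv_inv x, ← h, inv_one])
        clear_value x
        refine inv_eq_of_mul_eq_one_right ?_
        field_simp
        ring
    · simp [T, sgn, hl]
  have hexp : exp (-u * (T Λ δ).w) = exp (-u * δ.w) * ∏ l ∈ Λ, exp (-(-u * δ.a l)) := by
    rw [← exp_sum, ← exp_add, Finset.sum_neg_distrib, ← Finset.mul_sum]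
    simp only [T, tr]
    ring_nf
  rw [F, F, hexp, Finset.prod_congr rfl fun l _ => hfac l, Finset.prod_mul_distrib,
    Finset.prod_ite_mem, Finset.univ_inter, Finset.prod_mul_distrib, Finset.prod_mul_distrib,
    Finset.prod_const, tr, e_sum]
  have h4 : (∏ l ∈ Λ, exp (-(-u * δ.a l))) * ∏ l ∈ Λ, exp (-u * δ.a l) = 1 := by
    rw [← Finset.prod_mul_distrib]
    exact Finset.prod_eq_one fun l _ => by rw [← exp_add]; simp
  linear_combination ((-1) ^ Λ.card * (∏ l ∈ Λ, e (δ.θ l)) * exp (-u * δ.w) *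
    ∏ l, (1 - e (δ.θ l) * exp (-u * δ.a l))⁻¹) * h4

lemma F_smul (g : GN N) (δ : Param N) (u : ℂ) :
    F u (g • δ) = phase g δ.θ * F (g.α * u) δ := by
  rw [smul_def, F_T, F_R, F_M, phase]
  congr 4
  simp only [tr, R, M, Finset.sum_map]
  rfl

/-- Since the inverse of 0 is 0, the function F takes the value 0 exactly at the zeros of its
denominator. Transformation rules for F thereby carry over to these zeros. -/
lemma den_eq_zero_iff_F (δ : Param N) (u : ℂ) : den δ u = 0 ↔ F u δ = 0 := by
  rw [F_eq, mul_eq_zero, or_iff_right (exp_ne_zero _), inv_eq_zero]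

lemma phase_ne_zero (g : GN N) (θ : Fin N → ℝ) : phase g θ ≠ 0 :=
  mul_ne_zero (pow_ne_zero _ (by norm_num)) (exp_ne_zero _)

lemma den_smul_eq_zero_iff (g : GN N) (δ : Param N) (u : ℂ) :
    den (g • δ) u = 0 ↔ den δ (g.α * u) = 0 := by
  rw [den_eq_zero_iff_F, den_eq_zero_iff_F, F_smul, mul_eq_zero, or_iff_right (phase_ne_zero _ _)]

/-- The two sides are compared by evaluating F at (gh)δ in two ways, at a point where it does not
vanish. -/
lemma phase_mul (g h : GN N) (δ : Param N) :
    phase (g * h) δ.θ = phase g (h • δ).θ * phase h δ.θ := by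
  obtain ⟨u, hu⟩ := (eventually_den_ne_zero ((g * h) • δ) 0).exists
  rw [Ne, den_eq_zero_iff_F] at hu
  have h1 := F_smul (g * h) δ u
  have h2 := F_smul g (h • δ) u
  rw [← mul_smul, F_smul h δ] at h2
  have h3 : ((g * h).α : ℂ) * u = h.α * (g.α * u) := by rw [mul_α]; push_cast; ring
  rw [h3] at h1
  have h4 : F (h.α * (g.α * u)) δ ≠ 0 := fun h0 => hu (by rw [h1, h0, mul_zero])
  refine mul_right_cancel₀ h4 ?_
  rw [← h1, h2, mul_assoc]

/-- For an integer exponent the power α^{-k} is multiplicative in α, whatever the branch of the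
logarithm. -/
lemma J_mul (g h : GN N) (k : ℤ) (δ : Param N) :
    J (g * h) k δ.θ = J g k (h • δ).θ * J h k δ.θ := by
  simp only [J_eq, phase_mul, mul_α, Units.val_mul, ← Int.cast_neg, cpow_intCast, mul_zpow]
  ring

lemma mem_cone_or_neg_mem_cone {z : ℂ} (hz : z ≠ 0) : z ∈ cone ↔ -z ∉ cone := by
  simp only [cone, mem_ofPred_eq, neg_re, neg_im]
  constructor
  · rintro (h | h) (h' | h') <;> linarith
  · intro h
    push Not at h
    rcases lt_trichotomy z.re 0 with h1 | h1 | h1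
    · linarith [h.1]
    · refine Or.inr ⟨h1, lt_of_le_of_ne ?_ fun h2 => hz (Complex.ext h1 h2.symm)⟩
      linarith [h.2 (by linarith)]
    · exact Or.inl h1

/-- The cone contains exactly one of a and -a for a ≠ 0. Reversing the sign of a_ℓ changes the sum
subtracted in π by -a_ℓ, which compensates the shift of w. -/
lemma proj_T (Λ : Finset (Fin N)) (δ : Param N) : proj (T Λ δ) = proj δ := by
  classical
  rw [proj_eq, proj_eq]
  change δ.w - tr δ.a Λ - _ = _
  rw [sub_sub, tr, ← Finset.sum_filter_add_sum_filter_not Finset.univ (· ∈ Λ)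
    (fun l => if -(T Λ δ).a l ∈ cone then (T Λ δ).a l else 0),
    ← Finset.sum_filter_add_sum_filter_not Finset.univ (· ∈ Λ)
    (fun l => if -δ.a l ∈ cone then δ.a l else 0), ← add_assoc, Finset.filter_mem_eq_inter,
    Finset.univ_inter, ← Finset.sum_add_distrib]
  congr 2
  · refine Finset.sum_congr rfl fun l hl => ?_
    have h1 : (T Λ δ).a l = -δ.a l := by simp [T, sgn, hl]
    rw [h1, neg_neg]
    by_cases h0 : δ.a l = 0
    · simp [h0]
    · by_cases h2 : -δ.a l ∈ cone
      · have h3 : δ.a l ∉ cone := fun h => (mem_cone_or_neg_mem_cone h0).1 h h2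
        simp [h2, h3]
      · have h3 : δ.a l ∈ cone := (mem_cone_or_neg_mem_cone h0).2 h2
        simp [h2, h3]
  · refine Finset.sum_congr rfl fun l hl => ?_
    have h1 : (T Λ δ).a l = δ.a l := by simp [T, sgn, (Finset.mem_filter.1 hl).2]
    rw [h1]

lemma proj_R (σ : Equiv.Perm (Fin N)) (δ : Param N) : proj (R σ δ) = proj δ := by
  classical
  rw [proj_eq, proj_eq]
  congr 1
  exact Equiv.sum_comp σ⁻¹ fun l => if -δ.a l ∈ cone then δ.a l else 0

lemma M_eq_smul (α : ℂˣ) (δ : Param N) : M α δ = (⟨∅, 1, α⟩ : GN N) • δ := by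
  rw [smul_def]
  ext l <;> simp [T, R, M, tr, sgn]

lemma M_smul (α : ℂˣ) (g : GN N) (δ : Param N) :
    M α (g • δ) = T g.Λ (R g.σ (M (α * g.α) δ)) := by
  rw [smul_def]
  ext l
  · simp only [M, T, R, tr, Units.val_mul, mul_sub, Finset.mul_sum, mul_assoc]
  · simp only [M, T, R, Units.val_mul]; ring
  · simp only [M, T, R]

theorem smul_mem_stableDomain (g : GN N) {δ : Param N} (hδ : δ ∈ stableDomain N) :
    g • δ ∈ stableDomain N := by
  intro α
  rw [M_smul, proj_T, proj_R]
  exact hδ _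

/-! ### Transformation of contours -/

lemma isAdmissible_iff {δ : Param N} {r : ℝ} :
    IsAdmissible δ r ↔ 0 < r ∧ ∀ u : ℂ, 0 < ‖u‖ → ‖u‖ ≤ r → den δ u ≠ 0 := by
  refine and_congr_right fun _ => ?_
  constructor
  · intro h u h0 hr hd
    obtain ⟨l, hl⟩ := (den_eq_zero_iff δ u).1 hd
    exact h l u h0 hr hl
  · intro h l u h0 hr hl
    exact h u h0 hr ((den_eq_zero_iff δ u).2 ⟨l, hl⟩)

lemma norm_α_pos (g : GN N) : 0 < ‖(g.α : ℂ)‖ := norm_pos_iff.2 g.α.ne_zero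

lemma IsAdmissible.of_smul {g : GN N} {δ : Param N} {r : ℝ} (h : IsAdmissible (g • δ) r) :
    IsAdmissible δ (‖(g.α : ℂ)‖ * r) := by
  rw [isAdmissible_iff] at h ⊢
  refine ⟨mul_pos (norm_α_pos g) h.1, fun u h0 hr hd => ?_⟩
  have hn : ‖(g.α : ℂ)⁻¹ * u‖ = ‖(g.α : ℂ)‖⁻¹ * ‖u‖ := by rw [norm_mul, norm_inv]
  refine h.2 ((g.α : ℂ)⁻¹ * u) ?_ ?_ ?_
  · rw [hn]; exact mul_pos (inv_pos.2 (norm_α_pos g)) h0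
  · rw [hn, inv_mul_le_iff₀ (norm_α_pos g)]; exact hr
  · rw [den_smul_eq_zero_iff, mul_inv_cancel_left₀ g.α.ne_zero]; exact hd

lemma α_mul (g : GN N) (x t : ℝ) :
    (g.α : ℂ) * (x * exp (t * I)) = (‖(g.α : ℂ)‖ * x : ℝ) * exp ((t + ang g : ℝ) * I) := by
  nth_rewrite 1 [← norm_mul_exp_arg_mul_I (g.α : ℂ)]
  rw [ang]
  push_cast
  rw [add_mul, exp_add]
  ring

lemma α_cpow (g : GN N) (s : ℂ) :
    (g.α : ℂ) ^ (-s) = exp (-(s * (Real.log ‖(g.α : ℂ)‖ + ang g * I))) := by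
  rw [cpow_def_of_ne_zero g.α.ne_zero, Complex.log, ang]
  ring_nf

lemma ray_smul (g : GN N) {r : ℝ} (hr : 0 < r) (φ : ℝ) (s : ℂ) (δ : Param N) :
    exp (s * φ * I) * ray r φ s (g • δ) =
      J g s δ.θ * (exp (s * (φ + ang g : ℝ) * I) * ray (‖(g.α : ℂ)‖ * r) (φ + ang g) s δ) := by
  have hα := norm_α_pos g
  have h1 := integral_comp_mul_left_Ioi
    (fun y : ℝ => F (y * exp ((φ + ang g : ℝ) * I)) δ * exp ((s - 1) * Real.log y)) r hα
  have h2 : ray (‖(g.α : ℂ)‖ * r) (φ + ang g) s δ = ‖(g.α : ℂ)‖ * ∫ x in Ioi r,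
      F ((‖(g.α : ℂ)‖ * x : ℝ) * exp ((φ + ang g : ℝ) * I)) δ *
        exp ((s - 1) * Real.log (‖(g.α : ℂ)‖ * x)) := by
    rw [h1, real_smul, ofReal_inv, mul_inv_cancel_left₀ (ofReal_ne_zero.2 hα.ne')]
    rfl
  have h3 : ∀ x ∈ Ioi r, F (x * exp (φ * I)) (g • δ) * exp ((s - 1) * Real.log x) =
      phase g δ.θ * exp (-((s - 1) * Real.log ‖(g.α : ℂ)‖)) *
        (F ((‖(g.α : ℂ)‖ * x : ℝ) * exp ((φ + ang g : ℝ) * I)) δ *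
        exp ((s - 1) * Real.log (‖(g.α : ℂ)‖ * x))) := by
    intro x hx
    have h4 : exp ((s - 1) * Real.log x) = exp (-((s - 1) * Real.log ‖(g.α : ℂ)‖)) *
        exp ((s - 1) * (Real.log ‖(g.α : ℂ)‖ + Real.log x : ℝ)) := by
      rw [← exp_add]; push_cast; ring_nf
    rw [F_smul, α_mul, Real.log_mul hα.ne' (hr.trans hx).ne', h4]
    ring
  rw [h2, ray, setIntegral_congr_fun measurableSet_Ioi h3, MeasureTheory.integral_const_mul, J_eq,
    α_cpow]
  set W := ∫ x in Ioi r, F ((‖(g.α : ℂ)‖ * x : ℝ) * exp ((φ + ang g : ℝ) * I)) δ *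
        exp ((s - 1) * Real.log (‖(g.α : ℂ)‖ * x))
  have h4 : exp (s * φ * I) * exp (-((s - 1) * Real.log ‖(g.α : ℂ)‖)) =
      exp (-(s * (Real.log ‖(g.α : ℂ)‖ + ang g * I))) * exp (s * (φ + ang g : ℝ) * I) *
        ‖(g.α : ℂ)‖ := by
    have h5 : ((‖(g.α : ℂ)‖ : ℝ) : ℂ) = exp (Real.log ‖(g.α : ℂ)‖) := by
      rw [← ofReal_exp, Real.exp_log hα]
    rw [h5, ← exp_add, ← exp_add, ← exp_add]
    push_cast
    ring_nf
  linear_combination phase g δ.θ * W * h4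

lemma arcFun_smul (g : GN N) {r : ℝ} (hr : 0 < r) (s : ℂ) (δ : Param N) (t : ℝ) :
    arcFun r s (g • δ) t = J g s δ.θ * arcFun (‖(g.α : ℂ)‖ * r) s δ (t + ang g) := by
  have hα := norm_α_pos g
  simp only [arcFun]
  rw [F_smul, α_mul, J_eq, α_cpow, Real.log_mul hα.ne' hr.ne']
  have : exp (s * (Real.log r + t * I)) = exp (-(s * (Real.log ‖(g.α : ℂ)‖ + ang g * I))) *
      exp (s * ((Real.log ‖(g.α : ℂ)‖ + Real.log r : ℝ) + (t + ang g : ℝ) * I)) := by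
    rw [← exp_add]; push_cast; ring_nf
  rw [this]
  ring

lemma integral_arcFun_smul (g : GN N) {r : ℝ} (hr : 0 < r) (s : ℂ) (δ : Param N) (a b : ℝ) :
    ∫ t in a..b, arcFun r s (g • δ) t =
      J g s δ.θ * ∫ t in (a + ang g)..(b + ang g), arcFun (‖(g.α : ℂ)‖ * r) s δ t := by
  simp only [arcFun_smul g hr]
  rw [intervalIntegral.integral_const_mul,
    integral_comp_add_right (arcFun (‖(g.α : ℂ)‖ * r) s δ) (ang g)]

/-- The substitution u ↦ αu turns the initial arc into one that starts at the angle arg α instead of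
0. The missing arc does not depend on φ and drops out of differences of contours. -/
lemma contour_smul {g : GN N} {δ : Param N} {r : ℝ} (hr : IsAdmissible (g • δ) r) (φ : ℝ)
    (s : ℂ) :
    contour r φ s (g • δ) = J g s δ.θ * (contour (‖(g.α : ℂ)‖ * r) (φ + ang g) s δ -
      I * ∫ t in (0 : ℝ)..ang g, arcFun (‖(g.α : ℂ)‖ * r) s δ t) := by
  have hi : ∀ a b : ℝ, IntervalIntegrable (arcFun (‖(g.α : ℂ)‖ * r) s δ) volume a b :=
    fun a b => (hr.of_smul.continuous_arcFun s).intervalIntegrable a b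
  have h1 := integral_add_adjacent_intervals (hi 0 (ang g)) (hi (ang g) (φ + ang g))
  rw [contour, contour, ray_smul g hr.1, integral_arcFun_smul g hr.1, ← h1, zero_add]
  ring

lemma hankel_smul (g : GN N) (δ : Param N) {r : ℝ} (hr : 0 < r) (φ : ℝ) (s : ℂ) :
    exp (s * φ * I) * hankel r s (rot φ (g • δ)) =
      J g s δ.θ * (exp (s * (φ + ang g : ℝ) * I) *
        hankel (‖(g.α : ℂ)‖ * r) s (rot (φ + ang g) δ)) := by
  rw [exp_mul_hankel_rot hr, exp_mul_hankel_rot (mul_pos (norm_α_pos g) hr), ray_smul g hr,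
    integral_arcFun_smul g hr, add_right_comm φ (2 * Real.pi)]
  ring

/-! ### Gaps between the absolute values of the poles -/

lemma exists_gap_progression (x : ℝ) {d : ℝ} (hd : 0 < d) {ℓ : ℝ} (hℓ : 0 < ℓ) :
    ∃ c > 0, ∀ X : ℝ, ∃ Y, X ≤ Y ∧ Y + c ≤ X + ℓ ∧ ∀ n : ℤ, x + n * d ∉ Icc Y (Y + c) := by
  -- A window of length m ≤ d/2 contains at most one point of the progression. If the first third
  -- contains one, the last third is free.
  set m := min ℓ (d / 2)
  have hm : 0 < m := lt_min hℓ (half_pos hd)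
  have hm1 : m ≤ ℓ := min_le_left _ _
  have hm2 : m ≤ d / 2 := min_le_right _ _
  refine ⟨m / 3, by positivity, fun X => ?_⟩
  by_cases h : ∃ n : ℤ, x + n * d ∈ Icc X (X + m / 3)
  · obtain ⟨n, hn⟩ := h
    refine ⟨X + 2 * m / 3, by linarith, by linarith, fun k hk => ?_⟩
    have h1 : 0 < (k - n : ℝ) * d := by linarith [hn.2, hk.1]
    have h2 : (k - n : ℝ) * d < 1 * d := by linarith [hn.1, hk.2]
    have h3 := pos_of_mul_pos_left h1 hd.le
    have h4 := lt_of_mul_lt_mul_right h2 hd.le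
    have h5 : (0 : ℤ) < k - n := by exact_mod_cast h3
    have h6 : k - n < (1 : ℤ) := by exact_mod_cast h4
    omega
  · push Not at h
    exact ⟨X, le_rfl, by linarith, h⟩

lemma exists_gap_progressions {ι : Type*} (S : Finset ι) (x d : ι → ℝ) (hd : ∀ i ∈ S, 0 < d i) :
    ∀ {ℓ : ℝ}, 0 < ℓ → ∃ c > 0, ∀ X : ℝ, ∃ Y, X ≤ Y ∧ Y + c ≤ X + ℓ ∧
      ∀ i ∈ S, ∀ n : ℤ, x i + n * d i ∉ Icc Y (Y + c) := by
  classical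
  induction S using Finset.induction_on with
  | empty => exact fun {ℓ} hℓ => ⟨ℓ, hℓ, fun X => ⟨X, le_rfl, le_rfl, by simp⟩⟩
  | insert i S _ ih =>
    intro ℓ hℓ
    obtain ⟨c, hc, hS⟩ := ih (fun j hj => hd j (Finset.mem_insert_of_mem hj)) hℓ
    obtain ⟨c', hc', hi⟩ := exists_gap_progression (x i) (hd i (Finset.mem_insert_self _ _)) hc
    refine ⟨c', hc', fun X => ?_⟩
    obtain ⟨Y, hXY, hYX, hY⟩ := hS X
    obtain ⟨Z, hYZ, hZY, hZ⟩ := hi Y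
    refine ⟨Z, hXY.trans hYZ, hZY.trans hYX, fun j hj n hn => ?_⟩
    rcases Finset.mem_insert.1 hj with rfl | hj
    · exact hZ n hn
    · exact hY j hj n ⟨hYZ.trans hn.1, hn.2.trans hZY⟩

/-- The absolute values |2π(θ_ℓ + n)/a_ℓ| of the zeros lie in finitely many arithmetic progressions,
two for each ℓ according to the sign of θ_ℓ + n. Gaps of a fixed length therefore recur arbitrarily
far out. -/
lemma exists_gap_zeros (δ : Param N) :
    ∃ c > 0, ∀ X : ℝ, ∃ Y, X ≤ Y ∧ ∀ u, den δ u = 0 → ‖u‖ ∉ Icc Y (Y + c) := by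
  obtain ⟨c, hc, h⟩ := exists_gap_progressions
    ((Finset.univ.filter fun l => δ.a l ≠ 0) ×ˢ (Finset.univ : Finset Bool))
    (fun p => if p.2 then 2 * Real.pi * δ.θ p.1 / ‖δ.a p.1‖
      else -(2 * Real.pi * δ.θ p.1 / ‖δ.a p.1‖))
    (fun p => 2 * Real.pi / ‖δ.a p.1‖) (fun p hp => by
      have : δ.a p.1 ≠ 0 := by simpa using hp
      have := norm_pos_iff.2 this
      positivity) one_pos
  refine ⟨c, hc, fun X => ?_⟩
  obtain ⟨Y, hXY, -, hY⟩ := h X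
  refine ⟨Y, hXY, fun u hu hn => ?_⟩
  obtain ⟨l, ha, n, hln⟩ := exists_eq_of_den_eq_zero hu
  have han := norm_pos_iff.2 ha
  have h1 : ‖u‖ = |2 * Real.pi * δ.θ l / ‖δ.a l‖ + n * (2 * Real.pi / ‖δ.a l‖)| := by
    have h2 := congrArg norm hln
    rw [show (2 * Real.pi * I * (δ.θ l + n) : ℂ) = ((2 * Real.pi * (δ.θ l + n) : ℝ) : ℂ) * I by
      push_cast; ring, norm_mul, norm_mul, norm_I, mul_one, norm_real, Real.norm_eq_abs] at h2
    have h3 : 2 * Real.pi * δ.θ l / ‖δ.a l‖ + n * (2 * Real.pi / ‖δ.a l‖) =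
        (2 * Real.pi * (δ.θ l + n)) / ‖δ.a l‖ := by ring
    rw [h3, abs_div, abs_norm, eq_div_iff han.ne', h2]
  have hmem : ∀ b : Bool, (l, b) ∈
      (Finset.univ.filter fun l => δ.a l ≠ 0) ×ˢ (Finset.univ : Finset Bool) := by
    intro b; simp [ha]
  rcases abs_choice (2 * Real.pi * δ.θ l / ‖δ.a l‖ + n * (2 * Real.pi / ‖δ.a l‖)) with h2 | h2
  · refine hY (l, true) (hmem true) n ?_
    simp only [if_true]
    rwa [← h2, ← h1]
  · refine hY (l, false) (hmem false) (-n) ?_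
    simp only [Bool.false_eq_true, if_false]
    have h3 : -(2 * Real.pi * δ.θ l / ‖δ.a l‖) + ((-n : ℤ) : ℝ) * (2 * Real.pi / ‖δ.a l‖) =
        -(2 * Real.pi * δ.θ l / ‖δ.a l‖ + n * (2 * Real.pi / ‖δ.a l‖)) := by
      push_cast; ring
    rwa [h3, ← h2, ← h1]

/-- Limits along this filter determine a function only if the filter is nontrivial, and one such c
suffices for uniqueness. The midpoint of a gap of length c separates no two poles at distance less
than c/2. -/
lemma exists_neBot_goodRadii (ψ : ℝ) (δ : Param N) :
    ∃ c > 0, (atTop ⊓ 𝓟 (goodRadii ψ δ c)).NeBot := by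
  obtain ⟨c, hc, h⟩ := exists_gap_zeros δ
  refine ⟨c / 2, by positivity, ?_⟩
  rw [inf_principal_neBot_iff]
  intro U hU
  obtain ⟨X, hX⟩ := mem_atTop_sets.1 hU
  obtain ⟨Y, hXY, hY⟩ := h X
  have key : ∀ u ∈ poles ψ δ, ‖u‖ < Y + c / 2 → ‖u‖ < Y := by
    intro u hu h1
    by_contra h2
    exact hY u (mem_poles_iff.1 hu).2.1 ⟨not_lt.1 h2, by linarith⟩
  have key2 : ∀ u ∈ poles ψ δ, ∀ v ∈ poles ψ δ, ‖u - v‖ < c / 2 →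
      ‖u‖ < Y + c / 2 → ‖v‖ < Y + c / 2 := by
    intro u hu v hv huv h1
    have h2 := key u hu h1
    have h3 := norm_sub_norm_le v u
    rw [norm_sub_rev] at h3
    linarith
  exact ⟨Y + c / 2, hX _ (by linarith), fun u hu v hv huv =>
    ⟨key2 u hu v hv huv, key2 v hv u hu (by rwa [norm_sub_rev])⟩⟩

/-! ### The function `ρ_N` as a difference of contour integrals -/

lemma eq_of_forall_re_lt_one {f g : ℂ → ℂ} (hf : Differentiable ℂ f) (hg : Differentiable ℂ g)
    (h : ∀ s : ℂ, s.re < 1 → f s = g s) : f = g := by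
  have hf' : AnalyticOnNhd ℂ f univ := fun z _ => hf.analyticAt z
  have hg' : AnalyticOnNhd ℂ g univ := fun z _ => hg.analyticAt z
  refine AnalyticOnNhd.eq_of_eventuallyEq hf' hg' (z₀ := 0) ?_
  filter_upwards [(isOpen_lt continuous_re continuous_const).mem_nhds
    (show (0 : ℂ).re < 1 by simp)] with s hs using h s hs

/-- The sector contains no poles, so its residue sums vanish and the contours agree for Re(s) < 1.
The identity theorem gives all s. -/
lemma contour_eq_of_not_isCritical {δ : Param N} (hδ : δ ∈ stableDomain N) {φ₁ φ₂ : ℝ}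
    (h12 : φ₁ < φ₂) (h1 : -Real.pi < φ₁) (h2 : φ₂ < Real.pi)
    (h : ∀ t ∈ Icc φ₁ φ₂, ¬ IsCritical δ t) {r : ℝ} (hr : IsAdmissible δ r) (s : ℂ) :
    contour r φ₁ s δ = contour r φ₂ s δ := by
  have hc1 := h φ₁ (left_mem_Icc.2 h12.le)
  have hc2 := h φ₂ (right_mem_Icc.2 h12.le)
  refine congrFun (eq_of_forall_re_lt_one (differentiable_contour hδ hc1 hr)
    (differentiable_contour hδ hc2 hr) fun s hs => ?_) s
  have hempty : sectorPoles φ₁ φ₂ δ = ∅ := eq_empty_of_forall_notMem fun u hu =>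
    h u.arg ⟨hu.2.2.1.le, hu.2.2.2.le⟩ (isCritical_arg hu.1 hu.2.1)
  have hlim := hasSectorLimit hδ h12 h1 h2 hc1 hc2 r hr s hs 1 one_pos
  have h3 : nonseparatingRadii (∅ : Set ℂ) 1 = univ := by
    ext; simp [nonseparatingRadii]
  rw [hempty, h3, principal_univ, inf_top_eq] at hlim
  have h4 : ∀ R, residueSumOn ∅ δ s R = 0 := fun R => by simp [residueSumOn]
  simp only [h4, mul_zero] at hlim
  exact (sub_eq_zero.1 (tendsto_nhds_unique hlim tendsto_const_nhds)).symm ▸ rfl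

/-- A negative angle `ω` such that no angles in `[ω, 0)` and `[ψ + ω, ψ)` are critical. -/
structure IsBaseAngle (ψ : ℝ) (δ : Param N) (ω : ℝ) : Prop where
  neg : ω < 0
  neg_pi_lt : -Real.pi < ω
  neg_pi_lt_add : -Real.pi < ψ + ω
  not_isCritical : ∀ t ∈ Ico ω 0, ¬ IsCritical δ t
  not_isCritical_add : ∀ t ∈ Ico (ψ + ω) ψ, ¬ IsCritical δ t

lemma exists_Ioo_not_isCritical (δ : Param N) (φ : ℝ) :
    ∃ a < φ, ∀ t ∈ Ioo a φ, ¬ IsCritical δ t := by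
  have h : ∀ᶠ t in 𝓝[<] φ, ¬ IsCritical δ t :=
    (eventually_not_isCritical δ φ).filter_mono (nhdsWithin_mono _ fun t ht => ne_of_lt ht)
  obtain ⟨a, ha, hsub⟩ := (mem_nhdsLT_iff_exists_Ioo_subset).1 h
  exact ⟨a, ha, fun t ht => hsub ht⟩

lemma eventually_isBaseAngle {ψ : ℝ} (hψ : -Real.pi < ψ) (δ : Param N) :
    ∀ᶠ ω in 𝓝[<] (0 : ℝ), IsBaseAngle ψ δ ω := by
  obtain ⟨a, ha, h1⟩ := exists_Ioo_not_isCritical δ 0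
  obtain ⟨b, hb, h2⟩ := exists_Ioo_not_isCritical δ ψ
  have hpi := Real.pi_pos
  filter_upwards [Ioo_mem_nhdsLT ha, Ioo_mem_nhdsLT (sub_neg.2 hb),
    Ioo_mem_nhdsLT (neg_neg_of_pos hpi),
    Ioo_mem_nhdsLT (show -Real.pi - ψ < 0 by linarith)] with ω h3 h4 h5 h6
  exact ⟨h3.2, h5.1, by linarith [h6.1], fun t ht => h1 t ⟨h3.1.trans_le ht.1, ht.2⟩,
    fun t ht => h2 t ⟨by linarith [h4.1, ht.1], ht.2⟩⟩

lemma IsBaseAngle.not_isCritical_self {ψ : ℝ} {δ : Param N} {ω : ℝ} (h : IsBaseAngle ψ δ ω) :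
    ¬ IsCritical δ ω := h.not_isCritical ω ⟨le_rfl, h.neg⟩

lemma IsBaseAngle.not_isCritical_add_self {ψ : ℝ} {δ : Param N} {ω : ℝ}
    (h : IsBaseAngle ψ δ ω) : ¬ IsCritical δ (ψ + ω) :=
  h.not_isCritical_add _ ⟨le_rfl, by linarith [h.neg]⟩

/-- Turning the half-open sector by ω neither gains nor loses a pole, since the angles swept over at
both ends are not critical. The turned sector has noncritical sides and avoids the negative real
axis even if ψ = π. -/
lemma IsBaseAngle.tendsto_residueSum {ψ : ℝ} (hψ : ψ ≤ Real.pi) {δ : Param N}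
    (hδ : δ ∈ stableDomain N) {ω : ℝ} (h : IsBaseAngle ψ δ ω) {r : ℝ} (hr : IsAdmissible δ r)
    {s : ℂ} (hs : s.re < 1) {c : ℝ} (hc : 0 < c) :
    Tendsto (residueSum ψ δ s) (atTop ⊓ 𝓟 (goodRadii ψ δ c))
      (𝓝 (contour r (ψ + ω) s δ - contour r ω s δ)) := by
  have hω := h.neg
  have hpi := Real.pi_pos
  rcases lt_trichotomy ψ 0 with hψ0 | hψ0 | hψ0
  · have hpoles : poles ψ δ = sectorPoles (ψ + ω) ω δ := by
      ext u
      rw [mem_poles_iff]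
      constructor
      · rintro ⟨h0, hd, ⟨h1, -, -⟩ | ⟨-, h1, h2⟩⟩
        · linarith
        · refine ⟨h0, hd, by linarith, lt_of_not_ge fun h3 => ?_⟩
          exact h.not_isCritical _ ⟨h3, h2⟩ (isCritical_arg h0 hd)
      · rintro ⟨h0, hd, h1, h2⟩
        refine ⟨h0, hd, Or.inr ⟨hψ0, le_of_not_gt fun h3 => ?_, by linarith⟩⟩
        exact h.not_isCritical_add _ ⟨h1.le, h3⟩ (isCritical_arg h0 hd)
    have key := hasSectorLimit hδ (show ψ + ω < ω by linarith) h.neg_pi_lt_add (by linarith)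
      h.not_isCritical_add_self h.not_isCritical_self r hr s hs c hc
    rw [← hpoles] at key
    refine key.congr fun R => ?_
    rw [residueSum, Real.sign_of_pos (neg_pos.2 hψ0), ofReal_one, one_mul]
    rfl
  · subst hψ0
    have hpoles : poles 0 δ = ∅ := by
      ext u
      rw [mem_poles_iff]
      simp
    have h0 : ∀ R, residueSum 0 δ s R = 0 := fun R => by simp [residueSum]
    rw [zero_add, sub_self]
    exact tendsto_const_nhds.congr fun R => (h0 R).symm
  · have hpoles : poles ψ δ = sectorPoles ω (ψ + ω) δ := by
      ext u
      rw [mem_poles_iff]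
      constructor
      · rintro ⟨h0, hd, ⟨-, h1, h2⟩ | ⟨h1, -, -⟩⟩
        · refine ⟨h0, hd, by linarith, lt_of_not_ge fun h3 => ?_⟩
          exact h.not_isCritical_add _ ⟨h3, h2⟩ (isCritical_arg h0 hd)
        · linarith
      · rintro ⟨h0, hd, h1, h2⟩
        refine ⟨h0, hd, Or.inl ⟨hψ0, le_of_not_gt fun h3 => ?_, by linarith⟩⟩
        exact h.not_isCritical _ ⟨h1.le, h3⟩ (isCritical_arg h0 hd)
    have key := (hasSectorLimit hδ (show ω < ψ + ω by linarith) h.neg_pi_lt (by linarith)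
      h.not_isCritical_self h.not_isCritical_add_self r hr s hs c hc).neg
    rw [← hpoles, neg_sub] at key
    refine key.congr fun R => ?_
    rw [residueSum, Real.sign_of_neg (neg_neg_of_pos hψ0), ofReal_neg, ofReal_one, neg_one_mul,
      neg_mul]
    rfl

lemma IsBaseAngle.isRho {ψ : ℝ} (hψ : ψ ≤ Real.pi) {δ : Param N} (hδ : δ ∈ stableDomain N)
    {ω : ℝ} (h : IsBaseAngle ψ δ ω) {r : ℝ} (hr : IsAdmissible δ r) :
    IsRho ψ δ fun s => contour r (ψ + ω) s δ - contour r ω s δ := by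
  have hd : Differentiable ℂ fun s => contour r (ψ + ω) s δ - contour r ω s δ :=
    (differentiable_contour hδ h.not_isCritical_add_self hr).sub
      (differentiable_contour hδ h.not_isCritical_self hr)
  have ha : AnalyticOnNhd ℂ (fun s => contour r (ψ + ω) s δ - contour r ω s δ) univ :=
    fun s _ => hd.analyticAt s
  exact ⟨ha.meromorphicNFOn, fun s _ => ha s (mem_univ s),
    fun s hs c hc => h.tendsto_residueSum hψ hδ hr hs hc⟩

lemma finite_PN (N : ℕ) : (PN N).Finite := by
  refine ((finite_Icc 1 N).image fun n : ℕ => (n : ℂ)).subset ?_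
  rintro s ⟨n, h1, h2, rfl⟩
  exact ⟨n, ⟨h1, h2⟩, rfl⟩

/-- Both functions are the same limit for Re(s) < 1, hence agree on the complement of P_N, which is
connected. At the points of P_N the normal form fixes the value. -/
lemma IsRho.unique {ψ : ℝ} {δ : Param N} {ρ ρ' : ℂ → ℂ} (h : IsRho ψ δ ρ) (h' : IsRho ψ δ ρ') :
    ρ = ρ' := by
  obtain ⟨c, hc, hne⟩ := exists_neBot_goodRadii ψ δ
  have h1 : ∀ s : ℂ, s.re < 1 → ρ s = ρ' s := fun s hs =>
    tendsto_nhds_unique (h.limit s hs c hc) (h'.limit s hs c hc)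
  have hconn : IsPreconnected (PN N)ᶜ :=
    ((finite_PN N).countable.isConnected_compl_of_one_lt_rank
      (by rw [rank_real_complex]; exact_mod_cast Nat.one_lt_two)).isPreconnected
  have h0 : (0 : ℂ) ∈ (PN N)ᶜ := by
    rintro ⟨n, hn, -, h⟩
    have : n = 0 := by exact_mod_cast h.symm
    omega
  have heq : EqOn ρ ρ' (PN N)ᶜ := by
    refine h.holomorphic.eqOn_of_preconnected_of_eventuallyEq h'.holomorphic hconn h0 ?_
    filter_upwards [(isOpen_lt continuous_re continuous_const).mem_nhds
      (show (0 : ℂ).re < 1 by simp)] with s hs using h1 s hs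
  ext s
  have hev : ρ =ᶠ[𝓝[≠] s] ρ' := by
    have : ((PN N) \ {s})ᶜ ∈ 𝓝 s := ((finite_PN N).sdiff).isClosed.isOpen_compl.mem_nhds (by simp)
    filter_upwards [nhdsWithin_le_nhds this, self_mem_nhdsWithin] with z hz hzs
    exact heq fun hzP => hz ⟨hzP, hzs⟩
  exact ((MeromorphicNFAt.eventuallyEq_nhdsNE_iff_eventuallyEq_nhds
    (h.meromorphic (mem_univ s)) (h'.meromorphic (mem_univ s))).1 hev).eq_of_nhds

theorem existsUnique_isRho {ψ : ℝ} (hψ : ψ ∈ Ioc (-Real.pi) Real.pi) {δ : Param N}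
    (hδ : δ ∈ stableDomain N) : ∃! ρ : ℂ → ℂ, IsRho ψ δ ρ := by
  obtain ⟨ω, hω⟩ := (eventually_isBaseAngle hψ.1 δ).exists
  obtain ⟨r, hr⟩ := exists_isAdmissible δ
  exact ⟨_, hω.isRho hψ.2 hδ hr, fun ρ hρ => hρ.unique (hω.isRho hψ.2 hδ hr)⟩

lemma IsBaseAngle.rho_eq {ψ : ℝ} (hψ : ψ ≤ Real.pi) {δ : Param N} (hδ : δ ∈ stableDomain N)
    {ω : ℝ} (h : IsBaseAngle ψ δ ω) {r : ℝ} (hr : IsAdmissible δ r) (s : ℂ) :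
    rho ψ δ s = contour r (ψ + ω) s δ - contour r ω s δ := by
  have h1 := h.isRho hψ hδ hr
  have h2 : IsRho ψ δ (rho ψ δ) := Classical.epsilon_spec ⟨_, h1⟩
  exact congrFun (h2.unique h1) s

lemma differentiable_rho {ψ : ℝ} (hψ : ψ ∈ Ioc (-Real.pi) Real.pi) {δ : Param N}
    (hδ : δ ∈ stableDomain N) : Differentiable ℂ (rho ψ δ) := by
  obtain ⟨ω, hω⟩ := (eventually_isBaseAngle hψ.1 δ).exists
  obtain ⟨r, hr⟩ := exists_isAdmissible δ
  rw [show rho ψ δ = fun s => contour r (ψ + ω) s δ - contour r ω s δ from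
    funext fun s => hω.rho_eq hψ.2 hδ hr s]
  exact (differentiable_contour hδ hω.not_isCritical_add_self hr).sub
    (differentiable_contour hδ hω.not_isCritical_self hr)

lemma ang_mem (g : GN N) : ang g ∈ Ioc (-Real.pi) Real.pi := arg_mem_Ioc _

/-! ### Circles around the origin -/

lemma circleIntegral_F (r : ℝ) (hr : 0 < r) (k : ℤ) (δ : Param N) :
    (∮ z in C(0, r), F z δ * z ^ (k - 1)) =
      I * ∫ t in (0 : ℝ)..(2 * Real.pi), arcFun r k δ t := by
  rw [circleIntegral, ← intervalIntegral.integral_const_mul]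
  refine integral_congr fun t _ => ?_
  simp only [deriv_circleMap, smul_eq_mul, arcFun, circleMap_zero]
  have hne : (r * exp (t * I) : ℂ) ≠ 0 :=
    mul_ne_zero (ofReal_ne_zero.2 hr.ne') (exp_ne_zero _)
  have h1 : exp (k * (Real.log r + t * I)) = (r * exp (t * I) : ℂ) ^ k := by
    rw [exp_int_mul, exp_log_add hr]
  have hr0 : (r : ℂ) ≠ 0 := ofReal_ne_zero.2 hr.ne'
  rw [h1, zpow_sub_one₀ hne]
  field_simp

lemma IsAdmissible.circleIntegral_eq {δ : Param N} {r r' : ℝ} (hr : IsAdmissible δ r)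
    (hr' : 0 < r') (hle : r' ≤ r) (k : ℤ) :
    (∮ z in C(0, r), F z δ * z ^ (k - 1)) = ∮ z in C(0, r'), F z δ * z ^ (k - 1) := by
  have hd : ∀ z ∈ Metric.closedBall (0 : ℂ) r \ Metric.ball 0 r',
      DifferentiableAt ℂ (fun z => F z δ * z ^ (k - 1)) z := by
    intro z hz
    have hz1 : ‖z‖ ≤ r := by simpa using hz.1
    have hz2 : r' ≤ ‖z‖ := by simpa using hz.2
    have hz0 : 0 < ‖z‖ := hr'.trans_le hz2
    have h1 := (isAdmissible_iff.1 hr).2 z hz0 hz1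
    exact (analyticAt_F h1).differentiableAt.mul
      (differentiableAt_zpow.2 (Or.inl (norm_pos_iff.1 hz0)))
  refine circleIntegral_eq_of_differentiable_on_annulus_off_countable hr' hle countable_empty
    (fun z hz => (hd z hz).continuousAt.continuousWithinAt) fun z hz => hd z ?_
  exact ⟨Metric.ball_subset_closedBall hz.1.1,
    fun h => hz.1.2 (Metric.ball_subset_closedBall h)⟩

lemma IsAdmissible.laurentCoeff_eq {δ : Param N} {r : ℝ} (hr : IsAdmissible δ r) (k : ℤ) :
    laurentCoeff (fun u => F u δ) 0 (-k) =
      (2 * Real.pi : ℂ)⁻¹ * ∫ t in (0 : ℝ)..(2 * Real.pi), arcFun r k δ t := by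
  refine Tendsto.limUnder_eq (tendsto_const_nhds.congr' ?_)
  filter_upwards [Ioo_mem_nhdsGT hr.1] with ρ hρ
  simp only [neg_neg, sub_zero]
  rw [← hr.circleIntegral_eq hρ.1 hρ.2.le, circleIntegral_F r hr.1]
  have hpi : (Real.pi : ℂ) ≠ 0 := ofReal_ne_zero.2 Real.pi_ne_zero
  field_simp

lemma exists_tendsto_mul_factor_inv (δ : Param N) (l : Fin N) :
    ∃ v, Tendsto (fun u : ℂ => u * (1 - e (δ.θ l) * exp (-u * δ.a l))⁻¹) (𝓝[≠] 0) (𝓝 v) := by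
  set D : ℂ → ℂ := fun u => 1 - e (δ.θ l) * exp (-u * δ.a l) with hD
  have hd : HasDerivAt D (e (δ.θ l) * δ.a l) 0 := by
    have := (((((hasDerivAt_id (0 : ℂ)).neg).mul_const (δ.a l)).cexp).const_mul
      (e (δ.θ l))).const_sub 1
    refine this.congr_deriv ?_
    simp
  by_cases h0 : D 0 = 0
  · have ha : δ.a l ≠ 0 := a_ne_zero_of_zero δ (factor_eq_zero_iff.1 h0)
    have h1 := hasDerivAt_iff_tendsto_slope.1 hd
    refine ⟨(e (δ.θ l) * δ.a l)⁻¹,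
      (h1.inv₀ (mul_ne_zero (exp_ne_zero _) ha)).congr fun u => ?_⟩
    rw [slope_def_field, h0, sub_zero, sub_zero, inv_div, div_eq_mul_inv]
  · have h1 : ContinuousAt (fun u : ℂ => u * (D u)⁻¹) 0 :=
      continuousAt_id.mul (hd.continuousAt.inv₀ h0)
    exact ⟨_, h1.tendsto.mono_left nhdsWithin_le_nhds⟩

lemma exists_tendsto_F_mul_pow (δ : Param N) :
    ∃ v, Tendsto (fun u : ℂ => F u δ * u ^ N) (𝓝[≠] 0) (𝓝 v) := by
  choose v hv using exists_tendsto_mul_factor_inv δ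
  have h1 : Tendsto (fun u : ℂ => exp (-u * δ.w)) (𝓝[≠] 0) (𝓝 (exp (-0 * δ.w))) := by
    have : Continuous fun u : ℂ => exp (-u * δ.w) := by fun_prop
    exact (this.tendsto 0).mono_left nhdsWithin_le_nhds
  refine ⟨_, (h1.mul (tendsto_finsetProd Finset.univ fun l _ => hv l)).congr fun u => ?_⟩
  rw [Finset.prod_mul_distrib, Finset.prod_const, Finset.card_univ, Fintype.card_fin, F]
  ring

/-- Each factor of F has at most a simple pole at 0, so F(u, δ)u^{n-1} is bounded near 0 when n > N.
The circle integral does not depend on the radius and tends to 0 as the circle shrinks. -/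
lemma IsAdmissible.integral_arcFun_eq_zero {δ : Param N} {r : ℝ} (hr : IsAdmissible δ r) {n : ℕ}
    (hn : N < n) : ∫ t in (0 : ℝ)..(2 * Real.pi), arcFun r n δ t = 0 := by
  obtain ⟨v, hv⟩ := exists_tendsto_F_mul_pow δ
  obtain ⟨m, rfl⟩ := Nat.exists_eq_add_of_lt hn
  have h1 : Tendsto (fun u : ℂ => F u δ * u ^ (((N + m + 1 : ℕ) : ℤ) - 1)) (𝓝[≠] 0)
      (𝓝 (v * 0 ^ m)) := by
    have hp : Tendsto (fun u : ℂ => u ^ m) (𝓝[≠] 0) (𝓝 (0 ^ m)) :=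
      ((continuous_pow m).tendsto 0).mono_left nhdsWithin_le_nhds
    refine (hv.mul hp).congr fun u => ?_
    rw [mul_assoc, ← pow_add, show (((N + m + 1 : ℕ) : ℤ) - 1) = ((N + m : ℕ) : ℤ) by push_cast; ring,
      zpow_natCast]
  have h2 := h1.norm.eventually_lt_const (lt_add_one _)
  rw [eventually_nhdsWithin_iff, Metric.eventually_nhds_iff] at h2
  obtain ⟨ρ, hρ, hb⟩ := h2
  set Mb := ‖v * 0 ^ m‖ + 1
  have hMb : 0 ≤ Mb := by positivity
  have hconst : ∀ᶠ x in 𝓝[>] (0 : ℝ),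
      ‖∮ z in C(0, r), F z δ * z ^ (((N + m + 1 : ℕ) : ℤ) - 1)‖ ≤ 2 * Real.pi * x * Mb := by
    filter_upwards [Ioo_mem_nhdsGT hr.1, Ioo_mem_nhdsGT hρ] with x hx hx'
    rw [hr.circleIntegral_eq hx.1 hx.2.le]
    refine circleIntegral.norm_integral_le_of_norm_le_const hx.1.le fun z hz => ?_
    have hz' : ‖z‖ = x := by simpa using hz
    refine (hb (y := z) (by rw [dist_zero_right, hz']; exact hx'.2) ?_).le
    exact norm_pos_iff.1 (by rw [hz']; exact hx.1)
  have hlim : Tendsto (fun x : ℝ => 2 * Real.pi * x * Mb) (𝓝[>] 0) (𝓝 (2 * Real.pi * 0 * Mb)) := by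
    have : Continuous fun x : ℝ => 2 * Real.pi * x * Mb := by fun_prop
    exact (this.tendsto 0).mono_left nhdsWithin_le_nhds
  have h3 := ge_of_tendsto hlim hconst
  rw [mul_zero, zero_mul] at h3
  have h4 := norm_le_zero_iff.1 h3
  rw [circleIntegral_F r hr.1, mul_eq_zero, or_iff_right I_ne_zero] at h4
  exact_mod_cast h4

/-! ### The function `𝓛_N` -/

lemma differentiable_hankel {δ : Param N} (hδ : δ ∈ stableDomain N) {φ : ℝ}
    (hφ : ¬ IsCritical δ φ) {r : ℝ} (hr : IsAdmissible δ r) :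
    Differentiable ℂ fun s => hankel r s (rot φ δ) := by
  have h : ∀ s, hankel r s (rot φ δ) = exp (-(s * φ * I)) * ((e s - 1) * contour r φ s δ +
      I * ∫ t in (0 : ℝ)..(2 * Real.pi), arcFun r s δ t) := by
    intro s
    rw [← exp_mul_hankel_rot_eq_contour hr, ← mul_assoc, ← exp_add, neg_add_cancel, exp_zero,
      one_mul]
  simp only [h, e]
  have h1 := differentiable_contour hδ hφ hr
  have h2 := differentiable_arcIntegral hr 0 (2 * Real.pi)
  fun_prop

lemma hasDerivAt_e (s : ℂ) : HasDerivAt e (e s * (2 * Real.pi * I)) s := by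
  have h : HasDerivAt (fun x => exp (2 * Real.pi * I * x))
      (exp (2 * Real.pi * I * s) * (2 * Real.pi * I)) s := by
    simpa using ((hasDerivAt_id s).const_mul (2 * Real.pi * I : ℂ)).cexp
  exact h

lemma e_intCast (n : ℤ) : e n = 1 := by
  rw [e, exp_eq_one_iff]
  exact ⟨n, by ring⟩

lemma e_eq_one_iff {s : ℂ} : e s = 1 ↔ ∃ n : ℤ, s = n := by
  constructor
  · intro h
    rw [e, exp_eq_one_iff] at h
    obtain ⟨n, hn⟩ := h
    exact ⟨n, mul_left_cancel₀ two_pi_I_ne_zero (by rw [hn]; ring)⟩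
  · rintro ⟨n, rfl⟩
    exact e_intCast n

lemma eventually_e_ne_one (s : ℂ) : ∀ᶠ z in 𝓝[≠] s, e z - 1 ≠ 0 := by
  have hd : HasDerivAt (fun z => e z - 1) (e s * (2 * Real.pi * I)) s :=
    (hasDerivAt_e s).sub_const 1
  exact hd.eventually_ne (mul_ne_zero (exp_ne_zero _) two_pi_I_ne_zero)

/-- The simple zeros of e(z) - 1 at integers outside P_N are compensated: at n ≤ 0 by the zeros of
1/Γ, and at n > N because the Hankel integral reduces there to a full circle integral, which
vanishes. -/
lemma exists_tendsto_hankel {δ : Param N} (hδ : δ ∈ stableDomain N) {φ : ℝ}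
    (hφ : ¬ IsCritical δ φ) {r : ℝ} (hr : IsAdmissible δ r) {s : ℂ} (hs : s ∉ PN N) :
    ∃ v, Tendsto (fun z => (Gamma z * (e z - 1))⁻¹ * hankel r z (rot φ δ)) (𝓝[≠] s) (𝓝 v) := by
  set Q : ℂ → ℂ := fun z => (Gamma z)⁻¹ * hankel r z (rot φ δ) with hQ
  have hQd : Differentiable ℂ Q := differentiable_one_div_Gamma.mul (differentiable_hankel hδ hφ hr)
  have heq : ∀ z, (Gamma z * (e z - 1))⁻¹ * hankel r z (rot φ δ) = Q z * (e z - 1)⁻¹ := by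
    intro z; rw [hQ, mul_inv]; ring
  simp only [heq]
  by_cases he : e s = 1
  · obtain ⟨n, rfl⟩ := e_eq_one_iff.1 he
    have hQ0 : Q n = 0 := by
      rcases lt_or_ge 0 n with hn | hn
      · lift n to ℕ using hn.le
        have hnN : N < n := by
          by_contra hle
          exact hs ⟨n, by exact_mod_cast hn, not_lt.1 hle, by push_cast; rfl⟩
        have h1 := exp_mul_hankel_rot_eq_contour hr φ ((n : ℤ) : ℂ)
        rw [he, sub_self, zero_mul, zero_add, Int.cast_natCast, hr.integral_arcFun_eq_zero hnN,
          mul_zero, mul_eq_zero, or_iff_right (exp_ne_zero _)] at h1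
        rw [hQ]
        simp only [Int.cast_natCast, h1, mul_zero]
      · obtain ⟨m, rfl⟩ := Int.exists_eq_neg_ofNat hn
        rw [hQ]
        simp only [Int.cast_neg, Int.cast_natCast, Gamma_neg_nat_eq_zero, inv_zero, zero_mul]
    have h1 := hasDerivAt_iff_tendsto_slope.1 (hQd (n : ℂ)).hasDerivAt
    have h2 := hasDerivAt_iff_tendsto_slope.1 (hasDerivAt_e (n : ℂ))
    have h3 : e (n : ℂ) * (2 * Real.pi * I) ≠ 0 := mul_ne_zero (exp_ne_zero _) two_pi_I_ne_zero
    refine ⟨_, (h1.mul (h2.inv₀ h3)).congr' ?_⟩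
    filter_upwards [self_mem_nhdsWithin] with z hz
    have hzn : z - n ≠ 0 := sub_ne_zero.2 hz
    rw [slope_def_field, slope_def_field, hQ0, he, sub_zero, inv_div]
    field_simp
  · have h1 : ContinuousAt (fun z => Q z * (e z - 1)⁻¹) s :=
      hQd.continuous.continuousAt.mul
        ((((hasDerivAt_e s).continuousAt).sub continuousAt_const).inv₀ (sub_ne_zero.2 he))
    exact ⟨_, h1.tendsto.mono_left nhdsWithin_le_nhds⟩

lemma isAdmissible_of_rot {δ : Param N} {ω r : ℝ} (h : IsAdmissible (rot ω δ) r) :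
    IsAdmissible δ r := by
  have h1 : rot ω δ = (⟨∅, 1, Units.mk0 (exp (ω * I)) (exp_ne_zero _)⟩ : GN N) • δ :=
    M_eq_smul _ _
  rw [h1] at h
  have := h.of_smul
  rwa [Units.val_mk0, norm_exp_ofReal_mul_I, one_mul] at this

lemma radii_rot {ε : Param N → ℝ} (hε : ε ∈ radii N) (ω : ℝ) (δ : Param N) :
    IsAdmissible δ (ε (rot ω δ)) :=
  isAdmissible_of_rot (isAdmissible_of_radii hε (rot ω δ))

/-- For ω < 0 near 0 the contour does not depend on ω and the Hankel integral does not depend on the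
radius. So the formula varies with ω only through the factor e^{-isω}. -/
lemma exists_tendsto_LFormula {δ : Param N} (hδ : δ ∈ stableDomain N) {s : ℂ} (hs : s ∉ PN N) :
    ∃ v, ∀ ε ∈ radii N, ∀ᶠ ω in 𝓝[<] (0 : ℝ),
      Tendsto (fun z => LFormula ε z (rot ω δ)) (𝓝[≠] s) (𝓝 (exp (-(s * ω * I)) * v)) := by
  obtain ⟨r, hr⟩ := exists_isAdmissible δ
  obtain ⟨ω₀, h₀⟩ := (eventually_isBaseAngle (neg_neg_of_pos Real.pi_pos) δ (ψ := 0)).exists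
  obtain ⟨v, hv⟩ := exists_tendsto_hankel hδ h₀.not_isCritical_self hr hs
  refine ⟨exp (s * ω₀ * I) * v, fun ε hε => ?_⟩
  filter_upwards [Ioo_mem_nhdsLT h₀.neg] with ω hω
  have hωc : ¬ IsCritical δ ω := h₀.not_isCritical ω ⟨hω.1.le, hω.2⟩
  have hK : ∀ z, contour r ω₀ z δ = contour r ω z δ := fun z =>
    contour_eq_of_not_isCritical hδ hω.1 h₀.neg_pi_lt (hω.2.trans Real.pi_pos)
      (fun t ht => h₀.not_isCritical t ⟨ht.1, ht.2.trans_lt hω.2⟩) hr z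
  have heq : ∀ z, LFormula ε z (rot ω δ) = exp (-(z * ω * I)) * (exp (z * ω₀ * I) *
      ((Gamma z * (e z - 1))⁻¹ * hankel r z (rot ω₀ δ))) := by
    intro z
    have h1 := exp_mul_hankel_rot_eq_contour hr ω₀ z
    rw [hK z, ← exp_mul_hankel_rot_eq_contour hr ω z] at h1
    rw [LFormula, hankel_rot_eq hδ hωc (radii_rot hε ω δ) hr z, mul_left_comm (exp (z * ω₀ * I)),
      h1, mul_left_comm (exp (-(z * ω * I))), ← mul_assoc (exp (-(z * ω * I))), ← exp_add,
      neg_add_cancel, exp_zero, one_mul]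
  simp only [heq]
  have hc : ∀ x : ℝ, Tendsto (fun z : ℂ => exp (z * x * I)) (𝓝[≠] s) (𝓝 (exp (s * x * I))) := by
    intro x
    have : Continuous fun z : ℂ => exp (z * x * I) := by fun_prop
    exact (this.tendsto s).mono_left nhdsWithin_le_nhds
  have hc' : Tendsto (fun z : ℂ => exp (-(z * ω * I))) (𝓝[≠] s) (𝓝 (exp (-(s * ω * I)))) := by
    have : Continuous fun z : ℂ => exp (-(z * ω * I)) := by fun_prop
    exact (this.tendsto s).mono_left nhdsWithin_le_nhds
  exact hc'.mul ((hc ω₀).mul hv)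

lemma tendsto_LEps_of_tendsto_LFormula {δ : Param N} {s v : ℂ} {ε : Param N → ℝ}
    (h : ∀ᶠ ω in 𝓝[<] (0 : ℝ),
      Tendsto (fun z => LFormula ε z (rot ω δ)) (𝓝[≠] s) (𝓝 (exp (-(s * ω * I)) * v))) :
    Tendsto (fun ω => LEps ε s (rot ω δ)) (𝓝[<] (0 : ℝ)) (𝓝 v) := by
  have h1 : Tendsto (fun ω : ℝ => exp (-(s * ω * I)) * v) (𝓝[<] 0) (𝓝 v) := by
    have hc : Continuous fun ω : ℝ => exp (-(s * ω * I)) * v := by fun_prop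
    have := (hc.tendsto 0).mono_left (nhdsWithin_le_nhds (s := Iio 0))
    simpa using this
  refine h1.congr' ?_
  filter_upwards [h] with ω hω using hω.limUnder_eq.symm

theorem tendsto_LFormula {δ : Param N} (hδ : δ ∈ stableDomain N) {s : ℂ} (hs : s ∉ PN N)
    {ε : Param N → ℝ} (hε : ε ∈ radii N) : ∀ᶠ ω in 𝓝[<] (0 : ℝ),
      Tendsto (fun z => LFormula ε z (rot ω δ)) (𝓝[≠] s) (𝓝 (exp (-(s * ω * I)) * L s δ)) := by
  obtain ⟨v, hv⟩ := exists_tendsto_LFormula hδ hs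
  have hL : L s δ = v :=
    (tendsto_LEps_of_tendsto_LFormula (hv _ (radii_nonempty N).some_mem)).limUnder_eq
  rw [hL]
  exact hv ε hε

theorem tendsto_LEps {δ : Param N} (hδ : δ ∈ stableDomain N) {s : ℂ} (hs : s ∉ PN N)
    {ε : Param N → ℝ} (hε : ε ∈ radii N) :
    Tendsto (fun ω => LEps ε s (rot ω δ)) (𝓝[<] (0 : ℝ)) (𝓝 (L s δ)) :=
  tendsto_LEps_of_tendsto_LFormula (tendsto_LFormula hδ hs hε)

/-- The identity is checked at one fixed small ω < 0 and for z near s with e(z) ≠ 1, where the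
full-circle terms cancel in the difference of Hankel integrals. The limit z → s then includes the
integers. -/
theorem L_smul (g : GN N) {δ : Param N} (hδ : δ ∈ stableDomain N) {s : ℂ} (hs : s ∉ PN N) :
    L s (g • δ) = J g s δ.θ * (L s δ + rho (ang g) δ s / Gamma s) := by
  obtain ⟨ε, hε⟩ := radii_nonempty N
  have hψ := ang_mem g
  obtain ⟨ω, ⟨h1, h2⟩, hω⟩ := (((tendsto_LFormula (smul_mem_stableDomain g hδ) hs hε).and
    (tendsto_LFormula hδ hs hε)).and (eventually_isBaseAngle hψ.1 δ)).exists
  -- This is the radius into which multiplication by α transforms the circle used for gδ.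
  set r := ‖(g.α : ℂ)‖ * ε (rot ω (g • δ))
  have hr' : IsAdmissible (g • δ) (ε (rot ω (g • δ))) := radii_rot hε ω _
  have hr : IsAdmissible δ r := hr'.of_smul
  have hc : Tendsto (fun z : ℂ => exp (z * ω * I)) (𝓝[≠] s) (𝓝 (exp (s * ω * I))) := by
    have : Continuous fun z : ℂ => exp (z * ω * I) := by fun_prop
    exact (this.tendsto s).mono_left nhdsWithin_le_nhds
  have hJ : Tendsto (fun z => J g z δ.θ) (𝓝[≠] s) (𝓝 (J g s δ.θ)) := by
    have : Continuous fun z => J g z δ.θ := by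
      simp only [J_eq, α_cpow]
      fun_prop
    exact (this.tendsto s).mono_left nhdsWithin_le_nhds
  have hρ : Tendsto (fun z => rho (ang g) δ z * (Gamma z)⁻¹) (𝓝[≠] s)
      (𝓝 (rho (ang g) δ s * (Gamma s)⁻¹)) :=
    (((differentiable_rho hψ hδ).mul differentiable_one_div_Gamma).continuous.tendsto s).mono_left
      nhdsWithin_le_nhds
  have hl := hc.mul h1
  have hrr := hJ.mul ((hc.mul h2).add hρ)
  have heq : (fun z => exp (z * ω * I) * LFormula ε z (rot ω (g • δ))) =ᶠ[𝓝[≠] s] fun z =>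
      J g z δ.θ * (exp (z * ω * I) * LFormula ε z (rot ω δ) +
        rho (ang g) δ z * (Gamma z)⁻¹) := by
    filter_upwards [eventually_e_ne_one s] with z hz
    have e1 := hankel_smul g δ hr'.1 ω z
    have e2 := exp_mul_hankel_rot_eq_contour hr (ω + ang g) z
    have e3 := exp_mul_hankel_rot_eq_contour hr ω z
    have e4 := hω.rho_eq hψ.2 hδ hr z
    rw [add_comm (ang g) ω] at e4
    rw [LFormula, LFormula, hankel_rot_eq hδ hω.not_isCritical_self (radii_rot hε ω δ) hr z,
      mul_left_comm, e1, e2, mul_left_comm (exp (z * ω * I)), e3, e4, mul_inv]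
    have e5 : (e z - 1)⁻¹ * (e z - 1) = 1 := inv_mul_cancel₀ hz
    linear_combination (J g z δ.θ * (Gamma z)⁻¹ *
      (contour r (ω + ang g) z δ - contour r ω z δ)) * e5
  have hfin := tendsto_nhds_unique (hl.congr' heq) hrr
  rw [← mul_assoc, ← mul_assoc, ← exp_add, add_neg_cancel, exp_zero, one_mul, one_mul] at hfin
  rw [hfin, div_eq_mul_inv]

/-! ### Values at integers -/

/-- For an integer k the integrand is single-valued, so the ray is unchanged and only m full circles
are added. -/
lemma contour_add_two_pi_mul {δ : Param N} {r : ℝ} (hr : IsAdmissible δ r) (φ : ℝ) (k m : ℤ) :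
    contour r (φ + m * (2 * Real.pi)) k δ = contour r φ k δ +
      I * (m * ∫ t in (0 : ℝ)..(2 * Real.pi), arcFun r k δ t) := by
  have hi : ∀ a b : ℝ, IntervalIntegrable (arcFun r k δ) volume a b := fun a b =>
    (hr.continuous_arcFun k).intervalIntegrable a b
  have hper : Function.Periodic (arcFun r k δ) (2 * Real.pi) := fun t => by
    rw [arcFun_add_two_pi, e_intCast, one_mul]
  have h1 := hper.intervalIntegral_add_zsmul_eq m φ hi
  have h2 := hper.intervalIntegral_add_eq φ 0
  rw [zero_add] at h2
  have h3 := integral_add_adjacent_intervals (hi 0 φ) (hi φ (φ + m * (2 * Real.pi)))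
  have hexp : ∀ z : ℂ, exp (z + (m : ℂ) * (2 * Real.pi) * I) = exp z := by
    intro z
    rw [exp_eq_exp_iff_exists_int]
    exact ⟨m, by ring⟩
  have h4 : exp ((φ + m * (2 * Real.pi) : ℝ) * I) = exp (φ * I) := by
    rw [← hexp (φ * I)]; push_cast; ring_nf
  have h5 : exp (k * (φ + m * (2 * Real.pi) : ℝ) * I) = exp (k * φ * I) := by
    rw [exp_eq_exp_iff_exists_int]
    exact ⟨k * m, by push_cast; ring⟩
  simp only [zsmul_eq_mul] at h1
  rw [contour, contour, ← h3, h1, h2, h5]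
  unfold ray
  rw [h4]
  ring

lemma exists_ang_mul (g h : GN N) :
    ∃ m : ℤ, ang g + ang h = ang (g * h) + m * (2 * Real.pi) := by
  have h1 : ((ang (g * h) : ℝ) : Real.Angle) = ((ang g + ang h : ℝ) : Real.Angle) := by
    rw [ang, mul_α, Units.val_mul, arg_mul_coe_angle g.α.ne_zero h.α.ne_zero, Real.Angle.coe_add]
    rfl
  obtain ⟨m, hm⟩ := Real.Angle.angle_eq_iff_two_pi_dvd_sub.1 h1
  exact ⟨-m, by push_cast; linarith⟩

/-- Written as differences of contours of δ, the three functions ρ_N telescope except that the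
angles ψ_g + ψ_h and ψ_{gh} may differ by 2πm. The m extra circles give the Laurent coefficient. -/
theorem rho_smul (g h : GN N) {δ : Param N} (hδ : δ ∈ stableDomain N) (k : ℤ) :
    rho (ang g) (h • δ) k = J h k δ.θ * (rho (ang (g * h)) δ k - rho (ang h) δ k +
      I * (ang g + ang h - ang (g * h) : ℝ) * laurentCoeff (fun u => F u δ) 0 (-k)) := by
  obtain ⟨ω, ⟨h1, h2⟩, h3⟩ := (((eventually_isBaseAngle (ang_mem g).1 (h • δ)).and
    (eventually_isBaseAngle (ang_mem (g * h)).1 δ)).and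
    (eventually_isBaseAngle (ang_mem h).1 δ)).exists
  obtain ⟨r', hr'⟩ := exists_isAdmissible (h • δ)
  have hr := hr'.of_smul
  obtain ⟨m, hm⟩ := exists_ang_mul g h
  have e1 : ang g + ω + ang h = ang (g * h) + ω + m * (2 * Real.pi) := by linarith
  have e2 : ang g + ang h - ang (g * h) = m * (2 * Real.pi) := by linarith
  rw [h1.rho_eq (ang_mem g).2 (smul_mem_stableDomain h hδ) hr',
    h2.rho_eq (ang_mem _).2 hδ hr, h3.rho_eq (ang_mem h).2 hδ hr, hr.laurentCoeff_eq, e2,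
    contour_smul hr', contour_smul hr', e1, contour_add_two_pi_mul hr, add_comm ω]
  have hpi : (Real.pi : ℂ) ≠ 0 := ofReal_ne_zero.2 Real.pi_ne_zero
  push_cast
  field_simp
  ring

end BarnesL

/-! ### The main theorem -/

theorem theorem2 (N : ℕ) (hN : 0 < N) :
    -- the group acts on the domain
    (∀ (g : BarnesL.GN N), ∀ δ ∈ BarnesL.stableDomain N, g • δ ∈ BarnesL.stableDomain N) ∧
    -- the function `𝓛_N` is well defined there, with every admissible choice of radii
    (∀ s ∉ BarnesL.PN N, ∀ δ ∈ BarnesL.stableDomain N, ∀ ε ∈ BarnesL.radii N,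
      (∀ᶠ ω in 𝓝[<] (0 : ℝ), Tendsto (fun z => BarnesL.LFormula ε z (BarnesL.rot ω δ)) (𝓝[≠] s)
        (𝓝 (BarnesL.LEps ε s (BarnesL.rot ω δ)))) ∧
      Tendsto (fun ω => BarnesL.LEps ε s (BarnesL.rot ω δ)) (𝓝[<] (0 : ℝ))
        (𝓝 (BarnesL.L s δ))) ∧
    -- the limit of residue sums exists for `Re(s) < 1` and has a unique continuation
    (∀ (g : BarnesL.GN N), ∀ δ ∈ BarnesL.stableDomain N,
      ∃! ρ : ℂ → ℂ, BarnesL.IsRho (BarnesL.ang g) δ ρ) ∧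
    -- the transformation formula
    (∀ (g : BarnesL.GN N), ∀ s ∉ BarnesL.PN N, ∀ δ ∈ BarnesL.stableDomain N,
      BarnesL.L s (g • δ) = BarnesL.J g s δ.θ *
        (BarnesL.L s δ + BarnesL.rho (BarnesL.ang g) δ s / Complex.Gamma s)) ∧
    -- the cocycle property (`G_N` acting on functions on `𝔻_N` by composition on the right)
    (∀ k : ℤ, groupCohomology.IsMulCocycle₁
      (fun g : (BarnesL.GN N)ᵈᵐᵃ => BarnesL.Junit k (DomMulAct.mk.symm g))) ∧
    -- the transformation rule for `ρ_N` at integers, away from poles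
    (∀ (g h : BarnesL.GN N), ∀ δ ∈ BarnesL.stableDomain N, ∀ k : ℤ,
      AnalyticAt ℂ (BarnesL.rho (BarnesL.ang g) (h • δ)) k →
      AnalyticAt ℂ (BarnesL.rho (BarnesL.ang (g * h)) δ) k →
      AnalyticAt ℂ (BarnesL.rho (BarnesL.ang h) δ) k →
      BarnesL.rho (BarnesL.ang g) (h • δ) k = BarnesL.J h k δ.θ *
        (BarnesL.rho (BarnesL.ang (g * h)) δ k - BarnesL.rho (BarnesL.ang h) δ k
          + Complex.I * (BarnesL.ang g + BarnesL.ang h - BarnesL.ang (g * h) : ℝ)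
            * BarnesL.laurentCoeff (fun u => BarnesL.F u δ) 0 (-k))) := by
  refine ⟨fun g δ hδ => BarnesL.smul_mem_stableDomain g hδ,
    fun s hs δ hδ ε hε => ⟨?_, BarnesL.tendsto_LEps hδ hs hε⟩,
    fun g δ hδ => BarnesL.existsUnique_isRho (BarnesL.ang_mem g) hδ,
    fun g s hs δ hδ => BarnesL.L_smul g hδ hs, fun k g h => ?_,
    fun g h δ hδ k _ _ _ => BarnesL.rho_smul g h hδ k⟩
  · filter_upwards [BarnesL.tendsto_LFormula hδ hs hε] with ω hω
    exact tendsto_nhds_limUnder ⟨_, hω⟩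
  · funext δ
    refine Units.ext ?_
    -- Multiplication in `DomMulAct` is reversed, hence the interchange of g and h.
    have h1 := BarnesL.J_mul (DomMulAct.mk.symm h) (DomMulAct.mk.symm g) k δ
    exact h1
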